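/- Let $n\ge 1$, write points of $\mathbb R^{2n}$ as $(x,v)$ with $x,v\in\mathbb R^n$, let $\langle x\rangle=(1+|x|^2)^{1/2}$, and let all operators act in $L^2=L^2(\mathbb R^{2n};\mathbb C)$ with operator norm $\|\cdot\|$. Let $$P_0=-\Delta_v+\tfrac14|v|^2-\tfrac n2+v\cdot\nabla_x,\qquad D(P_0)=\{f\in L^2:\ P_0f\in L^2\}$$ ($P_0f$ in the sense of distributions), and let $R_0(\zeta)=(P_0-\zeta)^{-1}$. Let $V:\mathbb R^n\to\mathbb R$ be of class $C^1$ such that, for some $\rho>-1$ and $C>0$, $$|V(x)|+\langle x\rangle|\nabla V(x)|\le C\langle x\rangle^{-\rho},\qquad x\in\mathbb R^n ,$$ and let $P=P_0-\nabla V(x)\cdot\nabla_v$ with domain $D(P)=D(P_0)$. Let $\sigma_d(P)$ be the discrete spectrum of $P$, i.e. the set of eigenvalues that are isolated points of the spectrum and have finite algebraic multiplicity. For $\zeta\in\mathbb C\setminus[0,\infty)$ put $$\tau(\zeta)=\min\Big\{\Big(\|v\cdot\nabla_vR_0(\zeta)\|+\Big\|v\cdot\frac{x}{\langle x\rangle}R_0(\zeta)\Big\|+\|R_0(\zeta)\|\Big)^{-1},\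 \|R_0(\zeta)\|^{-1/2}\Big\}.$$ Then for every $\zeta\in\mathbb C\setminus[0,\infty)$ the resolvent $R_0(\zeta)$ exists, the three norms are finite, and $0<\tau(\zeta)<\infty$. Moreover $\sigma_d(P)\subset\mathbb C\setminus[0,\infty)$, and there is a constant $c_0>0$, independent of $z$ and $u$, such that for every $z\in\sigma_d(P)$ and every eigenfunction $u\in D(P)$, $u\ne0$, $Pu=zu$, one has $$e^{c_0\tau(z)(\langle x\rangle+|v|^2)}\,u\in L^2 .$$ -/

import Mathlib

open MeasureTheory SchwartzMap
open scoped NNReal ENNReal LineDeriv ContDiff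

noncomputable section

namespace KFP

/-! ### Unbounded operators on a complex Banach space -/

section Abstract

variable {H : Type*} [NormedAddCommGroup H] [NormedSpace ℂ H]

/-- `R` is a bounded two-sided inverse of `T - z : D(T) → H`. -/
def IsResolventAt (T : H →ₗ.[ℂ] H) (z : ℂ) (R : H →L[ℂ] H) : Prop :=
  (∀ f : H, ∃ h : R f ∈ T.domain, T ⟨R f, h⟩ - z • R f = f) ∧
    ∀ u : T.domain, R (T u - z • (u : H)) = u

/-- The resolvent set of an unbounded operator. -/
def resolventSet (T : H →ₗ.[ℂ] H) : Set ℂ :=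
  {z | ∃ R : H →L[ℂ] H, IsResolventAt T z R}

/-- The spectrum of an unbounded operator. -/
def spectrum (T : H →ₗ.[ℂ] H) : Set ℂ := (resolventSet T)ᶜ

open Classical in
/-- The resolvent `(T - z)⁻¹` for `z` in the resolvent set (and `0` elsewhere). -/
def resolvent (T : H →ₗ.[ℂ] H) (z : ℂ) : H →L[ℂ] H :=
  if h : z ∈ resolventSet T then Classical.choose h else 0

/-- The inverse of `T - z` is unique. -/
theorem IsResolventAt.unique {T : H →ₗ.[ℂ] H} {z : ℂ} {R S : H →L[ℂ] H}
    (hR : IsResolventAt T z R) (hS : IsResolventAt T z S) : R = S := by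
  ext f
  obtain ⟨h, hf⟩ := hS.1 f
  have := hR.2 ⟨S f, h⟩
  rw [hf] at this
  exact this

theorem IsResolventAt.resolvent_eq {T : H →ₗ.[ℂ] H} {z : ℂ} {R : H →L[ℂ] H}
    (hR : IsResolventAt T z R) : resolvent T z = R := by
  have h : z ∈ resolventSet T := ⟨R, hR⟩
  rw [resolvent, dif_pos h]
  exact (Classical.choose_spec h).unique hR

/-- The Riesz integral `-(2πi)⁻¹ ∮ (T - w)⁻¹ dw` over the circle `|w - z| = r`. -/
def rieszProjection (T : H →ₗ.[ℂ] H) (z : ℂ) (r : ℝ) : H →L[ℂ] H :=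
  -((2 * (Real.pi : ℂ) * Complex.I)⁻¹ • ∮ w in C(z, r), resolvent T w)

/-- The discrete spectrum: eigenvalues which are isolated points of the spectrum and whose
algebraic multiplicity, the rank of the Riesz projection, is finite. -/
def discreteSpectrum (T : H →ₗ.[ℂ] H) : Set ℂ :=
  {z | (∃ u : T.domain, (u : H) ≠ 0 ∧ T u = z • (u : H)) ∧
    ∃ r : ℝ, 0 < r ∧ (∀ w ∈ Metric.closedBall z r, w ≠ z → w ∈ resolventSet T) ∧
      FiniteDimensional ℂ (LinearMap.range (rieszProjection T z r).toLinearMap)}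

/-- The operator norm of `A ∘ R` on `H`, where `A` is unbounded and `R` is bounded; it is `∞` if
the range of `R` is not contained in `D(A)` or if `A ∘ R` is not bounded. -/
def compNorm (A : H →ₗ.[ℂ] H) (R : H →L[ℂ] H) : ℝ≥0∞ :=
  ⨅ (C : ℝ≥0) (_ : ∀ f : H, ∃ h : R f ∈ A.domain, ‖A ⟨R f, h⟩‖ ≤ C * ‖f‖), (C : ℝ≥0∞)

/-- The domain `{u ∈ D(B) : B u ∈ D(A)}` of the composition `A ∘ B`. -/
def compDomain (A B : H →ₗ.[ℂ] H) : Submodule ℂ H :=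
  (A.domain.comap B.toFun).map B.domain.subtype

theorem mem_compDomain {A B : H →ₗ.[ℂ] H} {u : H} :
    u ∈ compDomain A B ↔ ∃ h : u ∈ B.domain, B ⟨u, h⟩ ∈ A.domain := by
  constructor
  · rintro ⟨w, hw, rfl⟩
    exact ⟨w.2, hw⟩
  · rintro ⟨h, hw⟩
    exact ⟨⟨u, h⟩, hw, rfl⟩

/-- The composition `A ∘ B`, with domain `{u ∈ D(B) : B u ∈ D(A)}`. -/
def compOp (A B : H →ₗ.[ℂ] H) : H →ₗ.[ℂ] H where
  domain := compDomain A B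
  toFun :=
    { toFun := fun u => A ⟨B ⟨u, (mem_compDomain.1 u.2).1⟩, (mem_compDomain.1 u.2).2⟩
      map_add' := fun a b => by
        rw [← LinearPMap.map_add]
        congr 1
        exact Subtype.ext (LinearPMap.map_add B ⟨a, (mem_compDomain.1 a.2).1⟩
          ⟨b, (mem_compDomain.1 b.2).1⟩)
      map_smul' := fun c a => by
        rw [RingHom.id_apply, ← LinearPMap.map_smul]
        congr 1
        exact Subtype.ext (LinearPMap.map_smul B c ⟨a, (mem_compDomain.1 a.2).1⟩) }

end Abstract

/-! ### Operators on `L²` of the phase space -/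

/-- The configuration space `ℝⁿ`. -/
abbrev Conf (n : ℕ) : Type := EuclideanSpace ℝ (Fin n)

/-- The phase space `ℝ²ⁿ`, with points `p = (x, v)`. -/
abbrev Phase (n : ℕ) : Type := Conf n × Conf n

instance (n : ℕ) : (volume : Measure (Phase n)).IsAddHaarMeasure :=
  Measure.prod.instIsAddHaarMeasure (volume : Measure (Conf n)) (volume : Measure (Conf n))

/-- `L²(ℝ²ⁿ; ℂ)` for Lebesgue measure. -/
abbrev L2 (n : ℕ) : Type := Lp ℂ 2 (volume : Measure (Phase n))

/-- The embedding of `L²` into the tempered distributions. -/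
def toDist (n : ℕ) : L2 n →ₗ[ℂ] 𝓢'(Phase n, ℂ) :=
  (Lp.toTemperedDistributionCLM ℂ (volume : Measure (Phase n)) 2).toLinearMap

theorem toDist_injective (n : ℕ) : Function.Injective (toDist n) :=
  LinearMap.ker_eq_bot.1 Lp.ker_toTemperedDistributionCLM_eq_bot

/-- The maximal realization in `L²` of an operator `A` on tempered distributions: its domain is
`{u ∈ L² : A u ∈ L²}`, and it acts as `A`. -/
def maximal {n : ℕ} (A : 𝓢'(Phase n, ℂ) →L[ℂ] 𝓢'(Phase n, ℂ)) : L2 n →ₗ.[ℂ] L2 n where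
  domain := (LinearMap.range (toDist n)).comap (A.toLinearMap ∘ₗ toDist n)
  toFun := (LinearEquiv.ofInjective (toDist n) (toDist_injective n)).symm.toLinearMap ∘ₗ
    (((A.toLinearMap ∘ₗ toDist n).domRestrict _).codRestrict _ fun u => u.2)

theorem toDist_maximal {n : ℕ} (A : 𝓢'(Phase n, ℂ) →L[ℂ] 𝓢'(Phase n, ℂ))
    (u : (maximal A).domain) : toDist n (maximal A u) = A (toDist n u) :=
  congrArg Subtype.val
    ((LinearEquiv.ofInjective (toDist n) (toDist_injective n)).apply_symm_apply _)

/-- The functions `u ∈ L²` with `m u ∈ L²`. -/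
def mulDomain {n : ℕ} (m : Phase n → ℂ) : Submodule ℂ (L2 n) where
  carrier := {u | MemLp (fun p => m p * u p) 2 volume}
  add_mem' := fun {a b} ha hb => (MemLp.add ha hb).ae_eq (by
    filter_upwards [Lp.coeFn_add a b] with p hp
    rw [hp, Pi.add_apply, Pi.add_apply, mul_add])
  zero_mem' := (MemLp.zero (p := 2) (ε := ℂ)).ae_eq (by
    filter_upwards [Lp.coeFn_zero ℂ 2 (volume : Measure (Phase n))] with p hp
    rw [hp, Pi.zero_apply, mul_zero])
  smul_mem' := fun c a ha => (MemLp.const_mul ha c).ae_eq (by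
    filter_upwards [Lp.coeFn_smul c a] with p hp
    rw [hp, Pi.smul_apply, smul_eq_mul, mul_left_comm])

/-- The operator of multiplication by the function `m`, with its maximal domain. -/
def mulOp {n : ℕ} (m : Phase n → ℂ) : L2 n →ₗ.[ℂ] L2 n where
  domain := mulDomain m
  toFun :=
    { toFun := fun u => MemLp.toLp (fun p => m p * (u : L2 n) p) u.2
      map_add' := fun a b => by
        refine Eq.trans ?_ (MemLp.toLp_add a.2 b.2)
        refine MemLp.toLp_congr _ _ ?_
        filter_upwards [Lp.coeFn_add (a : L2 n) b] with p hp
        rw [Submodule.coe_add, hp, Pi.add_apply, Pi.add_apply, mul_add]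
      map_smul' := fun c a => by
        refine Eq.trans ?_ (MemLp.toLp_const_smul c a.2)
        refine MemLp.toLp_congr _ _ ?_
        filter_upwards [Lp.coeFn_smul c (a : L2 n)] with p hp
        rw [Submodule.coe_smul, hp, Pi.smul_apply, Pi.smul_apply, smul_eq_mul, smul_eq_mul,
          mul_left_comm] }

/-! ### The Kramers-Fokker-Planck operator -/

/-- The partial derivative `∂_{x_i}` of tempered distributions on the phase space. -/
def dx {n : ℕ} (i : Fin n) : 𝓢'(Phase n, ℂ) →L[ℂ] 𝓢'(Phase n, ℂ) :=
  LineDeriv.lineDerivOpCLM ℂ 𝓢'(Phase n, ℂ) ((EuclideanSpace.single i 1, 0) : Phase n)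

/-- The partial derivative `∂_{v_i}` of tempered distributions on the phase space. -/
def dv {n : ℕ} (i : Fin n) : 𝓢'(Phase n, ℂ) →L[ℂ] 𝓢'(Phase n, ℂ) :=
  LineDeriv.lineDerivOpCLM ℂ 𝓢'(Phase n, ℂ) ((0, EuclideanSpace.single i 1) : Phase n)

/-- Multiplication of tempered distributions by `v_i`. -/
def mulV {n : ℕ} (i : Fin n) : 𝓢'(Phase n, ℂ) →L[ℂ] 𝓢'(Phase n, ℂ) :=
  TemperedDistribution.smulLeftCLM ℂ fun p : Phase n => ((p.2 i : ℝ) : ℂ)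

/-- Multiplication of tempered distributions by `|v|²`. -/
def mulNormSqV (n : ℕ) : 𝓢'(Phase n, ℂ) →L[ℂ] 𝓢'(Phase n, ℂ) :=
  TemperedDistribution.smulLeftCLM ℂ fun p : Phase n => ((‖p.2‖ ^ 2 : ℝ) : ℂ)

theorem hasTemperateGrowth_v {n : ℕ} (i : Fin n) :
    (fun p : Phase n => ((p.2 i : ℝ) : ℂ)).HasTemperateGrowth :=
  (Complex.ofRealCLM ∘L (EuclideanSpace.proj i : Conf n →L[ℝ] ℝ) ∘L
    ContinuousLinearMap.snd ℝ (Conf n) (Conf n)).hasTemperateGrowth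

theorem hasTemperateGrowth_normSq_v (n : ℕ) :
    (fun p : Phase n => ((‖p.2‖ ^ 2 : ℝ) : ℂ)).HasTemperateGrowth :=
  Function.HasTemperateGrowth.comp Function.Complex.hasTemperateGrowth_ofReal
    (Function.HasTemperateGrowth.comp (Function.hasTemperateGrowth_norm_sq (H := Conf n))
      (ContinuousLinearMap.snd ℝ (Conf n) (Conf n)).hasTemperateGrowth)

/-- The differential expression `-Δ_v + |v|²/4 - n/2 + v·∇_x` on tempered distributions. -/
def freeExpr (n : ℕ) : 𝓢'(Phase n, ℂ) →L[ℂ] 𝓢'(Phase n, ℂ) :=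
  -(∑ i, dv i ∘L dv i) + (1 / 4 : ℂ) • mulNormSqV n
    - ((n : ℂ) / 2) • ContinuousLinearMap.id ℂ 𝓢'(Phase n, ℂ) + ∑ i, mulV i ∘L dx i

/-- The free operator `P₀`, with domain `D(P₀) = {f ∈ L² : P₀ f ∈ L²}`. -/
def P0 (n : ℕ) : L2 n →ₗ.[ℂ] L2 n := maximal (freeExpr n)

/-- The perturbation `W = -∇V(x)·∇_v`, with weak derivatives in `L²`. -/
def W {n : ℕ} (V : Conf n → ℝ) : L2 n →ₗ.[ℂ] L2 n :=
  -∑ i, compOp (mulOp fun p => ((gradient V p.1 i : ℝ) : ℂ)) (maximal (dv i))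

/-- The operator `P = P₀ + W`, with domain `D(P₀) ∩ D(W)`. When `∇V` is bounded, `D(P₀) ⊆ D(W)` by
the subelliptic estimate for `P₀`, so that the domain is `D(P₀)`. -/
def P {n : ℕ} (V : Conf n → ℝ) : L2 n →ₗ.[ℂ] L2 n := P0 n + W V

/-- The bracket `⟨x⟩ = (1 + |x|²)^{1/2}`. -/
def bracket {n : ℕ} (x : Conf n) : ℝ := Real.sqrt (1 + ‖x‖ ^ 2)

/-- The operator `v·∇_v` in `L²`. -/
def vGradV (n : ℕ) : L2 n →ₗ.[ℂ] L2 n := maximal (∑ i, mulV i ∘L dv i)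

/-- Multiplication by `v·x/⟨x⟩` in `L²`. -/
def mulVX (n : ℕ) : L2 n →ₗ.[ℂ] L2 n :=
  mulOp fun p => ((inner ℝ p.2 p.1 / bracket p.1 : ℝ) : ℂ)

/-- The free resolvent `R₀(ζ) = (P₀ - ζ)⁻¹`. -/
def R0 (n : ℕ) (ζ : ℂ) : L2 n →L[ℂ] L2 n := resolvent (P0 n) ζ

/-- `τ(ζ) = min {(‖v·∇_v R₀(ζ)‖ + ‖v·x/⟨x⟩ R₀(ζ)‖ + ‖R₀(ζ)‖)⁻¹, ‖R₀(ζ)‖^{-1/2}}`. The minimum is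
taken in `[0, ∞]`, and both `0` and `∞` are sent to `0`; so `0 < τ(ζ)` contains the assertion that
`R₀(ζ)` exists and that the three operators are bounded. -/
def tau (n : ℕ) (ζ : ℂ) : ℝ :=
  (min (compNorm (vGradV n) (R0 n ζ) + compNorm (mulVX n) (R0 n ζ) +
      ENNReal.ofReal ‖R0 n ζ‖)⁻¹
    (ENNReal.ofReal ‖R0 n ζ‖ ^ (-(1 / 2) : ℝ))).toReal

/-- The half-line `[0, ∞[` in the complex plane. -/
def halfLine : Set ℂ := {z | 0 ≤ z.re ∧ z.im = 0}

end KFP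

end

noncomputable section

namespace KFP

section

/-! ### Operators on Schwartz functions of the phase space -/

/-! Write `ann`, `cre` for the annihilation and creation operators in `v`, so that `P₀ = ∑ cre ann +
∑ v_i ∂_{x_i}` with `v_i = ann_i + cre_i`. Completing the square gives `P₀ = ∑ rais low - Δ_x` with
`low = ann + ∂_x` and `rais = cre + ∂_x`, which obey the canonical commutation relations without
being adjoint to each other (`opT_eq`, `low_rais`). The functions `g(x - v) e^{-|v|²/4}` are killed
by every `low`, and `rais` shifts `P₀` by one. Hence on the span `Core` of all raised functions the
equation `(P₀ - z)u = f` is solved by inverting `-Δ - z + k` for integers `k ≥ 0`, for every `z`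
outside the half-line (`Core.exists_opT_eq`).

Boundedness of that inverse is an induction on `Re z` (`aPriori`): for `Re z < 0` it is accretivity,
and `APriori.step` passes from `z - 1` to `z`. Since `Core` is dense (`coreL2_dense`) and the
maximal operator is injective by a duality argument (`P0_injective`), `R₀(z)` exists, and Schwartz
functions form a core of `P₀`. Energy estimates bound `v·∇_v` and `v·x/⟨x⟩` relative to `P₀`, whence
`0 < τ` (`tau_pos`). Testing on high Hermite functions gives `‖v·∇_v R₀‖ ≥ 1/2`, so `τ ≤ 2`
(`tau_le_two`).

The hypothesis on `V` enters only through the fact that `∇V` is continuous, bounded and tends to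
zero. Translating test functions to infinity in `x` removes the perturbation, so a bounded inverse
of `P - z` would give a lower bound for `P₀ - z`. On the half-line, Weyl sequences of `-Δ` exclude
this. Thus the half-line lies in the spectrum of `P` and contains no isolated point of it
(`not_mem_resolventSet_P`).

For the decay, the eigenvalue equation `(P₀ - z)u = ∇V·∇_v u` is tested with the bounded weights
`exp(κ f/(1 + ε f))`, with bounds uniform in `ε`. For `f = |v|²` and `κ ≤ 1/8` the harmonic
potential absorbs the error (`memLp_exp_sqv`). For `f = ⟨x⟩` the commutator with `P₀` is at most `κ`
times the weight times `|v·x|/⟨x⟩`, which is absorbed when `κ ≤ τ/4`; the perturbation is small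
outside a ball (`memLp_exp_bracket`). The bound `τ ≤ 2` makes both apply with `κ = τ/16`, and the
two decays combine to the constant `1/32`. -/

/-- The Schwartz space of the phase space. -/
abbrev Sch (n : ℕ) : Type := 𝓢(Phase n, ℂ)

/-- The embedding of Schwartz functions into `L²`. -/
def emb {n : ℕ} : Sch n →ₗ[ℂ] L2 n :=
  (SchwartzMap.toLpCLM ℂ ℂ 2 (volume : Measure (Phase n))).toLinearMap

/-- The directional derivative of Schwartz functions. -/
def sder {n : ℕ} (m : Phase n) : Sch n →ₗ[ℂ] Sch n :=
  (LineDeriv.lineDerivOpCLM ℂ (Sch n) m).toLinearMap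

/-- Multiplication of Schwartz functions by a function of temperate growth. -/
def smulS {n : ℕ} (g : Phase n → ℂ) : Sch n →ₗ[ℂ] Sch n :=
  (SchwartzMap.smulLeftCLM ℂ g).toLinearMap

/-- The direction of `x_i`. -/
def ex {n : ℕ} (i : Fin n) : Phase n := (EuclideanSpace.single i 1, 0)

/-- The direction of `v_i`. -/
def ev {n : ℕ} (i : Fin n) : Phase n := (0, EuclideanSpace.single i 1)

/-- The coordinate function `v_i`. -/
def cv {n : ℕ} (i : Fin n) : Phase n → ℂ := fun p => ((p.2 i : ℝ) : ℂ)

theorem emb_eq {n : ℕ} (u : Sch n) : emb u = u.toLp 2 volume := rfl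

theorem coeFn_emb {n : ℕ} (u : Sch n) : emb u =ᵐ[volume] u := u.coeFn_toLp 2 volume

theorem sder_apply {n : ℕ} (m : Phase n) (u : Sch n) (p : Phase n) :
    sder m u p = fderiv ℝ u p m := rfl

theorem smulS_apply {n : ℕ} {g : Phase n → ℂ} (hg : g.HasTemperateGrowth) (u : Sch n)
    (p : Phase n) : smulS g u p = g p * u p :=
  SchwartzMap.smulLeftCLM_apply_apply hg u p

theorem inner_emb {n : ℕ} (u w : Sch n) :
    inner ℂ (emb u) (emb w) = ∫ p, starRingEnd ℂ (u p) * w p := by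
  rw [emb_eq, emb_eq, SchwartzMap.inner_toL2_toL2_eq u w volume]
  simp only [RCLike.inner_apply, mul_comm]

theorem inner_sder {n : ℕ} (m : Phase n) (u w : Sch n) :
    inner ℂ (emb u) (emb (sder m w)) = -inner ℂ (emb (sder m u)) (emb w) := by
  rw [inner_emb, inner_emb]
  exact SchwartzMap.integral_bilinear_lineDerivOp_right_eq_neg_left u w
    ((ContinuousLinearMap.mul ℝ ℂ).comp (Complex.conjCLE : ℂ →L[ℝ] ℂ)) m

theorem inner_smulS {n : ℕ} {g : Phase n → ℂ} (hg : g.HasTemperateGrowth)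
    (hr : ∀ p, starRingEnd ℂ (g p) = g p) (u w : Sch n) :
    inner ℂ (emb u) (emb (smulS g w)) = inner ℂ (emb (smulS g u)) (emb w) := by
  rw [inner_emb, inner_emb]
  congr 1
  ext p
  rw [smulS_apply hg, smulS_apply hg, map_mul, hr]
  ring

theorem sder_comm {n : ℕ} (m m' : Phase n) (u : Sch n) :
    sder m (sder m' u) = sder m' (sder m u) := by
  ext p
  have h2 : ∀ a b : Phase n, sder a (sder b u) p = fderiv ℝ (fderiv ℝ u) p a b := by
    intro a b
    rw [sder_apply]
    have : (sder b u : Phase n → ℂ) = fun q => fderiv ℝ u q b := rfl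
    rw [this, fderiv_clm_apply]
    · simp
    · have h := u.smooth 2
      exact (h.fderiv_right (m := 1) (by norm_num)).differentiable (by norm_num) p
    · exact differentiableAt_const _
  rw [h2, h2]
  exact second_derivative_symmetric (f := u) (f' := fderiv ℝ u)
    (fun y => u.differentiableAt.hasFDerivAt)
    ((((u.smooth 2).fderiv_right (m := 1) (by norm_num)).differentiable
      (by norm_num) p).hasFDerivAt) _ _

theorem sder_smulS {n : ℕ} {g g' : Phase n → ℂ} (hg : g.HasTemperateGrowth)
    (hg' : g'.HasTemperateGrowth) (m : Phase n) (h : ∀ p, fderiv ℝ g p m = g' p) (u : Sch n) :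
    sder m (smulS g u) = smulS g (sder m u) + smulS g' u := by
  ext p
  rw [_root_.add_apply, smulS_apply hg, smulS_apply hg', sder_apply, sder_apply]
  have : (smulS g u : Phase n → ℂ) = fun q => g q * u q := funext fun q => smulS_apply hg u q
  rw [this, fderiv_fun_mul (hg.1.differentiable (by simp) p) u.differentiableAt]
  simp [← h p]
  ring

theorem smulS_comm {n : ℕ} {g h : Phase n → ℂ} (hg : g.HasTemperateGrowth)
    (hh : h.HasTemperateGrowth) (u : Sch n) : smulS g (smulS h u) = smulS h (smulS g u) := by
  ext p
  simp only [smulS_apply hg, smulS_apply hh]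
  ring

theorem cv_temperate {n : ℕ} (i : Fin n) : (cv i : Phase n → ℂ).HasTemperateGrowth :=
  hasTemperateGrowth_v i

theorem conj_cv {n : ℕ} (i : Fin n) (p : Phase n) : starRingEnd ℂ (cv i p) = cv i p :=
  Complex.conj_ofReal _

theorem fderiv_cv {n : ℕ} (i : Fin n) (p m : Phase n) : fderiv ℝ (cv i) p m = ((m.2 i : ℝ) : ℂ) := by
  have : (cv i : Phase n → ℂ) = (Complex.ofRealCLM ∘L (EuclideanSpace.proj i : Conf n →L[ℝ] ℝ) ∘L
    ContinuousLinearMap.snd ℝ (Conf n) (Conf n)) := rfl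
  rw [this, ContinuousLinearMap.fderiv]
  rfl

variable {n : ℕ}

/-- The derivative `∂_{x_i}` on Schwartz functions. -/
def sdx (i : Fin n) : Sch n →ₗ[ℂ] Sch n := sder (ex i)

/-- The derivative `∂_{v_i}` on Schwartz functions. -/
def sdv (i : Fin n) : Sch n →ₗ[ℂ] Sch n := sder (ev i)

/-- Multiplication by `v_i` on Schwartz functions. -/
def smv (i : Fin n) : Sch n →ₗ[ℂ] Sch n := smulS (cv i)

/-- The annihilation operator `∂_{v_i} + v_i/2`. -/
def ann (i : Fin n) : Sch n →ₗ[ℂ] Sch n := sdv i + (1 / 2 : ℂ) • smv i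

/-- The creation operator `-∂_{v_i} + v_i/2`. -/
def cre (i : Fin n) : Sch n →ₗ[ℂ] Sch n := -sdv i + (1 / 2 : ℂ) • smv i

/-- The annihilation operator `∂_{v_i} + v_i/2 + ∂_{x_i}` adapted to the free operator. -/
def low (i : Fin n) : Sch n →ₗ[ℂ] Sch n := ann i + sdx i

/-- The creation operator `-∂_{v_i} + v_i/2 + ∂_{x_i}` adapted to the free operator. -/
def rais (i : Fin n) : Sch n →ₗ[ℂ] Sch n := cre i + sdx i

/-- The Laplacian in `x` on Schwartz functions. -/
def lapx : Sch n →ₗ[ℂ] Sch n := ∑ i, sdx i ∘ₗ sdx i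

/-- The operator `P₀ - z` on Schwartz functions. -/
def opT (z : ℂ) : Sch n →ₗ[ℂ] Sch n :=
  ∑ i, cre i ∘ₗ ann i + ∑ i, smv i ∘ₗ sdx i - z • LinearMap.id

theorem sdv_smv (i j : Fin n) (u : Sch n) :
    sdv i (smv j u) = smv j (sdv i u) + (if i = j then (1 : ℂ) else 0) • u := by
  have h := sder_smulS (cv_temperate j) (g' := fun _ => if i = j then (1 : ℂ) else 0)
    (Function.HasTemperateGrowth.const _) (ev i) (fun p => by
      rw [fderiv_cv]
      simp only [ev, PiLp.single_apply, eq_comm (a := j)]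
      split_ifs <;> simp) u
  refine h.trans ?_
  congr 1
  ext p
  rw [smulS_apply (Function.HasTemperateGrowth.const _)]
  rfl

theorem sdx_smv (i j : Fin n) (u : Sch n) : sdx i (smv j u) = smv j (sdx i u) := by
  have h := sder_smulS (cv_temperate j) (g' := fun _ => (0 : ℂ))
    (Function.HasTemperateGrowth.const _) (ex i) (fun p => by
      rw [fderiv_cv]
      simp [ex]) u
  refine h.trans ?_
  have : smulS (fun _ => (0 : ℂ)) u = 0 := by
    ext p
    rw [smulS_apply (Function.HasTemperateGrowth.const _), zero_mul]
    rfl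
  rw [this, add_zero]
  rfl

theorem smv_comm (i j : Fin n) (u : Sch n) : smv i (smv j u) = smv j (smv i u) :=
  smulS_comm (cv_temperate i) (cv_temperate j) u

theorem sdx_comm (i j : Fin n) (u : Sch n) : sdx i (sdx j u) = sdx j (sdx i u) := sder_comm _ _ u

theorem sdv_comm (i j : Fin n) (u : Sch n) : sdv i (sdv j u) = sdv j (sdv i u) := sder_comm _ _ u

theorem sdx_sdv (i j : Fin n) (u : Sch n) : sdx i (sdv j u) = sdv j (sdx i u) := sder_comm _ _ u

theorem ann_apply (i : Fin n) (u : Sch n) : ann i u = sdv i u + (1 / 2 : ℂ) • smv i u := rfl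

theorem cre_apply (i : Fin n) (u : Sch n) : cre i u = -sdv i u + (1 / 2 : ℂ) • smv i u := rfl

theorem low_apply (i : Fin n) (u : Sch n) : low i u = ann i u + sdx i u := rfl

theorem rais_apply (i : Fin n) (u : Sch n) : rais i u = cre i u + sdx i u := rfl

theorem lapx_apply (u : Sch n) : lapx u = ∑ i, sdx i (sdx i u) := by
  simp [lapx, LinearMap.sum_apply]

theorem opT_apply (z : ℂ) (u : Sch n) :
    opT z u = ∑ i, cre i (ann i u) + ∑ i, smv i (sdx i u) - z • u := by
  simp [opT, LinearMap.sum_apply]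

theorem sdx_ann (i j : Fin n) (u : Sch n) : sdx i (ann j u) = ann j (sdx i u) := by
  simp only [ann_apply, map_add, map_smul, sdx_sdv, sdx_smv]

theorem sdx_cre (i j : Fin n) (u : Sch n) : sdx i (cre j u) = cre j (sdx i u) := by
  simp only [cre_apply, map_add, map_neg, map_smul, sdx_sdv, sdx_smv]

theorem sdx_low (i j : Fin n) (u : Sch n) : sdx i (low j u) = low j (sdx i u) := by
  simp only [low_apply, map_add, sdx_ann, sdx_comm i j]

theorem sdx_rais (i j : Fin n) (u : Sch n) : sdx i (rais j u) = rais j (sdx i u) := by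
  simp only [rais_apply, map_add, sdx_cre, sdx_comm i j]

theorem ann_cre (i j : Fin n) (u : Sch n) :
    ann i (cre j u) = cre j (ann i u) + (if i = j then (1 : ℂ) else 0) • u := by
  simp only [cre_apply, ann_apply, map_add, map_neg, map_smul, sdv_smv, sdv_comm i j, smv_comm i j,
    eq_comm (a := j) (b := i)]
  module

theorem cre_comm (i j : Fin n) (u : Sch n) : cre i (cre j u) = cre j (cre i u) := by
  simp only [cre_apply, map_add, map_neg, map_smul, sdv_smv, sdv_comm i j, smv_comm i j,
    eq_comm (a := j) (b := i)]
  module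

theorem ann_comm (i j : Fin n) (u : Sch n) : ann i (ann j u) = ann j (ann i u) := by
  simp only [ann_apply, map_add, map_smul, sdv_smv, sdv_comm i j, smv_comm i j,
    eq_comm (a := j) (b := i)]
  module

theorem ann_add_cre (i : Fin n) (u : Sch n) : ann i u + cre i u = smv i u := by
  rw [ann_apply, cre_apply]
  module

theorem ann_sub_cre (i : Fin n) (u : Sch n) : ann i u - cre i u = (2 : ℂ) • sdv i u := by
  rw [ann_apply, cre_apply]
  module

/-- The added `∂_x` commutes with everything, so the canonical commutation relation of `ann` and
`cre` survives. It is skew, however, so `low` and `rais` are no longer adjoint and no energy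
estimate comes with them. -/
theorem low_rais (i j : Fin n) (u : Sch n) :
    low i (rais j u) = rais j (low i u) + (if i = j then (1 : ℂ) else 0) • u := by
  simp only [low_apply, rais_apply, map_add, ann_cre, sdx_cre, sdx_ann, sdx_comm i j]
  abel

theorem rais_comm (i j : Fin n) (u : Sch n) : rais i (rais j u) = rais j (rais i u) := by
  simp only [rais_apply, map_add, cre_comm i j, sdx_cre, sdx_comm i j]
  abel

theorem lapx_rais (j : Fin n) (u : Sch n) : lapx (rais j u) = rais j (lapx u) := by
  simp only [lapx_apply, map_sum, sdx_rais]

/-- Completion of the square: the transport term `v_i ∂_{x_i} = (ann_i + cre_i) ∂_{x_i}` supplies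
the cross terms of `(cre_i + ∂_{x_i})(ann_i + ∂_{x_i})`, at the price of `∂_{x_i}²`. -/
theorem opT_eq (z : ℂ) (u : Sch n) : opT z u = ∑ i, rais i (low i u) - lapx u - z • u := by
  rw [opT_apply, lapx_apply, ← Finset.sum_add_distrib, ← Finset.sum_sub_distrib]
  congr 1
  refine Finset.sum_congr rfl fun i _ => ?_
  rw [← ann_add_cre]
  simp only [low_apply, rais_apply, map_add, sdx_ann]
  abel

theorem opT_rais (z : ℂ) (j : Fin n) (u : Sch n) : opT z (rais j u) = rais j (opT (z - 1) u) := by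
  simp only [opT_eq, low_rais, map_add, map_sub, map_smul, map_sum, lapx_rais,
    Finset.sum_add_distrib]
  have : ∑ i, (if i = j then (1 : ℂ) else 0) • rais i u = rais j u := by simp
  rw [this, Finset.sum_congr rfl fun i _ => rais_comm i j (low i u)]
  module

theorem sdx_opT (z : ℂ) (j : Fin n) (u : Sch n) : sdx j (opT z u) = opT z (sdx j u) := by
  simp only [opT_apply, map_add, map_sub, map_smul, map_sum, sdx_cre, sdx_ann, sdx_smv, sdx_comm j]

theorem opT_shift (z w : ℂ) (u : Sch n) : opT z u = opT w u + (w - z) • u := by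
  simp only [opT_apply]
  module

/-! ### Formal adjoints and energy identities -/

theorem inner_sdx (i : Fin n) (u w : Sch n) :
    inner ℂ (emb u) (emb (sdx i w)) = -inner ℂ (emb (sdx i u)) (emb w) := inner_sder _ u w

theorem inner_sdv (i : Fin n) (u w : Sch n) :
    inner ℂ (emb u) (emb (sdv i w)) = -inner ℂ (emb (sdv i u)) (emb w) := inner_sder _ u w

theorem inner_smv (i : Fin n) (u w : Sch n) :
    inner ℂ (emb u) (emb (smv i w)) = inner ℂ (emb (smv i u)) (emb w) :=
  inner_smulS (cv_temperate i) (conj_cv i) u w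

theorem inner_cre (i : Fin n) (u w : Sch n) :
    inner ℂ (emb u) (emb (cre i w)) = inner ℂ (emb (ann i u)) (emb w) := by
  simp only [cre_apply, ann_apply, map_add, map_neg, map_smul, inner_add_left, inner_add_right,
    inner_neg_right, inner_smul_left, inner_smul_right, inner_sdv, inner_smv, neg_neg]
  congr 2
  simp [Complex.conj_ofNat]

theorem inner_ann (i : Fin n) (u w : Sch n) :
    inner ℂ (emb u) (emb (ann i w)) = inner ℂ (emb (cre i u)) (emb w) := by
  rw [← inner_conj_symm, ← inner_cre, inner_conj_symm]

/-- A formally skew operator has vanishing real part. -/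
theorem re_inner_eq_zero_of_skew {H : Type*} [NormedAddCommGroup H] [InnerProductSpace ℂ H]
    {a b : H} (h : inner ℂ a b = -inner ℂ b a) : (inner ℂ a b).re = 0 := by
  have h1 := congrArg Complex.re h
  rw [← inner_conj_symm b a] at h1
  simp only [Complex.neg_re, Complex.conj_re] at h1
  linarith

/-- `v_i` is symmetric, `∂_{x_i}` is skew and the two commute, so their product is skew. -/
theorem re_inner_transport (i : Fin n) (u : Sch n) :
    (inner ℂ (emb u) (emb (smv i (sdx i u)))).re = 0 := by
  refine re_inner_eq_zero_of_skew ?_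
  rw [← sdx_smv, inner_sdx, inner_smv, sdx_smv]

theorem re_inner_self {H : Type*} [NormedAddCommGroup H] [InnerProductSpace ℂ H] (a : H) :
    (inner ℂ a a).re = ‖a‖ ^ 2 := by
  rw [inner_self_eq_norm_sq_to_K]
  norm_cast

/-- The skew transport term drops out, which makes `P₀` accretive. -/
theorem re_inner_opT (z : ℂ) (u : Sch n) :
    (inner ℂ (emb u) (emb (opT z u))).re =
      ∑ i, ‖emb (ann i u)‖ ^ 2 - z.re * ‖emb u‖ ^ 2 := by
  rw [opT_apply]
  simp only [map_add, map_sub, map_sum, map_smul, inner_add_right, inner_sub_right, inner_sum,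
    inner_smul_right, inner_cre, Complex.sub_re, Complex.add_re, Complex.re_sum,
    re_inner_transport, re_inner_self]
  rw [inner_self_eq_norm_sq_to_K]
  have : (z * ((‖emb u‖ : ℝ) : ℂ) ^ 2).re = z.re * ‖emb u‖ ^ 2 := by
    rw [← Complex.ofReal_pow, Complex.re_mul_ofReal]
  simp only [Finset.sum_const_zero, add_zero, sub_right_inj]
  exact this

theorem norm_cre_sq (i : Fin n) (u : Sch n) :
    ‖emb (cre i u)‖ ^ 2 = ‖emb (ann i u)‖ ^ 2 + ‖emb u‖ ^ 2 := by
  rw [← re_inner_self, inner_cre, ann_cre, map_add, inner_add_left, ← inner_conj_symm,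
    inner_cre]
  simp only [if_true, one_smul, Complex.add_re, Complex.conj_re, re_inner_self]

end

section

open scoped Nat

/-! ### Functions of temperate growth and Schwartz functions -/

section Temperate

variable {E F : Type*} [NormedAddCommGroup E] [NormedSpace ℝ E] [NormedAddCommGroup F]
  [NormedSpace ℝ F]

/-- The exponential is not temperate on the line, but all its derivatives are bounded on the open
half-line below `M + 1`, which contains the range of `f`. -/
theorem temperate_exp {f : E → ℝ} (hf : f.HasTemperateGrowth) {M : ℝ} (hM : ∀ x, f x ≤ M) :
    (fun x => Real.exp (f x)).HasTemperateGrowth := by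
  refine Function.HasTemperateGrowth.comp' (g := Real.exp) (t := Set.Iio (M + 1)) ?_
    isOpen_Iio.uniqueDiffOn Real.contDiff_exp.contDiffOn ?_ hf
  · rintro - ⟨x, rfl⟩
    exact (hM x).trans_lt (lt_add_one M)
  · intro N
    refine ⟨0, Real.exp (M + 1), (Real.exp_pos _).le, fun k _ x hx => ?_⟩
    rw [norm_iteratedFDerivWithin_eq_norm_iteratedDerivWithin,
      iteratedDerivWithin_eq_iteratedDeriv isOpen_Iio.uniqueDiffOn Real.contDiff_exp.contDiffAt hx,
      iteratedDeriv_eq_iterate, Real.iter_deriv_exp]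
    simpa using (Set.mem_Iio.1 hx).le

/-- The derivatives of the reciprocal are bounded on `(c/2, ∞)`, an open set containing the range of
`f`. -/
theorem temperate_inv {f : E → ℝ} (hf : f.HasTemperateGrowth) {c : ℝ} (hc : 0 < c)
    (h : ∀ x, c ≤ f x) : (fun x => (f x)⁻¹).HasTemperateGrowth := by
  refine Function.HasTemperateGrowth.comp' (g := fun y : ℝ => y⁻¹) (t := Set.Ioi (c / 2)) ?_
    isOpen_Ioi.uniqueDiffOn ?_ ?_ hf
  · rintro - ⟨x, rfl⟩
    exact (half_lt_self hc).trans_le (h x)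
  · exact contDiffOn_id.inv fun x hx => ((half_pos hc).trans hx).ne'
  · intro N
    refine ⟨0, ∑ k ∈ Finset.range (N + 1), (k ! : ℝ) * ((c / 2)⁻¹) ^ (1 + k), by positivity,
      fun k hk x hx => ?_⟩
    have hx0 : 0 < x := (half_pos hc).trans hx
    rw [norm_iteratedFDerivWithin_eq_norm_iteratedDerivWithin,
      iteratedDerivWithin_eq_iteratedDeriv isOpen_Ioi.uniqueDiffOn
        (contDiffAt_inv ℝ hx0.ne') hx, iteratedDeriv_eq_iterate, iter_deriv_inv]
    have h1 : ‖(-1 : ℝ) ^ k * (k ! : ℝ) * x ^ (-1 - k : ℤ)‖ = (k ! : ℝ) * (x⁻¹) ^ (1 + k) := by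
      rw [norm_mul, norm_mul, norm_pow, norm_neg, norm_one, one_pow, one_mul, Real.norm_natCast,
        show (-1 - k : ℤ) = -((1 + k : ℕ) : ℤ) by push_cast; ring, zpow_neg, zpow_natCast, ← inv_pow,
        Real.norm_of_nonneg (by positivity)]
    rw [h1, pow_zero, mul_one]
    refine le_trans ?_ (Finset.single_le_sum (f := fun k => (k ! : ℝ) * ((c / 2)⁻¹) ^ (1 + k))
      (fun i _ => by positivity) (Finset.mem_range.2 (Nat.lt_succ_of_le hk)))
    have : x⁻¹ ≤ (c / 2)⁻¹ := inv_anti₀ (half_pos hc) (le_of_lt hx)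
    gcongr

end Temperate

variable {E F : Type*} [NormedAddCommGroup E] [NormedSpace ℝ E] [NormedAddCommGroup F]
  [NormedSpace ℝ F]

/-- The tensor product of two Schwartz functions. -/
def tensorS (f : 𝓢(E, ℂ)) (g : 𝓢(F, ℂ)) : 𝓢(E × F, ℂ) where
  toFun p := f p.1 * g p.2
  smooth' := (f.smooth'.comp contDiff_fst).mul (g.smooth'.comp contDiff_snd)
  decay' k m := by
    have hf : ∀ a i (p : E × F), ‖p.1‖ ^ a * ‖iteratedFDeriv ℝ i (fun p : E × F => f p.1) p‖ ≤
        SchwartzMap.seminorm ℝ a i f * ‖ContinuousLinearMap.fst ℝ E F‖ ^ i := by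
      intro a i p
      have h1 := (ContinuousLinearMap.fst ℝ E F).iteratedFDeriv_comp_right
        f.smooth' p (i := i) (by exact_mod_cast le_top)
      have h2 : ‖iteratedFDeriv ℝ i (fun p : E × F => f p.1) p‖ ≤
          ‖iteratedFDeriv ℝ i f p.1‖ * ‖ContinuousLinearMap.fst ℝ E F‖ ^ i := by
        refine (congrArg norm h1).trans_le ((ContinuousMultilinearMap.norm_compContinuousLinearMap_le
          _ _).trans ?_)
        simp only [Finset.prod_const, Finset.card_univ, Fintype.card_fin]
        exact le_rfl
      calc _ ≤ ‖p.1‖ ^ a * (‖iteratedFDeriv ℝ i f p.1‖ * ‖ContinuousLinearMap.fst ℝ E F‖ ^ i) := by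
            gcongr
        _ ≤ _ := by
            rw [← mul_assoc]
            gcongr
            exact SchwartzMap.le_seminorm ℝ a i f p.1
    have hg : ∀ a i (p : E × F), ‖p.2‖ ^ a * ‖iteratedFDeriv ℝ i (fun p : E × F => g p.2) p‖ ≤
        SchwartzMap.seminorm ℝ a i g * ‖ContinuousLinearMap.snd ℝ E F‖ ^ i := by
      intro a i p
      have h1 := (ContinuousLinearMap.snd ℝ E F).iteratedFDeriv_comp_right
        g.smooth' p (i := i) (by exact_mod_cast le_top)
      have h2 : ‖iteratedFDeriv ℝ i (fun p : E × F => g p.2) p‖ ≤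
          ‖iteratedFDeriv ℝ i g p.2‖ * ‖ContinuousLinearMap.snd ℝ E F‖ ^ i := by
        refine (congrArg norm h1).trans_le ((ContinuousMultilinearMap.norm_compContinuousLinearMap_le
          _ _).trans ?_)
        simp only [Finset.prod_const, Finset.card_univ, Fintype.card_fin]
        exact le_rfl
      calc _ ≤ ‖p.2‖ ^ a * (‖iteratedFDeriv ℝ i g p.2‖ * ‖ContinuousLinearMap.snd ℝ E F‖ ^ i) := by
            gcongr
        _ ≤ _ := by
            rw [← mul_assoc]
            gcongr
            exact SchwartzMap.le_seminorm ℝ a i g p.2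
    set A : ℕ → ℕ → ℝ := fun a i => SchwartzMap.seminorm ℝ a i f * ‖ContinuousLinearMap.fst ℝ E F‖ ^ i
    set B : ℕ → ℕ → ℝ := fun a i => SchwartzMap.seminorm ℝ a i g * ‖ContinuousLinearMap.snd ℝ E F‖ ^ i
    have hA : ∀ a i, 0 ≤ A a i := fun a i => by positivity
    refine ⟨∑ i ∈ Finset.range (m + 1), (m.choose i : ℝ) *
      (A k i * B 0 (m - i) + A 0 i * B k (m - i)), fun p => ?_⟩
    have hmul := norm_iteratedFDeriv_mul_le (𝕜 := ℝ) (f := fun p : E × F => f p.1)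
      (g := fun p : E × F => g p.2) (N := ∞) (f.smooth'.comp contDiff_fst)
      (g.smooth'.comp contDiff_snd) p (n := m) (by exact_mod_cast le_top)
    refine (mul_le_mul_of_nonneg_left hmul (by positivity)).trans ?_
    rw [Finset.mul_sum]
    refine Finset.sum_le_sum fun i _ => ?_
    have hp : ‖p‖ ^ k ≤ ‖p.1‖ ^ k + ‖p.2‖ ^ k := by
      rcases max_cases ‖p.1‖ ‖p.2‖ with h | h
      · rw [Prod.norm_def, h.1]
        exact le_add_of_nonneg_right (by positivity)
      · rw [Prod.norm_def, h.1]
        exact le_add_of_nonneg_left (by positivity)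
    have f0 := hf 0 i p
    have g0 := hg 0 (m - i) p
    have f1 := hf k i p
    have g1 := hg k (m - i) p
    rw [pow_zero, one_mul] at f0 g0
    set X := ‖iteratedFDeriv ℝ i (fun p : E × F => f p.1) p‖
    set Y := ‖iteratedFDeriv ℝ (m - i) (fun p : E × F => g p.2) p‖
    have hX : 0 ≤ X := norm_nonneg _
    have hY : 0 ≤ Y := norm_nonneg _
    calc _ ≤ (‖p.1‖ ^ k + ‖p.2‖ ^ k) * ((m.choose i : ℝ) * X * Y) := by gcongr
      _ = (m.choose i : ℝ) * ((‖p.1‖ ^ k * X) * Y + X * (‖p.2‖ ^ k * Y)) := by ring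
      _ ≤ _ := by
        refine mul_le_mul_of_nonneg_left (add_le_add ?_ ?_) (by positivity)
        · exact mul_le_mul f1 g0 hY (hA _ _)
        · exact mul_le_mul f0 g1 (by positivity) (hA _ _)

theorem tensorS_apply (f : 𝓢(E, ℂ)) (g : 𝓢(F, ℂ)) (p : E × F) :
    tensorS f g p = f p.1 * g p.2 := rfl

variable {H : Type*} [NormedAddCommGroup H] [InnerProductSpace ℝ H]

theorem exists_pow_mul_exp_le (k : ℕ) : ∃ C : ℝ, ∀ r : ℝ, 0 ≤ r →
    (1 + r) ^ k * Real.exp (-(r ^ 2 / 4)) ≤ C := by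
  refine ⟨(k ! : ℝ) * Real.exp 2, fun r hr => ?_⟩
  have h1 : (1 + r) ^ k / (k ! : ℝ) ≤ Real.exp (1 + r) :=
    Real.pow_div_factorial_le_exp (1 + r) (by positivity) k
  rw [div_le_iff₀ (by positivity)] at h1
  calc _ ≤ Real.exp (1 + r) * (k ! : ℝ) * Real.exp (-(r ^ 2 / 4)) := by gcongr
    _ = (k ! : ℝ) * Real.exp (1 + r + -(r ^ 2 / 4)) := by rw [Real.exp_add (1 + r)]; ring
    _ ≤ _ := by
      gcongr
      -- `1 + r - r²/4 = 2 - (r - 2)²/4`.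
      nlinarith [sq_nonneg (r - 2)]

/-- The Gaussian `e^{-|v|²/4}` as a Schwartz function. -/
def gaussS (H : Type*) [NormedAddCommGroup H] [InnerProductSpace ℝ H] : 𝓢(H, ℂ) where
  toFun v := ((Real.exp (-(‖v‖ ^ 2 / 4)) : ℝ) : ℂ)
  smooth' := Complex.ofRealCLM.contDiff.comp
    (Real.contDiff_exp.comp ((contDiff_norm_sq ℝ).div_const 4).neg)
  decay' k m := by
    set q : H → ℝ := fun v => -(‖v‖ ^ 2 / 4) with hq
    have hqt : q.HasTemperateGrowth := by
      have : q = fun v => (-1 / 4 : ℝ) * ‖v‖ ^ 2 := by ext v; simp only [hq]; ring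
      rw [this]
      fun_prop
    obtain ⟨a, C, hC, hb⟩ := hqt.norm_iteratedFDeriv_le_uniform m
    obtain ⟨M, hM⟩ := exists_pow_mul_exp_le (k + a * m)
    refine ⟨(m ! : ℝ) * (1 + C) ^ m * M, fun v => ?_⟩
    have h1 : ‖iteratedFDeriv ℝ m (fun v : H => ((Real.exp (q v) : ℝ) : ℂ)) v‖ ≤
        ‖iteratedFDeriv ℝ m (Real.exp ∘ q) v‖ :=
      (Complex.ofRealLI.norm_iteratedFDeriv_comp_left
        (Real.contDiff_exp.comp hqt.1).contDiffAt (by exact_mod_cast le_top)).le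
    have h2 : ‖iteratedFDeriv ℝ m (Real.exp ∘ q) v‖ ≤
        m ! * Real.exp (q v) * ((1 + C) * (1 + ‖v‖) ^ a) ^ m := by
      refine norm_iteratedFDeriv_comp_le (N := ∞) Real.contDiff_exp hqt.1
        (by exact_mod_cast le_top) v (fun i _ => ?_) (fun i hi hi' => ?_)
      · rw [norm_iteratedFDeriv_eq_norm_iteratedDeriv, iteratedDeriv_eq_iterate,
          Real.iter_deriv_exp, Real.norm_of_nonneg (Real.exp_pos _).le]
      · refine (hb i hi' v).trans (le_trans (b := (1 + C) * (1 + ‖v‖) ^ a) ?_ ?_)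
        · gcongr
          linarith
        · refine le_self_pow₀ (one_le_mul_of_one_le_of_one_le (by linarith) ?_) (by omega)
          exact one_le_pow₀ (by linarith [norm_nonneg v])
    calc _ ≤ (1 + ‖v‖) ^ k * (m ! * Real.exp (q v) * ((1 + C) * (1 + ‖v‖) ^ a) ^ m) := by
          gcongr
          · linarith [norm_nonneg v]
          · exact h1.trans h2
      _ = (m ! : ℝ) * (1 + C) ^ m * ((1 + ‖v‖) ^ (k + a * m) * Real.exp (q v)) := by
          rw [mul_pow, ← pow_mul, pow_add]
          ring
      _ ≤ _ := by
          gcongr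
          exact hM _ (norm_nonneg v)

theorem gaussS_apply (v : H) : gaussS H v = ((Real.exp (-(‖v‖ ^ 2 / 4)) : ℝ) : ℂ) := rfl

end

section

/-! ### The resolvent of the Laplacian on Schwartz functions -/

theorem halfLine_sub_one {z : ℂ} (hz : z ∉ halfLine) : z - 1 ∉ halfLine := by
  intro h
  refine hz ⟨?_, ?_⟩
  · have := h.1
    simp at this
    linarith
  · simpa using h.2

theorem re_or_im_of_not_halfLine {z : ℂ} (hz : z ∉ halfLine) : z.im ≠ 0 ∨ z.re < 0 := by
  by_contra! h
  exact hz ⟨h.2, h.1⟩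

section Laplacian

variable {E : Type*} [NormedAddCommGroup E] [InnerProductSpace ℝ E]

theorem temperate_symbol (z : ℂ) :
    (fun ξ : E => (((2 * Real.pi) ^ 2 * ‖ξ‖ ^ 2 : ℝ) : ℂ) - z).HasTemperateGrowth := by
  refine Function.HasTemperateGrowth.sub ?_ (Function.HasTemperateGrowth.const z)
  exact Function.HasTemperateGrowth.comp Function.Complex.hasTemperateGrowth_ofReal
    (Function.HasTemperateGrowth.mul (Function.HasTemperateGrowth.const _)
      (Function.hasTemperateGrowth_norm_sq E))

theorem exists_normSq_sub_ge {z : ℂ} (hz : z ∉ halfLine) :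
    ∃ c : ℝ, 0 < c ∧ ∀ s : ℝ, 0 ≤ s → c ≤ (s - z.re) ^ 2 + z.im ^ 2 := by
  rcases re_or_im_of_not_halfLine hz with h | h
  · exact ⟨z.im ^ 2, by positivity, fun s _ => le_add_of_nonneg_left (sq_nonneg _)⟩
  · refine ⟨z.re ^ 2, by have := h.ne; positivity, fun s hs => ?_⟩
    nlinarith [sq_nonneg z.im]

/-- With `1/w = conj w/|w|²` only the real function `|w|²` has to be inverted, and it is bounded
below off the half-line. -/
theorem temperate_inv_symbol {z : ℂ} (hz : z ∉ halfLine) :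
    (fun ξ : E => ((((2 * Real.pi) ^ 2 * ‖ξ‖ ^ 2 : ℝ) : ℂ) - z)⁻¹).HasTemperateGrowth := by
  obtain ⟨c, hc, h⟩ := exists_normSq_sub_ge hz
  have h1 : (fun ξ : E => (((2 * Real.pi) ^ 2 * ‖ξ‖ ^ 2 - z.re) ^ 2 + z.im ^ 2)⁻¹
      ).HasTemperateGrowth := by
    refine temperate_inv ?_ hc fun ξ => h _ (by positivity)
    fun_prop
  have h2 := (Function.HasTemperateGrowth.comp Function.Complex.hasTemperateGrowth_ofReal h1).mul
    (temperate_symbol (E := E) (starRingEnd ℂ z))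
  refine (congrArg Function.HasTemperateGrowth (funext fun ξ => ?_)).mpr h2
  rw [Complex.inv_def, mul_comm]
  simp only [Pi.mul_apply, Function.comp_apply, Complex.normSq_apply, map_sub, Complex.conj_ofReal,
    Complex.sub_re, Complex.sub_im, Complex.ofReal_re, Complex.ofReal_im]
  congr 3
  ring

variable [FiniteDimensional ℝ E] [MeasurableSpace E] [BorelSpace E]

open Laplacian in
theorem laplacian_sub_eq_multiplier (z : ℂ) (f : 𝓢(E, ℂ)) :
    -Δ f - z • f =
      fourierMultiplierCLM ℂ (fun ξ : E => (((2 * Real.pi) ^ 2 * ‖ξ‖ ^ 2 : ℝ) : ℂ) - z) f := by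
  have h0 : (fun ξ : E => (‖ξ‖ ^ 2 : ℝ)).HasTemperateGrowth :=
    Function.hasTemperateGrowth_norm_sq E
  have h0' : (fun ξ : E => ((‖ξ‖ ^ 2 : ℝ) : ℂ)).HasTemperateGrowth :=
    Function.HasTemperateGrowth.comp Function.Complex.hasTemperateGrowth_ofReal h0
  -- The symbol is written as a sum of two terms so that additivity of Fourier multipliers in the
  -- symbol applies.
  have h1 : (fun ξ : E => (((2 * Real.pi) ^ 2 * ‖ξ‖ ^ 2 : ℝ) : ℂ) - z) =
      fun ξ => ∑ i : Fin 2, (![((2 * Real.pi : ℝ) ^ 2 : ℂ) • fun ξ : E => ((‖ξ‖ ^ 2 : ℝ) : ℂ),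
        fun _ => -z] i) ξ := by
    ext ξ
    simp [Fin.sum_univ_two]
    ring
  rw [h1, fourierMultiplierCLM_sum]
  · simp only [Fin.sum_univ_two, Matrix.cons_val_zero, Matrix.cons_val_one, _root_.add_apply]
    rw [fourierMultiplierCLM_smul h0', fourierMultiplierCLM_const, laplacian_eq_fourierMultiplierCLM]
    have h2 := fourierMultiplierCLM_ofReal (F := ℂ) ℂ h0 f
    have h3 : fourierMultiplierCLM ℂ (fun ξ : E => ((‖ξ‖ ^ 2 : ℝ) : ℂ)) f =
      fourierMultiplierCLM ℂ (fun ξ : E => (‖ξ‖ ^ 2 : ℝ)) f := h2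
    rw [_root_.smul_apply, h3]
    ext x
    simp only [_root_.neg_apply, _root_.smul_apply, _root_.add_apply, smul_eq_mul,
      ContinuousLinearMap.id_apply, neg_smul, neg_neg, Complex.real_smul, sub_eq_add_neg]
    push_cast
    rfl
  · intro i _
    fin_cases i
    · exact (Function.HasTemperateGrowth.const _).mul h0'
    · exact Function.HasTemperateGrowth.const _

open Laplacian in
theorem exists_laplacian_resolvent {z : ℂ} (hz : z ∉ halfLine) (f : 𝓢(E, ℂ)) :
    ∃ g : 𝓢(E, ℂ), -Δ g - z • g = f := by
  refine ⟨fourierMultiplierCLM ℂ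
    (fun ξ : E => ((((2 * Real.pi) ^ 2 * ‖ξ‖ ^ 2 : ℝ) : ℂ) - z)⁻¹) f, ?_⟩
  rw [laplacian_sub_eq_multiplier, fourierMultiplierCLM_fourierMultiplierCLM_apply
    (temperate_symbol z) (temperate_inv_symbol hz)]
  have : ((fun ξ : E => (((2 * Real.pi) ^ 2 * ‖ξ‖ ^ 2 : ℝ) : ℂ) - z) *
      fun ξ : E => ((((2 * Real.pi) ^ 2 * ‖ξ‖ ^ 2 : ℝ) : ℂ) - z)⁻¹) = fun _ => 1 := by
    ext ξ
    refine mul_inv_cancel₀ fun h => hz ?_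
    rw [← sub_eq_zero.1 h]
    exact ⟨by simp only [Complex.ofReal_re]; positivity, Complex.ofReal_im _⟩
  rw [this, fourierMultiplierCLM_const]
  simp

end Laplacian

variable {n : ℕ}

/-! ### The core spanned by the generalised Hermite functions -/

/-- The change of variables `(x, v) ↦ (x - v, v)`. -/
def shear (n : ℕ) : Phase n ≃L[ℝ] Phase n :=
  ContinuousLinearEquiv.equivOfInverse
    ((ContinuousLinearMap.fst ℝ (Conf n) (Conf n) -
      ContinuousLinearMap.snd ℝ (Conf n) (Conf n)).prod (ContinuousLinearMap.snd ℝ _ _))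
    ((ContinuousLinearMap.fst ℝ (Conf n) (Conf n) +
      ContinuousLinearMap.snd ℝ (Conf n) (Conf n)).prod (ContinuousLinearMap.snd ℝ _ _))
    (fun p => by simp) (fun p => by simp)

theorem shear_apply (p : Phase n) : shear n p = (p.1 - p.2, p.2) := rfl

/-- The function `e^{-|v|²/4} g(x - v)`, annihilated by all `low i`. -/
def baseS (g : 𝓢(Conf n, ℂ)) : Sch n :=
  SchwartzMap.compCLMOfContinuousLinearEquiv ℂ (shear n) (tensorS g (gaussS (Conf n)))

theorem baseS_apply (g : 𝓢(Conf n, ℂ)) (p : Phase n) :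
    baseS g p = g (p.1 - p.2) * gaussS (Conf n) p.2 := rfl

theorem fderiv_gaussS (i : Fin n) (v : Conf n) :
    fderiv ℝ (gaussS (Conf n)) v (EuclideanSpace.single i 1) =
      -(1 / 2 : ℂ) * (((v i : ℝ) : ℂ) * gaussS (Conf n) v) := by
  have h : HasFDerivAt (fun v : Conf n => ((Real.exp (-(‖v‖ ^ 2 * (1 / 4))) : ℝ) : ℂ)) _ v :=
    Complex.ofRealCLM.hasFDerivAt.comp v
      (((hasStrictFDerivAt_norm_sq v).hasFDerivAt.mul_const (1 / 4)).neg.exp)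
  have h' : (fun v : Conf n => ((Real.exp (-(‖v‖ ^ 2 * (1 / 4))) : ℝ) : ℂ)) = gaussS (Conf n) := by
    ext v
    rw [gaussS_apply]
    congr 4
    ring
  rw [h'] at h
  rw [h.fderiv, ← congrFun h' v]
  simp [EuclideanSpace.inner_single_right]
  ring

theorem sder_baseS (a : Conf n) (b : Conf n) (g : 𝓢(Conf n, ℂ)) (p : Phase n) :
    sder (a, b) (baseS g) p = fderiv ℝ g (p.1 - p.2) (a - b) * gaussS (Conf n) p.2 +
      g (p.1 - p.2) * fderiv ℝ (gaussS (Conf n)) p.2 b := by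
  have h1 : HasFDerivAt (fun p : Phase n => g (p.1 - p.2)) _ p :=
    HasFDerivAt.comp p (g.differentiableAt (x := p.1 - p.2)).hasFDerivAt
      ((hasFDerivAt_fst (p := p)).sub (hasFDerivAt_snd (p := p)))
  have h2 : HasFDerivAt (fun p : Phase n => gaussS (Conf n) p.2) _ p :=
    HasFDerivAt.comp p ((gaussS (Conf n)).differentiableAt (x := p.2)).hasFDerivAt
      (hasFDerivAt_snd (p := p))
  rw [sder_apply, show (baseS g : Phase n → ℂ) = _ from funext (baseS_apply g)]
  refine (DFunLike.congr_fun (h1.mul h2).fderiv (a, b)).trans ?_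
  simp
  ring

theorem sdx_baseS (i : Fin n) (g : 𝓢(Conf n, ℂ)) :
    sdx i (baseS g) = baseS (LineDeriv.lineDerivOp (EuclideanSpace.single i (1 : ℝ)) g) := by
  ext p
  refine (sder_baseS _ _ _ _).trans ?_
  rw [map_zero, mul_zero, add_zero, sub_zero]
  rfl

/-- `∂_v + ∂_x` kills functions of `x - v`, and `∂_v + v/2` kills the Gaussian. -/
theorem low_baseS (i : Fin n) (g : 𝓢(Conf n, ℂ)) : low i (baseS g) = 0 := by
  ext p
  have h1 := sder_baseS 0 (EuclideanSpace.single i 1) g p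
  have h2 := sder_baseS (EuclideanSpace.single i 1) 0 g p
  have h3 : smv i (baseS g) p = cv i p * baseS g p := smulS_apply (cv_temperate i) _ p
  rw [low_apply, ann_apply, _root_.add_apply, _root_.add_apply, _root_.smul_apply, h3]
  refine (congrArg₂ (· + ·) (congrArg₂ (· + ·) h1 rfl) h2).trans ?_
  rw [baseS_apply, fderiv_gaussS]
  simp [cv]
  ring

/-- The span of the functions obtained by applying products of `rais i` to the `baseS g`. -/
inductive Core : Sch n → Prop
  | base (g : 𝓢(Conf n, ℂ)) : Core (baseS g)
  | rais (i : Fin n) {u : Sch n} : Core u → Core (rais i u)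
  | add {u w : Sch n} : Core u → Core w → Core (u + w)
  | smul (c : ℂ) {u : Sch n} : Core u → Core (c • u)

theorem Core.neg {u : Sch n} (hu : Core u) : Core (-u) := by
  rw [← neg_one_smul ℂ u]
  exact hu.smul _

theorem Core.sub {u w : Sch n} (hu : Core u) (hw : Core w) : Core (u - w) := by
  rw [sub_eq_add_neg]
  exact hu.add hw.neg

theorem Core.zero : Core (0 : Sch n) := by
  rw [← zero_smul ℂ (baseS 0)]
  exact (Core.base 0).smul 0

theorem Core.sum {ι : Type*} {s : Finset ι} {u : ι → Sch n} (h : ∀ i ∈ s, Core (u i)) :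
    Core (∑ i ∈ s, u i) := by
  classical
  induction s using Finset.induction_on with
  | empty => exact Core.zero
  | insert a s ha ih =>
    rw [Finset.sum_insert ha]
    exact (h a (Finset.mem_insert_self a s)).add
      (ih fun i hi => h i (Finset.mem_insert_of_mem hi))

theorem Core.sdx (i : Fin n) {u : Sch n} (hu : Core u) : Core (sdx i u) := by
  induction hu with
  | base g => rw [sdx_baseS]; exact Core.base _
  | rais j _ ih => rw [sdx_rais]; exact ih.rais j
  | add _ _ ih ih' => rw [map_add]; exact ih.add ih'
  | smul c _ ih => rw [map_smul]; exact ih.smul c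

theorem Core.low (i : Fin n) {u : Sch n} (hu : Core u) : Core (low i u) := by
  induction hu with
  | base g => rw [low_baseS]; exact Core.zero
  | rais j hu ih => rw [low_rais]; exact (ih.rais j).add (hu.smul _)
  | add _ _ ih ih' => rw [map_add]; exact ih.add ih'
  | smul c _ ih => rw [map_smul]; exact ih.smul c

theorem Core.ann (i : Fin n) {u : Sch n} (hu : Core u) : Core (ann i u) := by
  rw [← add_sub_cancel_right (KFP.ann i u) (KFP.sdx i u), ← low_apply]
  exact (hu.low i).sub (hu.sdx i)

theorem Core.cre (i : Fin n) {u : Sch n} (hu : Core u) : Core (cre i u) := by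
  rw [← add_sub_cancel_right (KFP.cre i u) (KFP.sdx i u), ← rais_apply]
  exact (hu.rais i).sub (hu.sdx i)

theorem Core.smv (i : Fin n) {u : Sch n} (hu : Core u) : Core (smv i u) := by
  rw [← ann_add_cre]
  exact (hu.ann i).add (hu.cre i)

theorem Core.lapx {u : Sch n} (hu : Core u) : Core (lapx u) := by
  rw [lapx_apply]
  exact Core.sum fun i _ => (hu.sdx i).sdx i

theorem Core.opT (z : ℂ) {u : Sch n} (hu : Core u) : Core (opT z u) := by
  rw [opT_eq]
  exact ((Core.sum fun i _ => (hu.low i).rais i).sub hu.lapx).sub (hu.smul z)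

open Laplacian in
theorem lapx_baseS (z : ℂ) (g : 𝓢(Conf n, ℂ)) :
    -lapx (baseS g) - z • baseS g = baseS (-Δ g - z • g) := by
  rw [lapx_apply, laplacian_eq_sum (EuclideanSpace.basisFun (Fin n) ℝ)]
  simp only [sdx_baseS, EuclideanSpace.basisFun_apply]
  simp only [baseS, ← map_sum, ← map_neg, ← map_smul, ← map_sub]
  ext p
  have h : ∀ G : 𝓢(Conf n, ℂ), SchwartzMap.compCLMOfContinuousLinearEquiv ℂ (shear n)
      (tensorS G (gaussS (Conf n))) p = G (p.1 - p.2) * gaussS (Conf n) p.2 := fun G => rfl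
  simp only [map_sub, map_neg, map_smul, map_sum, _root_.sub_apply, _root_.neg_apply,
    _root_.smul_apply, _root_.sum_apply, h, smul_eq_mul]
  rw [sub_mul, neg_mul, Finset.sum_mul, mul_assoc]

theorem opT_baseS (z : ℂ) (g : 𝓢(Conf n, ℂ)) :
    opT z (baseS g) = -lapx (baseS g) - z • baseS g := by
  rw [opT_eq]
  simp [low_baseS]

/-- The induction must keep `z` free: solving for a raised function at `z` needs the unraised one at
`z - 1`, which is still off the half-line. On base functions `P₀` is `-Δ`. -/
theorem Core.exists_opT_eq {f : Sch n} (hf : Core f) :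
    ∀ {z : ℂ}, z ∉ halfLine → ∃ u, Core u ∧ KFP.opT z u = f := by
  induction hf with
  | base g =>
    intro z hz
    obtain ⟨g', hg'⟩ := exists_laplacian_resolvent hz g
    exact ⟨baseS g', Core.base g', by rw [opT_baseS, lapx_baseS, hg']⟩
  | rais j _ ih =>
    intro z hz
    obtain ⟨u, hu, h⟩ := ih (halfLine_sub_one hz)
    exact ⟨KFP.rais j u, hu.rais j, by rw [opT_rais, h]⟩
  | add _ _ ih ih' =>
    intro z hz
    obtain ⟨u, hu, h⟩ := ih hz
    obtain ⟨u', hu', h'⟩ := ih' hz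
    exact ⟨u + u', hu.add hu', by rw [map_add, h, h']⟩
  | smul c _ ih =>
    intro z hz
    obtain ⟨u, hu, h⟩ := ih hz
    exact ⟨c • u, hu.smul c, by rw [map_smul, h]⟩

/-- Here `z` stays fixed, because `Δ_x` commutes with `rais`. -/
theorem Core.exists_lapx_eq {f : Sch n} (hf : Core f) {z : ℂ} (hz : z ∉ halfLine) :
    ∃ u, Core u ∧ -KFP.lapx u - z • u = f := by
  induction hf with
  | base g =>
    obtain ⟨g', hg'⟩ := exists_laplacian_resolvent hz g
    exact ⟨baseS g', Core.base g', by rw [lapx_baseS, hg']⟩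
  | rais j _ ih =>
    obtain ⟨u, hu, h⟩ := ih
    exact ⟨KFP.rais j u, hu.rais j, by rw [lapx_rais, ← h, map_sub, map_neg, map_smul]⟩
  | add _ _ ih ih' =>
    obtain ⟨u, hu, h⟩ := ih
    obtain ⟨u', hu', h'⟩ := ih'
    refine ⟨u + u', hu.add hu', ?_⟩
    rw [← h, ← h', map_add, smul_add]
    abel
  | smul c _ ih =>
    obtain ⟨u, hu, h⟩ := ih
    refine ⟨c • u, hu.smul c, ?_⟩
    rw [← h, map_smul]
    module

end

section

variable {n : ℕ}

/-! ### A priori estimates on the core -/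

theorem low_opT (z : ℂ) (j : Fin n) (u : Sch n) : low j (opT z u) = opT (z - 1) (low j u) := by
  have hc : ∀ i, low j (low i u) = low i (low j u) := fun i => by
    simp only [low_apply, map_add, ann_comm i j, sdx_ann, sdx_comm i j]
    abel
  have hl : low j (lapx u) = lapx (low j u) := by simp only [lapx_apply, map_sum, sdx_low]
  simp only [opT_eq, map_sub, map_smul, map_sum, low_rais, Finset.sum_add_distrib, hc, hl]
  have : ∑ i, (if j = i then (1 : ℂ) else 0) • low i u = low j u := by simp
  rw [this]
  module

theorem le_of_sq_le_mul {a b : ℝ} (ha : 0 ≤ a) (hb : 0 ≤ b) (h : a ^ 2 ≤ a * b) : a ≤ b := by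
  rcases ha.eq_or_lt with h0 | h0
  · rwa [← h0]
  · nlinarith

theorem re_inner_le {H : Type*} [NormedAddCommGroup H] [InnerProductSpace ℂ H] (a b : H) :
    (inner ℂ a b).re ≤ ‖a‖ * ‖b‖ :=
  (Complex.re_le_norm _).trans (norm_inner_le_norm a b)

theorem norm_ann_sq_le (j : Fin n) (u : Sch n) :
    ‖emb (ann j u)‖ ^ 2 ≤ ∑ i, ‖emb (ann i u)‖ ^ 2 :=
  Finset.single_le_sum (f := fun i => ‖emb (ann i u)‖ ^ 2) (fun _ _ => by positivity)
    (Finset.mem_univ j)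

theorem norm_le_norm_cre (j : Fin n) (u : Sch n) : ‖emb u‖ ≤ ‖emb (cre j u)‖ := by
  have := norm_cre_sq j u
  exact (pow_le_pow_iff_left₀ (norm_nonneg _) (norm_nonneg _) two_ne_zero).1
    (by nlinarith [sq_nonneg ‖emb (ann j u)‖])

/-- At `z = -1` the energy contains exactly the extra `‖u‖²` that turns `‖ann u‖²` into `‖cre u‖²`.
-/
theorem norm_cre_sq_le_re_inner (j : Fin n) (u : Sch n) :
    ‖emb (cre j u)‖ ^ 2 ≤ (inner ℂ (emb u) (emb (opT (-1) u))).re := by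
  rw [re_inner_opT, norm_cre_sq]
  simpa using norm_ann_sq_le j u

theorem norm_le_opT (z : ℂ) (u : Sch n) :
    -z.re * ‖emb u‖ ≤ ‖emb (opT z u)‖ := by
  have h1 := re_inner_le (emb u) (emb (opT z u))
  rw [re_inner_opT] at h1
  have h2 : 0 ≤ ∑ i, ‖emb (ann i u)‖ ^ 2 := by positivity
  rcases (norm_nonneg (emb u)).eq_or_lt with h0 | h0
  · rw [← h0]
    simp
  · nlinarith

theorem norm_cre_le_opT (j : Fin n) (u : Sch n) : ‖emb (cre j u)‖ ≤ ‖emb (opT (-1) u)‖ := by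
  refine le_of_sq_le_mul (norm_nonneg _) (norm_nonneg _) ?_
  calc _ ≤ _ := norm_cre_sq_le_re_inner j u
    _ ≤ ‖emb u‖ * ‖emb (opT (-1) u)‖ := re_inner_le _ _
    _ ≤ _ := by
      gcongr
      exact norm_le_norm_cre j u

/-- By duality `ann j` moves onto `u` as `cre j u`, which the energy controls. A right-hand side
that loses one velocity derivative is therefore harmless. -/
theorem norm_cre_le_of_opT_eq_ann {j : Fin n} {u g : Sch n} (h : opT (-1) u = ann j g) :
    ‖emb (cre j u)‖ ≤ ‖emb g‖ := by
  refine le_of_sq_le_mul (norm_nonneg _) (norm_nonneg _) ?_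
  refine (norm_cre_sq_le_re_inner j u).trans ?_
  rw [h, inner_ann]
  exact re_inner_le _ _

/-- The resolvent estimate for `P₀ - z` on the core. -/
def APriori (n : ℕ) (z : ℂ) : Prop :=
  ∃ C : ℝ, 0 ≤ C ∧ ∀ u : Sch n, Core u → ‖emb u‖ ≤ C * ‖emb (opT z u)‖

theorem APriori.of_re_neg {z : ℂ} (hz : z.re < 0) : APriori n z := by
  refine ⟨(-z.re)⁻¹, inv_nonneg.2 (by linarith), fun u _ => ?_⟩
  rw [inv_mul_eq_div, le_div_iff₀ (by linarith), mul_comm]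
  exact norm_le_opT z u

theorem norm_opT_neg_one_le (z : ℂ) (u : Sch n) :
    ‖emb (opT (-1) u)‖ ≤ ‖emb (opT z u)‖ + ‖z + 1‖ * ‖emb u‖ := by
  rw [opT_shift (-1) z, map_add, map_smul, sub_neg_eq_add, ← norm_smul]
  exact norm_add_le _ _

theorem APriori.bound_cre {z : ℂ} (h : APriori n z) :
    ∃ C : ℝ, 0 ≤ C ∧ ∀ u : Sch n, Core u → ∀ j,
      ‖emb u‖ ≤ C * ‖emb (opT z u)‖ ∧ ‖emb (cre j u)‖ ≤ C * ‖emb (opT z u)‖ := by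
  obtain ⟨C, hC, h⟩ := h
  refine ⟨1 + ‖z + 1‖ * C, by positivity, fun u hu j => ?_⟩
  have h1 : ‖emb (cre j u)‖ ≤ (1 + ‖z + 1‖ * C) * ‖emb (opT z u)‖ := by
    calc _ ≤ _ := norm_cre_le_opT j u
      _ ≤ _ := norm_opT_neg_one_le z u
      _ ≤ ‖emb (opT z u)‖ + ‖z + 1‖ * (C * ‖emb (opT z u)‖) := by
        gcongr
        exact h u hu
      _ = _ := by ring
  exact ⟨(norm_le_norm_cre j u).trans h1, h1⟩

theorem neg_one_not_halfLine : (-1 : ℂ) ∉ halfLine := fun h => by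
  have := h.1
  simp at this
  linarith

/-- The energy argument only works at `-1`; subtracting the solution `y` at `-1` leaves the
right-hand side `(z + 1) y`, to which the ordinary estimate at `z` applies. -/
theorem APriori.bound_ann {z : ℂ} (h : APriori n z) :
    ∃ C : ℝ, 0 ≤ C ∧ ∀ u g : Sch n, Core u → Core g → ∀ j, opT z u = ann j g →
      ‖emb u‖ ≤ C * ‖emb g‖ ∧ ‖emb (cre j u)‖ ≤ C * ‖emb g‖ := by
  obtain ⟨C, hC, h⟩ := h.bound_cre
  refine ⟨1 + C * ‖z + 1‖, by positivity, fun u g hu hg j hug => ?_⟩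
  obtain ⟨y, hy, hyg⟩ := (hg.ann j).exists_opT_eq neg_one_not_halfLine
  have h1 := norm_cre_le_of_opT_eq_ann hyg
  have h2 := (norm_le_norm_cre j y).trans h1
  have h3 : opT z (u - y) = (z + 1) • y := by
    rw [map_sub, hug, opT_shift z (-1) y, hyg]
    module
  obtain ⟨h4, h5⟩ := h (u - y) (hu.sub hy) j
  rw [h3, map_smul, norm_smul] at h4 h5
  have h6 : C * (‖z + 1‖ * ‖emb y‖) ≤ C * ‖z + 1‖ * ‖emb g‖ := by
    rw [← mul_assoc]
    gcongr
  constructor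
  · calc ‖emb u‖ = ‖emb (u - y) + emb y‖ := by rw [← map_add, sub_add_cancel]
      _ ≤ ‖emb (u - y)‖ + ‖emb y‖ := norm_add_le _ _
      _ ≤ _ := by linarith
  · calc ‖emb (cre j u)‖ = ‖emb (cre j (u - y)) + emb (cre j y)‖ := by
          rw [← map_add, ← map_add, sub_add_cancel]
      _ ≤ ‖emb (cre j (u - y))‖ + ‖emb (cre j y)‖ := norm_add_le _ _
      _ ≤ _ := by linarith

/-- Two integrations by parts, one in each variable. -/
theorem norm_sdx_sdx_sq_sum (F : Sch n) :
    ∑ i, ∑ j, ‖emb (sdx i (sdx j F))‖ ^ 2 = ‖emb (lapx F)‖ ^ 2 := by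
  rw [← re_inner_self (emb (lapx F)), lapx_apply]
  simp only [map_sum, sum_inner, inner_sum, Complex.re_sum]
  refine Finset.sum_congr rfl fun i _ => Finset.sum_congr rfl fun j _ => ?_
  have : inner ℂ (emb (sdx j (sdx j F))) (emb (sdx i (sdx i F))) =
      inner ℂ (emb (sdx i (sdx j F))) (emb (sdx i (sdx j F))) := by
    rw [inner_sdx i, sdx_comm i j (sdx j F), ← inner_sdx j, sdx_comm j i]
  rw [← re_inner_self, this]

/-- Pairing with `F` bounds `F` through the imaginary part if `Im z ≠ 0` and through the real part
if `Re z < 0`. The real part then bounds the first derivatives, and the norm of `ΔF` the second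
ones. -/
theorem exists_elliptic_bound {z : ℂ} (hz : z ∉ halfLine) :
    ∃ C : ℝ, 0 ≤ C ∧ ∀ F : Sch n, ‖emb F‖ ≤ C * ‖emb (-lapx F - z • F)‖ ∧
      ∀ j, ‖emb (sdx j F)‖ ≤ C * ‖emb (-lapx F - z • F)‖ ∧
      ‖emb (sdx j (sdx j F))‖ ≤ C * ‖emb (-lapx F - z • F)‖ := by
  have hid : ∀ F : Sch n, inner ℂ (emb F) (emb (-lapx F - z • F)) =
      ((∑ i, ‖emb (sdx i F)‖ ^ 2 : ℝ) : ℂ) - z * ((‖emb F‖ ^ 2 : ℝ) : ℂ) := by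
    intro F
    rw [lapx_apply]
    simp only [map_sub, map_neg, map_sum, map_smul, inner_sub_right, inner_neg_right, inner_sum,
      inner_smul_right, inner_sdx, Finset.sum_neg_distrib, neg_neg, inner_self_eq_norm_sq_to_K]
    push_cast
    rfl
  have h1 : ∃ C : ℝ, 0 ≤ C ∧ ∀ F : Sch n, ‖emb F‖ ≤ C * ‖emb (-lapx F - z • F)‖ := by
    rcases re_or_im_of_not_halfLine hz with h | h
    · refine ⟨|z.im|⁻¹, by positivity, fun F => ?_⟩
      rw [inv_mul_eq_div, le_div_iff₀ (abs_pos.2 h)]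
      refine le_of_sq_le_mul (by positivity) (norm_nonneg _) ?_
      have h2 := (Complex.abs_im_le_norm _).trans
        (norm_inner_le_norm (𝕜 := ℂ) (emb F) (emb (-lapx F - z • F)))
      rw [hid, Complex.sub_im, Complex.ofReal_im, Complex.im_mul_ofReal, zero_sub, abs_neg,
        abs_mul, abs_of_nonneg (sq_nonneg ‖emb F‖)] at h2
      have := mul_le_mul_of_nonneg_right h2 (abs_nonneg z.im)
      nlinarith
    · refine ⟨(-z.re)⁻¹, inv_nonneg.2 (by linarith), fun F => ?_⟩
      rw [inv_mul_eq_div, le_div_iff₀ (by linarith)]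
      refine le_of_sq_le_mul (mul_nonneg (norm_nonneg _) (by linarith)) (norm_nonneg _) ?_
      have h2 := re_inner_le (emb F) (emb (-lapx F - z • F))
      rw [hid, Complex.sub_re, Complex.ofReal_re, Complex.re_mul_ofReal] at h2
      have h3 : 0 ≤ ∑ i, ‖emb (sdx i F)‖ ^ 2 := by positivity
      have : -z.re * ‖emb F‖ ^ 2 ≤ ‖emb F‖ * ‖emb (-lapx F - z • F)‖ := by linarith
      have := mul_le_mul_of_nonneg_right this (by linarith : 0 ≤ -z.re)
      nlinarith
  obtain ⟨C, hC, h⟩ := h1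
  refine ⟨1 + C + ‖z‖ * C, by positivity, fun F => ?_⟩
  set N := ‖emb (-lapx F - z • F)‖ with hN
  have hN0 : 0 ≤ N := norm_nonneg _
  have hF := h F
  refine ⟨hF.trans ?_, fun j => ⟨?_, ?_⟩⟩
  · gcongr
    nlinarith [mul_nonneg (norm_nonneg z) hC]
  · have h2 := re_inner_le (emb F) (emb (-lapx F - z • F))
    rw [hid, Complex.sub_re, Complex.ofReal_re, Complex.re_mul_ofReal, ← hN] at h2
    have h3 : ‖emb (sdx j F)‖ ^ 2 ≤ ∑ i, ‖emb (sdx i F)‖ ^ 2 :=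
      Finset.single_le_sum (f := fun i => ‖emb (sdx i F)‖ ^ 2) (fun _ _ => by positivity)
        (Finset.mem_univ j)
    refine (pow_le_pow_iff_left₀ (norm_nonneg _) (by positivity) two_ne_zero).1 ?_
    have h4 : z.re * ‖emb F‖ ^ 2 ≤ ‖z‖ * (C * N) ^ 2 := by
      gcongr
      exact Complex.re_le_norm z
    have h5 : ‖emb F‖ * N ≤ C * N * N := by gcongr
    have h6 : 0 ≤ ‖z‖ * C := by positivity
    have h7 : ‖z‖ * C * C + C ≤ (1 + C + ‖z‖ * C) ^ 2 := by
      nlinarith [mul_nonneg h6 hC]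
    calc _ ≤ (‖z‖ * C * C + C) * N ^ 2 := by linarith
      _ ≤ (1 + C + ‖z‖ * C) ^ 2 * N ^ 2 := by gcongr
      _ = _ := by ring
  · have h2 : ‖emb (lapx F)‖ ≤ (1 + C + ‖z‖ * C) * N := by
      have : emb (lapx F) = -(emb (-lapx F - z • F) + z • emb F) := by
        simp only [map_sub, map_neg, map_smul]
        abel
      rw [this, norm_neg]
      refine (norm_add_le _ _).trans ?_
      rw [norm_smul, ← hN]
      have h3 := mul_le_mul_of_nonneg_left hF (norm_nonneg z)
      have h4 := mul_nonneg hC hN0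
      linarith
    refine le_trans ?_ h2
    rw [← pow_le_pow_iff_left₀ (norm_nonneg _) (norm_nonneg _) two_ne_zero, ← norm_sdx_sdx_sq_sum]
    have h3 : ‖emb (sdx j (sdx j F))‖ ^ 2 ≤ ∑ k, ‖emb (sdx j (sdx k F))‖ ^ 2 :=
      Finset.single_le_sum (f := fun k => ‖emb (sdx j (sdx k F))‖ ^ 2)
        (fun _ _ => sq_nonneg _) (Finset.mem_univ j)
    exact h3.trans (Finset.single_le_sum (f := fun i => ∑ k, ‖emb (sdx i (sdx k F))‖ ^ 2)
      (fun _ _ => Finset.sum_nonneg fun _ _ => sq_nonneg _) (Finset.mem_univ j))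

/-- With `F = (-Δ_x - z)⁻¹ (P₀ - z) u`, the completed square gives `u = F - ∑ rais_j (P₀ - z + 1)⁻¹
low_j F`. Only the inverse at `z - 1` occurs, flanked by one velocity derivative on each side, and
the elliptic estimate supplies the `x`-derivatives of `F`. -/
theorem APriori.step {z : ℂ} (hz : z ∉ halfLine) (h : APriori n (z - 1)) : APriori n z := by
  obtain ⟨C₁, hC₁, h₁⟩ := h.bound_cre
  obtain ⟨C₂, hC₂, h₂⟩ := h.bound_ann
  obtain ⟨C₃, hC₃, h₃⟩ := exists_elliptic_bound (n := n) hz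
  refine ⟨C₃ + ∑ j : Fin n, (2 * C₁ * C₃ + 2 * C₂ * C₃), by positivity, fun u hu => ?_⟩
  obtain ⟨U, hU, hUu⟩ := hu.exists_lapx_eq hz
  set F := opT z U with hF
  have hFf : -lapx F - z • F = opT z u := by
    rw [← hUu, hF]
    simp only [lapx_apply, map_sub, map_neg, map_smul, map_sum, sdx_opT]
  have hFc : Core F := hU.opT z
  set N := ‖emb (opT z u)‖
  have hu' : u = F - ∑ j, rais j (low j U) := by
    rw [hF, opT_eq, ← hUu]
    abel
  have hj : ∀ j, ‖emb (rais j (low j U))‖ ≤ (2 * C₁ * C₃ + 2 * C₂ * C₃) * N := by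
    intro j
    obtain ⟨e0, e3⟩ := h₃ F
    obtain ⟨e1, e2⟩ := e3 j
    rw [hFf] at e0 e1 e2
    set y := low j U with hy
    have hyc : Core y := hU.low j
    -- The two parts of `low j F` are solved for separately: `y₁` takes `ann j F`, where the dual
    -- estimate is needed, and `y - y₁` takes `∂_{x_j} F`. The `∂_{x_j}` in `rais j` is passed to
    -- the right-hand sides, which costs `∂_{x_j}² F`.
    have hyT : opT (z - 1) y = ann j F + sdx j F := by rw [hy, ← low_opT, low_apply]
    obtain ⟨y₁, hy₁, hT₁⟩ := (hFc.ann j).exists_opT_eq (halfLine_sub_one hz)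
    have hT₂ : opT (z - 1) (y - y₁) = sdx j F := by rw [map_sub, hyT, hT₁, add_sub_cancel_left]
    have b1 := (h₂ y₁ F hy₁ hFc j hT₁).2
    have b2 := (h₂ (sdx j y₁) (sdx j F) (hy₁.sdx j) (hFc.sdx j) j
      (by rw [← sdx_opT, hT₁, sdx_ann])).1
    have b3 := (h₁ (y - y₁) (hyc.sub hy₁) j).2
    have b4 := (h₁ (sdx j (y - y₁)) ((hyc.sub hy₁).sdx j) j).1
    rw [← sdx_opT] at b4
    rw [hT₂] at b3 b4
    have hsum : emb (rais j y) = (emb (cre j y₁) + emb (sdx j y₁)) +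
        (emb (cre j (y - y₁)) + emb (sdx j (y - y₁))) := by
      rw [rais_apply]
      simp only [map_sub, map_add]
      abel
    rw [hsum]
    refine (norm_add_le _ _).trans ?_
    have c1 := norm_add_le (emb (cre j y₁)) (emb (sdx j y₁))
    have c2 := norm_add_le (emb (cre j (y - y₁))) (emb (sdx j (y - y₁)))
    have d0 := mul_le_mul_of_nonneg_left e0 hC₂
    have d1 := mul_le_mul_of_nonneg_left e1 hC₂
    have d2 := mul_le_mul_of_nonneg_left e1 hC₁
    have d3 := mul_le_mul_of_nonneg_left e2 hC₁
    linarith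
  calc ‖emb u‖ = ‖emb F - ∑ j, emb (rais j (low j U))‖ := by
        conv_lhs => rw [hu', map_sub, map_sum]
    _ ≤ ‖emb F‖ + ∑ j, ‖emb (rais j (low j U))‖ :=
        (norm_sub_le _ _).trans (by gcongr; exact norm_sum_le _ _)
    _ ≤ C₃ * N + ∑ j : Fin n, (2 * C₁ * C₃ + 2 * C₂ * C₃) * N := by
        refine add_le_add ?_ (Finset.sum_le_sum fun j _ => hj j)
        exact (h₃ F).1.trans_eq (by rw [hFf])
    _ = _ := by rw [← Finset.sum_mul]; ring

/-- Subtracting one from `z` finitely often reaches `Re z < 0` without meeting the half-line. -/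
theorem aPriori {z : ℂ} (hz : z ∉ halfLine) : APriori n z := by
  obtain ⟨k, hk⟩ := exists_nat_gt z.re
  induction k generalizing z with
  | zero => exact APriori.of_re_neg (by simpa using hk)
  | succ k ih =>
    refine APriori.step hz (ih (halfLine_sub_one hz) ?_)
    push_cast at hk
    simp
    linarith

end

section

/-! ### Density of the core -/

section CharFun

variable {E : Type*} [NormedAddCommGroup E] [NormedSpace ℝ E] [MeasurableSpace E]
  {μ : Measure E}

theorem integrable_mul_exp [BorelSpace E] {h : E → ℂ} (hh : Integrable h μ) (L : StrongDual ℝ E) :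
    Integrable (fun p => h p * Complex.exp (L p * Complex.I)) μ := by
  refine hh.mul_bdd (c := 1) (by fun_prop) (Filter.Eventually.of_forall fun p => ?_)
  rw [Complex.norm_exp_ofReal_mul_I]

theorem charFunDual_withDensity {f : E → ℝ} (hf : Integrable f μ) (hf0 : 0 ≤ f)
    (L : StrongDual ℝ E) : charFunDual (μ.withDensity fun p => ENNReal.ofReal (f p)) L =
      ∫ p, (f p : ℂ) * Complex.exp (L p * Complex.I) ∂μ := by
  rw [charFunDual_apply, integral_withDensity_eq_integral_toReal_smul₀]
  · refine integral_congr_ae (Filter.Eventually.of_forall fun p => ?_)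
    simp only [ENNReal.toReal_ofReal (hf0 p), Complex.real_smul]
  · exact hf.aemeasurable.ennreal_ofReal
  · exact Filter.Eventually.of_forall fun p => ENNReal.ofReal_lt_top

variable [BorelSpace E] [SecondCountableTopology E] [CompleteSpace E]

/-- The finite measures with densities `f⁺` and `f⁻` have the same characteristic function, hence
coincide. -/
theorem ae_eq_zero_of_fourier_real {f : E → ℝ} (hf : Integrable f μ)
    (h : ∀ L : StrongDual ℝ E, ∫ p, (f p : ℂ) * Complex.exp (L p * Complex.I) ∂μ = 0) :
    f =ᵐ[μ] 0 := by
  have hp := hf.pos_part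
  have hn := hf.neg.pos_part
  have ip : Integrable (fun p => ((max (f p) 0 : ℝ) : ℂ)) μ := hp.ofReal
  have iq : Integrable (fun p => ((max ((-f) p) 0 : ℝ) : ℂ)) μ := hn.ofReal
  have f1 : IsFiniteMeasure (μ.withDensity fun p => ENNReal.ofReal (max (f p) 0)) :=
    isFiniteMeasure_withDensity_ofReal hp.2
  have f2 : IsFiniteMeasure (μ.withDensity fun p => ENNReal.ofReal (max ((-f) p) 0)) :=
    isFiniteMeasure_withDensity_ofReal hn.2
  have heq : (μ.withDensity fun p => ENNReal.ofReal (max (f p) 0)) =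
      μ.withDensity fun p => ENNReal.ofReal (max ((-f) p) 0) := by
    refine Measure.ext_of_charFunDual (funext fun L => ?_)
    rw [charFunDual_withDensity hp fun p => le_max_right _ _,
      charFunDual_withDensity hn fun p => le_max_right _ _, ← sub_eq_zero,
      ← integral_sub (integrable_mul_exp ip L) (integrable_mul_exp iq L), ← h L]
    refine integral_congr_ae (Filter.Eventually.of_forall fun p => ?_)
    simp only [← sub_mul, ← Complex.ofReal_sub, Pi.neg_apply]
    congr 2
    rcases le_total (f p) 0 with h0 | h0
    · rw [max_eq_right h0, max_eq_left (by linarith)]; ring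
    · rw [max_eq_left h0, max_eq_right (by linarith)]; ring
  rw [withDensity_eq_iff hp.aemeasurable.ennreal_ofReal hn.aemeasurable.ennreal_ofReal
    hp.lintegral_lt_top.ne] at heq
  filter_upwards [heq] with p hp
  rw [ENNReal.ofReal_eq_ofReal_iff (le_max_right _ _) (le_max_right _ _), Pi.neg_apply] at hp
  rcases le_total (f p) 0 with h0 | h0
  · rw [max_eq_right h0, max_eq_left (by linarith)] at hp
    simp only [Pi.zero_apply]; linarith
  · rw [max_eq_left h0, max_eq_right (by linarith)] at hp
    exact hp

/-- An integrable function with vanishing Fourier transform vanishes. -/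
theorem ae_eq_zero_of_fourier {h : E → ℂ} (hh : Integrable h μ)
    (h0 : ∀ L : StrongDual ℝ E, ∫ p, h p * Complex.exp (L p * Complex.I) ∂μ = 0) :
    h =ᵐ[μ] 0 := by
  have hc : ∀ L : StrongDual ℝ E,
      ∫ p, starRingEnd ℂ (h p) * Complex.exp (L p * Complex.I) ∂μ = 0 := by
    intro L
    have := congrArg (starRingEnd ℂ) (h0 (-L))
    rw [← integral_conj, map_zero] at this
    rw [← this]
    refine integral_congr_ae (Filter.Eventually.of_forall fun p => ?_)
    simp [← Complex.exp_conj]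
  have hcI : Integrable (fun p => starRingEnd ℂ (h p)) μ :=
    (Complex.conjCLE : ℂ →L[ℝ] ℂ).integrable_comp hh
  have hre : (fun p => (h p).re) =ᵐ[μ] 0 := by
    refine ae_eq_zero_of_fourier_real hh.re fun L => ?_
    have h1 : ∀ p, ((h p).re : ℂ) * Complex.exp (L p * Complex.I) =
        (1 / 2 : ℂ) * (h p * Complex.exp (L p * Complex.I) +
          starRingEnd ℂ (h p) * Complex.exp (L p * Complex.I)) := by
      intro p
      rw [Complex.re_eq_add_conj]
      ring
    simp only [h1]
    rw [integral_const_mul, integral_add (integrable_mul_exp hh L) (integrable_mul_exp hcI L),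
      h0, hc]
    simp
  have him : (fun p => (h p).im) =ᵐ[μ] 0 := by
    refine ae_eq_zero_of_fourier_real hh.im fun L => ?_
    have h1 : ∀ p, ((h p).im : ℂ) * Complex.exp (L p * Complex.I) =
        (1 / (2 * Complex.I) : ℂ) * (h p * Complex.exp (L p * Complex.I) -
          starRingEnd ℂ (h p) * Complex.exp (L p * Complex.I)) := by
      intro p
      rw [Complex.im_eq_sub_conj]
      ring
    simp only [h1]
    rw [integral_const_mul, integral_sub (integrable_mul_exp hh L) (integrable_mul_exp hcI L),
      h0, hc]
    simp
  filter_upwards [hre, him] with p h1 h2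
  exact Complex.ext h1 h2

end CharFun

variable {n : ℕ}

/-- The coordinate function `x_j - v_j`. -/
def cy (j : Fin n) : Phase n → ℂ := fun p => (((p.1 - p.2) j : ℝ) : ℂ)

theorem cy_eq (j : Fin n) : (cy j : Phase n → ℂ) = (Complex.ofRealCLM ∘L
    (EuclideanSpace.proj j : Conf n →L[ℝ] ℝ) ∘L (ContinuousLinearMap.fst ℝ (Conf n) (Conf n) -
      ContinuousLinearMap.snd ℝ (Conf n) (Conf n))) := rfl

theorem cy_temperate (j : Fin n) : (cy j : Phase n → ℂ).HasTemperateGrowth := by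
  rw [cy_eq]
  exact ContinuousLinearMap.hasTemperateGrowth _

theorem fderiv_cy (j : Fin n) (p m : Phase n) :
    fderiv ℝ (cy j) p m = (((m.1 - m.2) j : ℝ) : ℂ) := by
  rw [cy_eq, ContinuousLinearMap.fderiv]
  rfl

theorem smulS_const (c : ℂ) (u : Sch n) : smulS (fun _ => c) u = c • u := by
  ext p
  rw [smulS_apply (Function.HasTemperateGrowth.const _)]
  rfl

/-- The terms `-∂_v` and `∂_x` of `rais` both differentiate `x - v` to `1`, which is the origin of
the `2`. -/
theorem smulS_cy_rais (i j : Fin n) (u : Sch n) :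
    smulS (cy j) (rais i u) =
      rais i (smulS (cy j) u) - (if i = j then (2 : ℂ) else 0) • u := by
  have h1 := sder_smulS (cy_temperate j) (g' := fun _ => if i = j then (1 : ℂ) else 0)
    (Function.HasTemperateGrowth.const _) (ex i) (fun p => by
      rw [fderiv_cy]
      simp only [ex, sub_zero, PiLp.single_apply, eq_comm (a := j)]
      split_ifs <;> simp) u
  have h2 := sder_smulS (cy_temperate j) (g' := fun _ => if i = j then (-1 : ℂ) else 0)
    (Function.HasTemperateGrowth.const _) (ev i) (fun p => by
      rw [fderiv_cy]
      simp only [ev, zero_sub, PiLp.neg_apply, PiLp.single_apply, eq_comm (a := j)]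
      split_ifs <;> simp) u
  have h3 : smv i (smulS (cy j) u) = smulS (cy j) (smv i u) :=
    smulS_comm (cv_temperate i) (cy_temperate j) u
  rw [smulS_const] at h1 h2
  rw [rais_apply, rais_apply, cre_apply, cre_apply, h3]
  have h1' : sdx i (smulS (cy j) u) = _ := h1
  have h2' : sdv i (smulS (cy j) u) = _ := h2
  rw [h1', h2']
  change smulS (cy j) (-sdv i u + (1 / 2 : ℂ) • smv i u + sdx i u) =
    -(smulS (cy j) (sdv i u) + _) + _ + (smulS (cy j) (sdx i u) + _) - _
  simp only [map_add, map_neg, map_smul]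
  split_ifs
  · module
  · module

theorem Core.smulS_cy (j : Fin n) {u : Sch n} (hu : Core u) : Core (smulS (cy j) u) := by
  induction hu with
  | base g =>
    have ht : (fun y : Conf n => ((y j : ℝ) : ℂ)).HasTemperateGrowth :=
      (Complex.ofRealCLM ∘L (EuclideanSpace.proj j : Conf n →L[ℝ] ℝ)).hasTemperateGrowth
    have : smulS (cy j) (baseS g) =
        baseS (SchwartzMap.smulLeftCLM ℂ (fun y : Conf n => ((y j : ℝ) : ℂ)) g) := by
      ext p
      rw [smulS_apply (cy_temperate j), baseS_apply, baseS_apply,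
        SchwartzMap.smulLeftCLM_apply_apply ht, smul_eq_mul, mul_assoc]
      rfl
    rw [this]
    exact Core.base _
  | rais i hu ih => rw [smulS_cy_rais]; exact (ih.rais i).sub (hu.smul _)
  | add _ _ ih ih' => rw [map_add]; exact ih.add ih'
  | smul c _ ih => rw [map_smul]; exact ih.smul c

theorem dual_eq_sum (L : StrongDual ℝ (Conf n)) (x : Conf n) :
    L x = ∑ i, x i * L (EuclideanSpace.single i 1) := by
  conv_lhs => rw [← (EuclideanSpace.basisFun (Fin n) ℝ).sum_repr x]
  simp

/-- Every linear form splits into a form in `x - v` and a form in `v`, and the core is stable under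
multiplication by both sets of coordinates. -/
theorem Core.exists_mul_dual (L : StrongDual ℝ (Phase n)) {u : Sch n} (hu : Core u) :
    ∃ w, Core w ∧ ∀ p, w p = (L p : ℂ) * u p := by
  set L₁ : StrongDual ℝ (Conf n) := L.comp (ContinuousLinearMap.inl ℝ _ _)
  set L₂ : StrongDual ℝ (Conf n) := L.comp ((ContinuousLinearMap.inl ℝ _ _) +
    (ContinuousLinearMap.inr ℝ _ _))
  refine ⟨∑ i, ((L₁ (EuclideanSpace.single i 1) : ℂ) • KFP.smulS (cy i) u +
    (L₂ (EuclideanSpace.single i 1) : ℂ) • KFP.smv i u),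
    Core.sum fun i _ => ((hu.smulS_cy i).smul _).add ((hu.smv i).smul _), fun p => ?_⟩
  have h1 : L p = L₁ (p.1 - p.2) + L₂ p.2 := by
    simp only [L₁, L₂, ContinuousLinearMap.comp_apply, ContinuousLinearMap.inl_apply,
      _root_.add_apply, ContinuousLinearMap.inr_apply, ← map_add]
    simp
  have h3 : ∀ i, KFP.smv i u p = cv i p * u p := fun i => smulS_apply (cv_temperate i) u p
  rw [h1, dual_eq_sum L₁, dual_eq_sum L₂, ← Finset.sum_add_distrib, _root_.sum_apply]
  push_cast
  rw [Finset.sum_mul]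
  refine Finset.sum_congr rfl fun i _ => ?_
  rw [Pi.add_apply, Pi.smul_apply, Pi.smul_apply, h3, smulS_apply (cy_temperate i)]
  simp only [cv, cy, smul_eq_mul, PiLp.sub_apply]
  push_cast
  ring

theorem Core.exists_mul_dual_pow (L : StrongDual ℝ (Phase n)) {u : Sch n} (hu : Core u) (k : ℕ) :
    ∃ w, Core w ∧ ∀ p, w p = (L p : ℂ) ^ k * u p := by
  induction k with
  | zero => exact ⟨u, hu, fun p => by simp⟩
  | succ k ih =>
    obtain ⟨w, hw, h⟩ := ih
    obtain ⟨w', hw', h'⟩ := hw.exists_mul_dual L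
    exact ⟨w', hw', fun p => by rw [h', h]; ring⟩

/-- The dominating function is a multiple of the Gaussian dilated by a factor of two. -/
theorem exists_exp_mul_gauss_le (L : StrongDual ℝ (Phase n)) :
    ∃ w : Sch n, ∀ p, Real.exp |L p| * ‖baseS (gaussS (Conf n)) p‖ ≤ ‖w p‖ := by
  set A := ‖L.comp ((shear n).symm : Phase n →L[ℝ] Phase n)‖
  set e : Phase n ≃L[ℝ] Phase n :=
    ContinuousLinearEquiv.smulLeft (Units.mk0 (1 / 2 : ℝ) (by norm_num))
  refine ⟨(Real.exp (3 * A ^ 2) : ℂ) •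
    SchwartzMap.compCLMOfContinuousLinearEquiv ℂ e (baseS (gaussS (Conf n))), fun p => ?_⟩
  set y := p.1 - p.2
  set v := p.2
  have h1 : |L p| ≤ A * (‖y‖ + ‖v‖) := by
    have h := (L.comp ((shear n).symm : Phase n →L[ℝ] Phase n)).le_opNorm (shear n p)
    have h2 : ‖shear n p‖ ≤ ‖y‖ + ‖v‖ := by
      rw [shear_apply, Prod.norm_def]
      exact max_le (le_add_of_nonneg_right (norm_nonneg _))
        (le_add_of_nonneg_left (norm_nonneg _))
    rw [ContinuousLinearMap.comp_apply] at h
    simp only [ContinuousLinearEquiv.coe_coe, ContinuousLinearEquiv.symm_apply_apply] at h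
    exact h.trans (by gcongr)
  have hnorm : ∀ q : Phase n, ‖baseS (gaussS (Conf n)) q‖ =
      Real.exp (-(‖q.1 - q.2‖ ^ 2 / 4) + -(‖q.2‖ ^ 2 / 4)) := fun q => by
    rw [baseS_apply, gaussS_apply, gaussS_apply, ← Complex.ofReal_mul, ← Real.exp_add,
      Complex.norm_real, Real.norm_of_nonneg (Real.exp_pos _).le]
  have h2 : ((Real.exp (3 * A ^ 2) : ℂ) • SchwartzMap.compCLMOfContinuousLinearEquiv ℂ e
      (baseS (gaussS (Conf n)))) p = (Real.exp (3 * A ^ 2) : ℂ) *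
        baseS (gaussS (Conf n)) ((1 / 2 : ℝ) • p) := rfl
  rw [h2, norm_mul, hnorm, hnorm, Complex.norm_real, Real.norm_of_nonneg (Real.exp_pos _).le,
    ← Real.exp_add, ← Real.exp_add, Real.exp_le_exp, Prod.smul_fst, Prod.smul_snd, ← smul_sub,
    norm_smul, norm_smul, Real.norm_of_nonneg (by norm_num)]
  change |L p| + (-(‖y‖ ^ 2 / 4) + -(‖v‖ ^ 2 / 4)) ≤
    3 * A ^ 2 + (-((1 / 2 * ‖y‖) ^ 2 / 4) + -((1 / 2 * ‖v‖) ^ 2 / 4))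
  -- After the dilation a deficit `3t²/16` is left for `t = ‖y‖` and `t = ‖v‖`, and `A t - 3t²/16 ≤
  -- 4A²/3`; the two together stay below `3A²`.
  nlinarith [sq_nonneg (3 / 8 * ‖y‖ - A), sq_nonneg (3 / 8 * ‖v‖ - A)]

/-- A square integrable function orthogonal to the core vanishes. -/
theorem ae_eq_zero_of_core {U : Phase n → ℂ} (hU : MemLp U 2 volume)
    (h : ∀ f : Sch n, Core f → ∫ p, U p * f p = 0) : U =ᵐ[volume] 0 := by
  set Φ : Sch n := baseS (gaussS (Conf n)) with hΦ
  have hint : ∀ w : Sch n, Integrable (fun p => U p * w p) volume := fun w =>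
    hU.integrable_mul (w.memLp 2 volume)
  have hz : (fun p => U p * Φ p) =ᵐ[volume] 0 := by
    refine ae_eq_zero_of_fourier (hint Φ) fun L => ?_
    obtain ⟨w, hw⟩ := exists_exp_mul_gauss_le L
    -- The exponential is expanded into its power series under the integral. Each term is a moment
    -- of `U Φ` along `L`, hence a pairing of `U` with the core, and vanishes; the bound `e^{|L|}
    -- |Φ| ≤ |w|` dominates the series.
    have hs := hasSum_integral_of_dominated_convergence (μ := volume)
      (F := fun (k : ℕ) (p : Phase n) =>
        U p * Φ p * ((L p * Complex.I) ^ k / (Nat.factorial k : ℂ)))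
      (f := fun p => U p * Φ p * Complex.exp (L p * Complex.I))
      (fun k p => ‖U p‖ * ‖Φ p‖ * (|L p| ^ k / (Nat.factorial k : ℝ)))
      (fun k => (hint Φ).aestronglyMeasurable.mul (by fun_prop))
      (fun k => Filter.Eventually.of_forall fun p => by
        simp only [norm_mul, norm_div, norm_pow, Complex.norm_I, mul_one, Complex.norm_real,
          Complex.norm_natCast, Real.norm_eq_abs]
        exact le_rfl)
      (Filter.Eventually.of_forall fun p => (Real.summable_pow_div_factorial |L p|).mul_left _)
      (by
        have he : ∀ p, ∑' k : ℕ, ‖U p‖ * ‖Φ p‖ * (|L p| ^ k / (Nat.factorial k : ℝ)) =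
            ‖U p‖ * ‖Φ p‖ * Real.exp |L p| := fun p => by
          rw [tsum_mul_left, Real.exp_eq_exp_ℝ, NormedSpace.exp_eq_tsum_div]
        simp only [he]
        refine (hint w).norm.mono' ?_ (Filter.Eventually.of_forall fun p => ?_)
        · exact (hU.1.norm.mul Φ.continuous.norm.aestronglyMeasurable).mul (by fun_prop)
        · rw [norm_mul, norm_mul, norm_norm, norm_norm, Real.norm_of_nonneg (Real.exp_pos _).le,
            norm_mul, mul_assoc, mul_comm ‖Φ p‖]
          exact mul_le_mul_of_nonneg_left (hw p) (norm_nonneg _))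
      (Filter.Eventually.of_forall fun p => by
        have := (NormedSpace.expSeries_div_hasSum_exp (L p * Complex.I : ℂ)).mul_left (U p * Φ p)
        rwa [← Complex.exp_eq_exp_ℂ] at this)
    refine hs.unique ?_
    have h0 : ∀ k : ℕ, ∫ p, U p * Φ p * ((L p * Complex.I) ^ k / (Nat.factorial k : ℂ)) = 0 := by
      intro k
      obtain ⟨f, hf, hfp⟩ := (Core.base (gaussS (Conf n))).exists_mul_dual_pow L k
      have : ∀ p, U p * Φ p * ((L p * Complex.I) ^ k / (Nat.factorial k : ℂ)) =
          (Complex.I ^ k / (Nat.factorial k : ℂ)) * (U p * f p) := fun p => by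
        rw [hfp, hΦ]
        ring
      simp only [this]
      rw [integral_const_mul, h f hf, mul_zero]
    simp only [h0]
    exact hasSum_zero
  filter_upwards [hz] with p hp
  have : Φ p ≠ 0 := by
    rw [hΦ, baseS_apply, gaussS_apply, gaussS_apply]
    exact mul_ne_zero (Complex.ofReal_ne_zero.2 (Real.exp_ne_zero _))
      (Complex.ofReal_ne_zero.2 (Real.exp_ne_zero _))
  exact (mul_eq_zero.1 hp).resolve_right this

/-- The image of the core in `L²`. -/
def coreL2 (n : ℕ) : Submodule ℂ (L2 n) where
  carrier := {u | ∃ f : Sch n, Core f ∧ emb f = u}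
  add_mem' := by
    rintro _ _ ⟨f, hf, rfl⟩ ⟨g, hg, rfl⟩
    exact ⟨f + g, hf.add hg, map_add _ _ _⟩
  zero_mem' := ⟨0, Core.zero, map_zero _⟩
  smul_mem' := by
    rintro c _ ⟨f, hf, rfl⟩
    exact ⟨c • f, hf.smul c, map_smul _ _ _⟩

theorem coreL2_dense (n : ℕ) : (coreL2 n).topologicalClosure = ⊤ := by
  rw [Submodule.topologicalClosure_eq_top_iff, Submodule.eq_bot_iff]
  intro w hw
  rw [Submodule.mem_orthogonal] at hw
  have hwm : MemLp (fun p => starRingEnd ℂ (w p)) 2 volume := (Lp.memLp w).star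
  have h0 := ae_eq_zero_of_core hwm fun f hf => by
    have h1 := hw (emb f) ⟨f, hf, rfl⟩
    rw [L2.inner_def] at h1
    have h2 := congrArg (starRingEnd ℂ) h1
    rw [← integral_conj, map_zero] at h2
    rw [← h2]
    refine integral_congr_ae ?_
    filter_upwards [coeFn_emb f] with p hp
    rw [hp]
    simp [RCLike.inner_apply]
  rw [Lp.eq_zero_iff_ae_eq_zero]
  filter_upwards [h0] with p hp
  simpa using hp

theorem exists_core_seq (w : L2 n) : ∃ f : ℕ → Sch n, (∀ k, Core (f k)) ∧
    Filter.Tendsto (fun k => emb (f k)) Filter.atTop (nhds w) := by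
  have hw : w ∈ closure ((coreL2 n : Submodule ℂ (L2 n)) : Set (L2 n)) := by
    rw [← Submodule.topologicalClosure_coe, coreL2_dense]
    trivial
  obtain ⟨x, hx, hlim⟩ := mem_closure_iff_seq_limit.1 hw
  choose f hf hfx using hx
  exact ⟨f, hf, by simpa only [hfx] using hlim⟩

end

section

/-! ### Closed operators -/

section Closed

variable {H : Type*} [NormedAddCommGroup H] [NormedSpace ℂ H]

/-- Sequential closedness of the graph of an unbounded operator. -/
def SeqClosed (A : H →ₗ.[ℂ] H) : Prop :=
  ∀ (u : ℕ → A.domain) (x y : H), Filter.Tendsto (fun k => (u k : H)) Filter.atTop (nhds x) →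
    Filter.Tendsto (fun k => A (u k)) Filter.atTop (nhds y) → ∃ h : x ∈ A.domain, A ⟨x, h⟩ = y

variable [CompleteSpace H]

/-- A closed injective operator `A - z`, which has uniformly bounded preimages on a dense set, has
a bounded inverse. -/
theorem SeqClosed.exists_resolvent {A : H →ₗ.[ℂ] H} (hA : SeqClosed A) {z : ℂ}
    (hinj : ∀ u : A.domain, A u = z • (u : H) → (u : H) = 0) {C : ℝ} {S : Submodule ℂ H}
    (hS : S.topologicalClosure = ⊤)
    (h : ∀ f ∈ S, ∃ u : A.domain, A u - z • (u : H) = f ∧ ‖(u : H)‖ ≤ C * ‖f‖) :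
    ∃ R : H →L[ℂ] H, IsResolventAt A z R := by
  have huniq : ∀ u w : A.domain, A u - z • (u : H) = A w - z • (w : H) → (u : H) = w := by
    intro u w huw
    rw [← sub_eq_zero, ← Submodule.coe_sub]
    refine hinj (u - w) ?_
    rw [LinearPMap.map_sub, Submodule.coe_sub, smul_sub, ← sub_eq_zero]
    rw [← sub_eq_zero] at huw
    rw [← huw]
    abel
  -- By injectivity the bound for the chosen preimage holds for every preimage, so it can be applied
  -- to differences.
  have hbd : ∀ u : A.domain, A u - z • (u : H) ∈ S → ‖(u : H)‖ ≤ C * ‖A u - z • (u : H)‖ := by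
    intro u hu
    obtain ⟨w, hw, hwC⟩ := h _ hu
    rwa [huniq w u hw] at hwC
  have hex : ∀ f : H, ∃ u : A.domain, A u - z • (u : H) = f ∧ ‖(u : H)‖ ≤ C * ‖f‖ := by
    intro f
    have hf : f ∈ closure (S : Set H) := by
      rw [← Submodule.topologicalClosure_coe, hS]
      trivial
    obtain ⟨g, hg, hlim⟩ := mem_closure_iff_seq_limit.1 hf
    choose u hu huC using fun k => h (g k) (hg k)
    have hcau : CauchySeq fun k => (u k : H) := by
      have hgc := hlim.cauchySeq
      rw [Metric.cauchySeq_iff] at hgc ⊢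
      intro ε hε
      obtain ⟨N, hN⟩ := hgc (ε / (|C| + 1)) (by positivity)
      refine ⟨N, fun k hk l hl => ?_⟩
      have h1 := hN k hk l hl
      rw [dist_eq_norm] at h1 ⊢
      have h2 : A (u k - u l) - z • ((u k - u l : A.domain) : H) = g k - g l := by
        rw [LinearPMap.map_sub, Submodule.coe_sub, smul_sub, ← hu k, ← hu l]
        abel
      have h3 := hbd (u k - u l) (by rw [h2]; exact S.sub_mem (hg k) (hg l))
      rw [h2, Submodule.coe_sub] at h3
      rw [lt_div_iff₀ (by positivity)] at h1
      calc _ ≤ _ := h3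
        _ ≤ (|C| + 1) * ‖g k - g l‖ := by
          gcongr
          exact (le_abs_self C).trans (by linarith)
        _ < ε := by rwa [mul_comm]
    obtain ⟨x, hx⟩ := cauchySeq_tendsto_of_complete hcau
    have hAu : Filter.Tendsto (fun k => A (u k)) Filter.atTop (nhds (f + z • x)) := by
      have : (fun k => A (u k)) = fun k => g k + z • (u k : H) := by
        ext k
        rw [← hu k]
        abel
      rw [this]
      exact hlim.add (hx.const_smul z)
    obtain ⟨hxd, hxA⟩ := hA u x _ hx hAu
    refine ⟨⟨x, hxd⟩, by rw [hxA, add_sub_cancel_right], ?_⟩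
    exact le_of_tendsto_of_tendsto' hx.norm (hlim.norm.const_mul C) huC
  choose Rf hR hRC using hex
  refine ⟨LinearMap.mkContinuous
    { toFun := fun f => (Rf f : H)
      map_add' := fun f g => by
        rw [← Submodule.coe_add]
        refine huniq _ _ ?_
        rw [hR, LinearPMap.map_add, Submodule.coe_add, smul_add, add_sub_add_comm, hR, hR]
      map_smul' := fun c f => by
        rw [RingHom.id_apply, ← Submodule.coe_smul]
        refine huniq _ _ ?_
        rw [hR, LinearPMap.map_smul, Submodule.coe_smul, smul_comm z c, ← smul_sub, hR] } C hRC,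
    fun f => ⟨(Rf f).2, hR f⟩, fun u => huniq _ _ (hR _)⟩

end Closed

variable {n : ℕ}

/-! ### Maximal realizations and multiplication operators -/

theorem toDist_apply (w : L2 n) (φ : Sch n) : toDist n w φ = ∫ p, φ p • w p :=
  Lp.toTemperedDistribution_apply w φ

theorem maximal_eq {A : 𝓢'(Phase n, ℂ) →L[ℂ] 𝓢'(Phase n, ℂ)} {u w : L2 n}
    (h : A (toDist n u) = toDist n w) : ∃ hu : u ∈ (maximal A).domain, maximal A ⟨u, hu⟩ = w := by
  have hu : u ∈ (maximal A).domain := ⟨w, h.symm⟩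
  exact ⟨hu, toDist_injective n (by rw [toDist_maximal, ← h])⟩

theorem toDist_continuous (n : ℕ) : Continuous (toDist n) :=
  (Lp.toTemperedDistributionCLM ℂ (volume : Measure (Phase n)) 2).continuous

theorem seqClosed_maximal (A : 𝓢'(Phase n, ℂ) →L[ℂ] 𝓢'(Phase n, ℂ)) :
    SeqClosed (maximal A) := by
  intro u x y hx hy
  refine maximal_eq ?_
  have h1 := ((A.continuous.comp (toDist_continuous n)).tendsto x).comp hx
  have h2 := ((toDist_continuous n).tendsto y).comp hy
  refine tendsto_nhds_unique h1 (h2.congr fun k => ?_)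
  exact toDist_maximal A (u k)

theorem mulOp_coeFn (m : Phase n → ℂ) (u : (mulOp m).domain) :
    mulOp m u =ᵐ[volume] fun p => m p * (u : L2 n) p :=
  MemLp.coeFn_toLp (f := fun p => m p * (u : L2 n) p) u.2

theorem mulOp_eq {m : Phase n → ℂ} {u w : L2 n} (h : w =ᵐ[volume] fun p => m p * u p) :
    ∃ hu : u ∈ (mulOp m).domain, mulOp m ⟨u, hu⟩ = w := by
  have hu : u ∈ (mulOp m).domain := (Lp.memLp w).ae_eq h
  exact ⟨hu, Lp.ext ((mulOp_coeFn m ⟨u, hu⟩).trans h.symm)⟩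

theorem exists_subseq_ae {u : ℕ → L2 n} {x : L2 n}
    (h : Filter.Tendsto u Filter.atTop (nhds x)) :
    ∃ ns : ℕ → ℕ, StrictMono ns ∧ ∀ᵐ p, Filter.Tendsto (fun k => u (ns k) p) Filter.atTop
      (nhds (x p)) :=
  (tendstoInMeasure_of_tendsto_Lp h).exists_seq_tendsto_ae

/-- Along a common subsequence both sequences converge almost everywhere, where multiplication by `m
p` is continuous. -/
theorem seqClosed_mulOp (m : Phase n → ℂ) : SeqClosed (mulOp m) := by
  intro u x y hx hy
  refine mulOp_eq ?_
  obtain ⟨ns, hns, h1⟩ := exists_subseq_ae hx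
  obtain ⟨ms, hms, h2⟩ := exists_subseq_ae (hy.comp hns.tendsto_atTop)
  have h3 : ∀ᵐ p, ∀ k, mulOp m (u k) p = m p * (u k : L2 n) p :=
    ae_all_iff.2 fun k => mulOp_coeFn m (u k)
  filter_upwards [h1, h2, h3] with p hp1 hp2 hp3
  refine tendsto_nhds_unique hp2 ?_
  simp only [Function.comp_apply, hp3]
  exact (hp1.comp hms.tendsto_atTop).const_mul (m p)

/-! ### The free operator on Schwartz functions -/

theorem toDist_emb (u : Sch n) :
    toDist n (emb u) = SchwartzMap.toTemperedDistributionCLM (Phase n) ℂ volume u :=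
  Lp.toTemperedDistribution_toLp_eq u

theorem lineDeriv_toDist_emb (m : Phase n) (u : Sch n) :
    LineDeriv.lineDerivOpCLM ℂ 𝓢'(Phase n, ℂ) m (toDist n (emb u)) =
      toDist n (emb (sder m u)) := by
  rw [toDist_emb, toDist_emb]
  exact TemperedDistribution.lineDerivOp_toTemperedDistributionCLM_eq u m

theorem dx_toDist_emb (i : Fin n) (u : Sch n) :
    dx i (toDist n (emb u)) = toDist n (emb (sdx i u)) := lineDeriv_toDist_emb _ u

theorem dv_toDist_emb (i : Fin n) (u : Sch n) :
    dv i (toDist n (emb u)) = toDist n (emb (sdv i u)) := lineDeriv_toDist_emb _ u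

theorem smulLeft_toDist_emb {g : Phase n → ℂ} (hg : g.HasTemperateGrowth) (u : Sch n) :
    TemperedDistribution.smulLeftCLM ℂ g (toDist n (emb u)) = toDist n (emb (smulS g u)) := by
  ext φ
  rw [TemperedDistribution.smulLeftCLM_apply_apply, toDist_apply, toDist_apply]
  refine integral_congr_ae ?_
  filter_upwards [coeFn_emb u, coeFn_emb (smulS g u)] with p h1 h2
  simp only [h1, h2, SchwartzMap.smulLeftCLM_apply_apply hg, smulS_apply hg, smul_eq_mul]
  ring

theorem mulV_toDist_emb (i : Fin n) (u : Sch n) :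
    mulV i (toDist n (emb u)) = toDist n (emb (smv i u)) :=
  smulLeft_toDist_emb (cv_temperate i) u

/-- Multiplication by `|v|²` on Schwartz functions. -/
def snv : Sch n →ₗ[ℂ] Sch n := smulS fun p => ((‖p.2‖ ^ 2 : ℝ) : ℂ)

theorem snv_eq (u : Sch n) : snv u = ∑ i, smv i (smv i u) := by
  ext p
  have h : ∀ i (w : Sch n), smv i w p = cv i p * w p := fun i w =>
    smulS_apply (cv_temperate i) w p
  have h' : snv u p = ((‖p.2‖ ^ 2 : ℝ) : ℂ) * u p := smulS_apply (hasTemperateGrowth_normSq_v n) u p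
  rw [h', _root_.sum_apply]
  simp only [h, cv]
  rw [EuclideanSpace.real_norm_sq_eq]
  push_cast
  rw [Finset.sum_mul]
  exact Finset.sum_congr rfl fun i _ => by ring

theorem opT_expand (z : ℂ) (u : Sch n) :
    opT z u = -(∑ i, sdv i (sdv i u)) + (1 / 4 : ℂ) • snv u - ((n : ℂ) / 2) • u +
      ∑ i, smv i (sdx i u) - z • u := by
  rw [opT_apply, snv_eq]
  congr 2
  have h : ∀ i, cre i (ann i u) =
      -sdv i (sdv i u) + (1 / 4 : ℂ) • smv i (smv i u) - (1 / 2 : ℂ) • u := fun i => by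
    simp only [cre_apply, ann_apply, map_add, map_smul, sdv_smv, if_true]
    module
  simp only [h, Finset.sum_sub_distrib, Finset.sum_add_distrib, Finset.sum_neg_distrib,
    Finset.smul_sum, Finset.sum_const, Finset.card_univ, Fintype.card_fin]
  congr 1
  rw [← Nat.cast_smul_eq_nsmul ℂ, smul_smul]
  congr 1
  ring

theorem freeExpr_apply (T : 𝓢'(Phase n, ℂ)) :
    freeExpr n T = -(∑ i, dv i (dv i T)) + (1 / 4 : ℂ) • mulNormSqV n T - ((n : ℂ) / 2) • T +
      ∑ i, mulV i (dx i T) := by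
  simp [freeExpr]

theorem freeExpr_toDist_emb (u : Sch n) :
    freeExpr n (toDist n (emb u)) = toDist n (emb (opT 0 u)) := by
  have h : mulNormSqV n (toDist n (emb u)) = toDist n (emb (snv u)) :=
    smulLeft_toDist_emb (hasTemperateGrowth_normSq_v n) u
  rw [freeExpr_apply, opT_expand, h]
  simp only [dv_toDist_emb, dx_toDist_emb, mulV_toDist_emb, map_add, map_sub, map_neg, map_sum,
    map_smul, zero_smul, sub_zero]

theorem P0_emb (u : Sch n) : ∃ h : emb u ∈ (P0 n).domain, P0 n ⟨emb u, h⟩ = emb (opT 0 u) :=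
  maximal_eq (freeExpr_toDist_emb u)

/-- The reflection `(x, v) ↦ (x, -v)`. -/
def reflE (n : ℕ) : Phase n ≃L[ℝ] Phase n :=
  (ContinuousLinearEquiv.refl ℝ (Conf n)).prodCongr (ContinuousLinearEquiv.neg ℝ)

theorem reflE_apply (p : Phase n) : reflE n p = (p.1, -p.2) := rfl

/-- Composition of Schwartz functions with the reflection `(x, v) ↦ (x, -v)`. -/
def sref : Sch n →ₗ[ℂ] Sch n :=
  (SchwartzMap.compCLMOfContinuousLinearEquiv ℂ (reflE n)).toLinearMap

theorem sref_apply (u : Sch n) (p : Phase n) : sref u p = u (p.1, -p.2) := rfl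

theorem sdv_sref (i : Fin n) (u : Sch n) : sdv i (sref u) = -sref (sdv i u) := by
  have h := SchwartzMap.lineDerivOp_compCLMOfContinuousLinearEquiv ℂ (ev i) (reflE n) u
  have h' : reflE n (ev i) = -ev i := by simp [reflE_apply, ev]
  rw [h', LineDeriv.lineDerivOp_left_neg, map_neg] at h
  exact h

theorem sdx_sref (i : Fin n) (u : Sch n) : sdx i (sref u) = sref (sdx i u) := by
  have h := SchwartzMap.lineDerivOp_compCLMOfContinuousLinearEquiv ℂ (ex i) (reflE n) u
  have h' : reflE n (ex i) = ex i := by simp [reflE_apply, ex]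
  rw [h'] at h
  exact h

theorem smv_sref (i : Fin n) (u : Sch n) : smv i (sref u) = -sref (smv i u) := by
  ext p
  have h : ∀ (w : Sch n) p, smv i w p = cv i p * w p := fun w => smulS_apply (cv_temperate i) w
  rw [h, _root_.neg_apply, sref_apply, sref_apply, h]
  simp [cv]

theorem snv_sref (u : Sch n) : snv (sref u) = sref (snv u) := by
  simp only [snv_eq, map_sum, smv_sref, map_neg, neg_neg]

/-- The transpose of `P₀` differs from `P₀` by the sign of the transport term, and the reflection of
`v` restores that sign. -/
theorem freeExpr_apply_sref (T : 𝓢'(Phase n, ℂ)) (φ : Sch n) :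
    freeExpr n T (sref φ) = T (sref (opT 0 φ)) := by
  have h1 : ∀ i (T : 𝓢'(Phase n, ℂ)) (φ : Sch n), dv i T φ = -T (sdv i φ) := fun i T φ => by
    rw [← map_neg]; rfl
  have h2 : ∀ i (T : 𝓢'(Phase n, ℂ)) (φ : Sch n), dx i T φ = -T (sdx i φ) := fun i T φ => by
    rw [← map_neg]; rfl
  have h3 : ∀ i (T : 𝓢'(Phase n, ℂ)) (φ : Sch n), mulV i T φ = T (smv i φ) := fun i T φ => rfl
  have h4 : ∀ (T : 𝓢'(Phase n, ℂ)) (φ : Sch n), mulNormSqV n T φ = T (snv φ) := fun T φ => rfl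
  have hs : ∀ (f : Fin n → 𝓢'(Phase n, ℂ)) (φ : Sch n), (∑ i, f i) φ = ∑ i, f i φ := fun f φ => by
    simp
  have h : freeExpr n T (sref φ) = -(∑ i, dv i (dv i T)) (sref φ) +
      (1 / 4 : ℂ) • mulNormSqV n T (sref φ) - ((n : ℂ) / 2) • T (sref φ) +
      (∑ i, mulV i (dx i T)) (sref φ) := by
    rw [freeExpr_apply]
    rfl
  rw [h, hs, hs, opT_expand]
  simp only [h1, h2, h3, h4, sdv_sref, sdx_sref, smv_sref, snv_sref, sdx_smv, map_add, map_sub,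
    map_neg, map_sum, map_smul, zero_smul, sub_zero, neg_neg]

/-- Injectivity of `P₀ - z`. -/
theorem P0_injective {z : ℂ} (hz : z ∉ halfLine) (u : (P0 n).domain)
    (h : P0 n u = z • (u : L2 n)) : (u : L2 n) = 0 := by
  have h1 : ∀ f : Sch n, Core f → toDist n (u : L2 n) (sref f) = 0 := by
    intro f hf
    -- Solvability on the core gives uniqueness by duality: an eigenvector annihilates the reflected
    -- range of `P₀ - z`, which contains the reflected core.
    obtain ⟨φ, -, rfl⟩ := hf.exists_opT_eq hz
    have h2 := congrArg (fun T : 𝓢'(Phase n, ℂ) => T (sref φ)) (toDist_maximal (freeExpr n) u)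
    have h3 : toDist n (P0 n u) (sref φ) = z • toDist n (u : L2 n) (sref φ) := by
      rw [h, map_smul]
      rfl
    rw [opT_shift z 0, map_add, map_add, ← freeExpr_apply_sref, map_smul, map_smul, zero_sub,
      neg_smul, ← h3]
    exact add_neg_eq_zero.2 h2.symm
  have hmp : MeasurePreserving (reflE n) (volume : Measure (Phase n)) volume :=
    (MeasurePreserving.id (volume : Measure (Conf n))).prod (Measure.measurePreserving_neg volume)
  have hU : MemLp (fun p => (u : L2 n) (reflE n p)) 2 volume :=
    (Lp.memLp (u : L2 n)).comp_measurePreserving hmp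
  have h2 := ae_eq_zero_of_core hU fun f hf => by
    have h3 := h1 f hf
    rw [toDist_apply, ← hmp.integral_comp (reflE n).toHomeomorph.measurableEmbedding] at h3
    rw [← h3]
    refine integral_congr_ae (Filter.Eventually.of_forall fun p => ?_)
    simp [sref_apply, reflE_apply, mul_comm]
  rw [Lp.eq_zero_iff_ae_eq_zero]
  have h3 := hmp.quasiMeasurePreserving.ae h2
  filter_upwards [h3] with p hp
  simpa [reflE_apply] using hp

/-- The resolvent of `P₀` exists outside of `[0, ∞[`. -/
theorem exists_resolvent_P0 {z : ℂ} (hz : z ∉ halfLine) :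
    ∃ R : L2 n →L[ℂ] L2 n, IsResolventAt (P0 n) z R := by
  obtain ⟨C, -, hC⟩ := aPriori (n := n) hz
  refine (seqClosed_maximal (freeExpr n)).exists_resolvent (P0_injective hz) (C := C)
    (coreL2_dense n) ?_
  rintro _ ⟨f, hf, rfl⟩
  obtain ⟨u, hu, rfl⟩ := hf.exists_opT_eq hz
  obtain ⟨h, h'⟩ := P0_emb u
  refine ⟨⟨emb u, h⟩, ?_, hC u hu⟩
  have h'' : maximal (freeExpr n) ⟨emb u, h⟩ = emb (opT 0 u) := h'
  rw [h'', opT_shift z 0, map_add, map_smul]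
  module

theorem isResolventAt_R0 {z : ℂ} (hz : z ∉ halfLine) : IsResolventAt (P0 n) z (R0 n z) := by
  obtain ⟨R, hR⟩ := exists_resolvent_P0 (n := n) hz
  rwa [R0, hR.resolvent_eq]

/-- The Schwartz functions are a core of `P₀`. -/
theorem exists_schwartz_seq (u : (P0 n).domain) : ∃ w : ℕ → Sch n,
    Filter.Tendsto (fun k => emb (w k)) Filter.atTop (nhds (u : L2 n)) ∧
      Filter.Tendsto (fun k => emb (opT 0 (w k))) Filter.atTop (nhds (P0 n u)) := by
  have hR := isResolventAt_R0 (n := n) neg_one_not_halfLine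
  obtain ⟨f, hf, hlim⟩ := exists_core_seq (P0 n u - (-1 : ℂ) • (u : L2 n))
  -- Core functions approximating `(P₀ + 1)u` have Schwartz preimages, and the bounded resolvent at
  -- `-1` transports the convergence to them.
  choose w hw hwf using fun k => (hf k).exists_opT_eq neg_one_not_halfLine
  have h1 : ∀ k, emb (w k) = R0 n (-1) (emb (f k)) := by
    intro k
    obtain ⟨h, h'⟩ := P0_emb (w k)
    have h2 := hR.2 ⟨emb (w k), h⟩
    rw [h'] at h2
    rw [← hwf k, opT_shift (-1) 0, map_add, map_smul]
    refine h2.symm.trans (congrArg _ ?_)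
    module
  have h2 : Filter.Tendsto (fun k => emb (w k)) Filter.atTop (nhds (u : L2 n)) := by
    simp only [h1]
    have := ((R0 n (-1)).continuous.tendsto _).comp hlim
    rwa [hR.2 u] at this
  refine ⟨w, h2, ?_⟩
  have h3 : ∀ k, emb (opT 0 (w k)) = emb (f k) + (-1 : ℂ) • emb (w k) := by
    intro k
    rw [← hwf k, opT_shift 0 (-1), map_add, map_smul]
    module
  simp only [h3]
  convert hlim.add (h2.const_smul (-1 : ℂ)) using 2
  module

end

section

variable {n : ℕ}

/-! ### Estimates in the velocity variable -/

theorem norm_smulS_le {g : Phase n → ℂ} (hg : g.HasTemperateGrowth) {c : ℝ}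
    (hc : ∀ p, ‖g p‖ ≤ c) (u : Sch n) : ‖emb (smulS g u)‖ ≤ c * ‖emb u‖ := by
  refine Lp.norm_le_mul_norm_of_ae_le_mul ?_
  filter_upwards [coeFn_emb u, coeFn_emb (smulS g u)] with p h1 h2
  rw [h1, h2, smulS_apply hg, norm_mul]
  exact mul_le_mul_of_nonneg_right (hc p) (norm_nonneg _)

theorem norm_ann_le (i : Fin n) (u : Sch n) :
    ‖emb (ann i u)‖ ≤ ‖emb (opT 0 u)‖ + ‖emb u‖ := by
  have h1 := re_inner_le (emb u) (emb (opT 0 u))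
  rw [re_inner_opT, Complex.zero_re, zero_mul, sub_zero] at h1
  have h2 := norm_ann_sq_le i u
  refine (pow_le_pow_iff_left₀ (norm_nonneg _) (by positivity) two_ne_zero).1 ?_
  nlinarith [norm_nonneg (emb u), norm_nonneg (emb (opT 0 u))]

theorem norm_cre_le (i : Fin n) (u : Sch n) :
    ‖emb (cre i u)‖ ≤ ‖emb (opT 0 u)‖ + ‖emb u‖ := by
  have h1 := re_inner_le (emb u) (emb (opT 0 u))
  rw [re_inner_opT, Complex.zero_re, zero_mul, sub_zero] at h1
  have h2 := norm_ann_sq_le i u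
  have h3 := norm_cre_sq i u
  refine (pow_le_pow_iff_left₀ (norm_nonneg _) (by positivity) two_ne_zero).1 ?_
  nlinarith [norm_nonneg (emb u), norm_nonneg (emb (opT 0 u))]

theorem norm_smv_le (i : Fin n) (u : Sch n) :
    ‖emb (smv i u)‖ ≤ 2 * (‖emb (opT 0 u)‖ + ‖emb u‖) := by
  rw [← ann_add_cre, map_add]
  refine (norm_add_le _ _).trans ?_
  linarith [norm_ann_le i u, norm_cre_le i u]

theorem norm_sdv_le (i : Fin n) (u : Sch n) :
    ‖emb (sdv i u)‖ ≤ ‖emb (opT 0 u)‖ + ‖emb u‖ := by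
  have h := congrArg (fun w => ‖emb w‖) (ann_sub_cre i u)
  simp only [map_sub, map_smul, norm_smul, Complex.norm_ofNat] at h
  have := norm_sub_le (emb (ann i u)) (emb (cre i u))
  linarith [norm_ann_le i u, norm_cre_le i u]

theorem inner_snv_self (u : Sch n) :
    (inner ℂ (emb (snv u)) (emb u)).re = ∑ k, ‖emb (smv k u)‖ ^ 2 := by
  rw [snv_eq, map_sum, sum_inner, Complex.re_sum]
  exact Finset.sum_congr rfl fun k _ => by rw [← inner_smv, re_inner_self]

theorem sdv_snv (i : Fin n) (u : Sch n) : sdv i (snv u) = snv (sdv i u) + (2 : ℂ) • smv i u := by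
  simp only [snv_eq, map_sum, sdv_smv, map_add, map_smul, Finset.sum_add_distrib]
  have : ∑ j, (if i = j then (1 : ℂ) else 0) • smv j u = smv i u := by simp
  rw [add_assoc, this]
  module

theorem re_inner_smv_sdv (i : Fin n) (u : Sch n) :
    2 * (inner ℂ (emb (smv i u)) (emb (sdv i u))).re = -‖emb u‖ ^ 2 := by
  have h : inner ℂ (emb (smv i u)) (emb (sdv i u)) =
      -inner ℂ (emb (sdv i u)) (emb (smv i u)) - inner ℂ (emb u) (emb u) := by
    rw [inner_sdv, sdv_smv, if_pos rfl, one_smul, map_add, inner_add_left, inner_smv]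
    ring
  have h1 := congrArg Complex.re h
  rw [← inner_conj_symm (emb (sdv i u))] at h1
  simp only [Complex.sub_re, Complex.neg_re, Complex.conj_re, re_inner_self] at h1
  linarith

/-- The multiplier `|v|²` commutes with the transport term, so no `x`-derivative appears, while the
two good terms control `v_k ∂_{v_i} u` and `|v|² u`. -/
theorem re_inner_snv_opT (u : Sch n) :
    (inner ℂ (emb (snv u)) (emb (opT 0 u))).re = ∑ i, ∑ k, ‖emb (smv k (sdv i u))‖ ^ 2 -
      n * ‖emb u‖ ^ 2 + 1 / 4 * ‖emb (snv u)‖ ^ 2 -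
      n / 2 * (inner ℂ (emb (snv u)) (emb u)).re := by
  have h1 : ∀ i, (inner ℂ (emb (snv u)) (emb (sdv i (sdv i u)))).re =
      -∑ k, ‖emb (smv k (sdv i u))‖ ^ 2 + ‖emb u‖ ^ 2 := fun i => by
    rw [inner_sdv, sdv_snv, map_add, map_smul, inner_add_left, inner_smul_left, Complex.neg_re,
      Complex.add_re, inner_snv_self, Complex.conj_ofNat]
    have := re_inner_smv_sdv i u
    have h0 : ∀ z : ℂ, (2 * z).re = 2 * z.re := fun z => by simp
    rw [h0, this]
    ring
  have h2 : ∀ i, (inner ℂ (emb (snv u)) (emb (smv i (sdx i u)))).re = 0 := fun i => by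
    rw [snv_eq, map_sum, sum_inner, Complex.re_sum]
    refine Finset.sum_eq_zero fun k _ => ?_
    rw [← inner_smv, smv_comm, ← sdx_smv]
    exact re_inner_transport i (smv k u)
  rw [opT_expand]
  simp only [map_add, map_sub, map_neg, map_sum, map_smul, zero_smul, sub_zero, inner_add_right,
    inner_sub_right, inner_neg_right, inner_sum, inner_smul_right, Complex.add_re, Complex.sub_re,
    Complex.neg_re, Complex.re_sum, h1, h2]
  have h3 : ((1 / 4 : ℂ) * inner ℂ (emb (snv u)) (emb (snv u))).re =
      1 / 4 * ‖emb (snv u)‖ ^ 2 := by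
    rw [← re_inner_self, show (1 / 4 : ℂ) = ((1 / 4 : ℝ) : ℂ) by norm_num, Complex.re_ofReal_mul]
  have h4 : ((n : ℂ) / 2 * inner ℂ (emb (snv u)) (emb u)).re =
      n / 2 * (inner ℂ (emb (snv u)) (emb u)).re := by
    rw [show (n : ℂ) / 2 = ((n / 2 : ℝ) : ℂ) by push_cast; rfl, Complex.re_ofReal_mul]
  rw [h3, h4]
  simp only [Finset.sum_add_distrib, Finset.sum_neg_distrib, Finset.sum_const, Finset.card_univ,
    Fintype.card_fin, nsmul_eq_mul, mul_zero]
  ring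

theorem norm_smv_sdv_le (i : Fin n) (u : Sch n) :
    ‖emb (smv i (sdv i u))‖ ≤ 3 * (‖emb (opT 0 u)‖ + n * ‖emb u‖) := by
  have h := re_inner_snv_opT u
  have h1 := re_inner_le (emb (snv u)) (emb (opT 0 u))
  have h2 := re_inner_le (emb (snv u)) (emb u)
  have h3 : ‖emb (smv i (sdv i u))‖ ^ 2 ≤ ∑ i, ∑ k, ‖emb (smv k (sdv i u))‖ ^ 2 := by
    have h4 : ‖emb (smv i (sdv i u))‖ ^ 2 ≤ ∑ k, ‖emb (smv k (sdv i u))‖ ^ 2 :=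
      Finset.single_le_sum (f := fun k => ‖emb (smv k (sdv i u))‖ ^ 2)
        (fun _ _ => sq_nonneg _) (Finset.mem_univ i)
    exact h4.trans (Finset.single_le_sum (f := fun i => ∑ k, ‖emb (smv k (sdv i u))‖ ^ 2)
      (fun _ _ => Finset.sum_nonneg fun _ _ => sq_nonneg _) (Finset.mem_univ i))
  set Z := ‖emb (smv i (sdv i u))‖
  set Y := ‖emb (snv u)‖
  set N := ‖emb u‖
  set F := ‖emb (opT 0 u)‖
  have hY : 0 ≤ Y := norm_nonneg _
  have hN : 0 ≤ N := norm_nonneg _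
  have hF : 0 ≤ F := norm_nonneg _
  have hn : (0 : ℝ) ≤ n := Nat.cast_nonneg n
  have hnn : (n : ℝ) * N ^ 2 ≤ (n * N) ^ 2 := by
    rw [mul_pow]
    gcongr
    exact_mod_cast Nat.le_self_pow two_ne_zero n
  set B := F + n * N with hB
  have hnN : 0 ≤ n * N := by positivity
  have hB0 : 0 ≤ B := by positivity
  have h5 : (n * N) ^ 2 ≤ B ^ 2 := by gcongr; linarith
  have h6 : Z ^ 2 + 1 / 4 * Y ^ 2 ≤ Y * B + B ^ 2 := by
    have : (n : ℝ) / 2 * (inner ℂ (emb (snv u)) (emb u)).re ≤ n / 2 * (Y * N) := by gcongr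
    nlinarith [mul_nonneg hY hnN]
  refine (pow_le_pow_iff_left₀ (norm_nonneg _) (by positivity) two_ne_zero).1 ?_
  -- `Y B ≤ Y²/4 + B²` turns `h6` into `Z² ≤ 2B²`.
  nlinarith [sq_nonneg (Y - 2 * B)]

/-! ### Consequences for the domain of the free operator -/

/-- Relatively bounded closed operators are defined on `D(P₀)`. -/
theorem tendsto_of_relBounded {A : L2 n →ₗ.[ℂ] L2 n} (hA : SeqClosed A) (L : Sch n →ₗ[ℂ] Sch n)
    (hL : ∀ w, ∃ h : emb w ∈ A.domain, A ⟨emb w, h⟩ = emb (L w)) {K : ℝ}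
    (hb : ∀ w, ‖emb (L w)‖ ≤ K * (‖emb (opT 0 w)‖ + ‖emb w‖)) {u : (P0 n).domain} {w : ℕ → Sch n}
    (h1 : Filter.Tendsto (fun k => emb (w k)) Filter.atTop (nhds (u : L2 n)))
    (h2 : Filter.Tendsto (fun k => emb (opT 0 (w k))) Filter.atTop (nhds (P0 n u))) :
    ∃ h : (u : L2 n) ∈ A.domain,
      Filter.Tendsto (fun k => emb (L (w k))) Filter.atTop (nhds (A ⟨u, h⟩)) := by
  have hcau : CauchySeq fun k => emb (L (w k)) := by
    have c1 := h1.cauchySeq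
    have c2 := h2.cauchySeq
    rw [Metric.cauchySeq_iff] at c1 c2 ⊢
    intro ε hε
    obtain ⟨N₁, hN₁⟩ := c1 (ε / (2 * (|K| + 1))) (by positivity)
    obtain ⟨N₂, hN₂⟩ := c2 (ε / (2 * (|K| + 1))) (by positivity)
    refine ⟨max N₁ N₂, fun k hk l hl => ?_⟩
    have e1 := hN₁ k (le_of_max_le_left hk) l (le_of_max_le_left hl)
    have e2 := hN₂ k (le_of_max_le_right hk) l (le_of_max_le_right hl)
    rw [dist_eq_norm, ← map_sub, lt_div_iff₀ (by positivity)] at e1 e2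
    rw [← map_sub] at e2
    rw [dist_eq_norm, ← map_sub, ← map_sub]
    have h3 : K * (‖emb (opT 0 (w k - w l))‖ + ‖emb (w k - w l)‖) ≤
        (|K| + 1) * (‖emb (opT 0 (w k - w l))‖ + ‖emb (w k - w l)‖) := by
      gcongr
      exact (le_abs_self K).trans (by linarith)
    linarith [hb (w k - w l)]
  obtain ⟨y, hy⟩ := cauchySeq_tendsto_of_complete hcau
  choose hd hAd using hL
  obtain ⟨h, hAy⟩ := hA (fun k => ⟨emb (w k), hd (w k)⟩) u y h1 (by simpa only [hAd] using hy)
  exact ⟨h, by rwa [hAy]⟩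

theorem norm_le_of_relBounded {A : L2 n →ₗ.[ℂ] L2 n} (hA : SeqClosed A) (L : Sch n →ₗ[ℂ] Sch n)
    (hL : ∀ w, ∃ h : emb w ∈ A.domain, A ⟨emb w, h⟩ = emb (L w)) {K : ℝ}
    (hb : ∀ w, ‖emb (L w)‖ ≤ K * (‖emb (opT 0 w)‖ + ‖emb w‖)) (u : (P0 n).domain) :
    ∃ h : (u : L2 n) ∈ A.domain, ‖A ⟨u, h⟩‖ ≤ K * (‖P0 n u‖ + ‖(u : L2 n)‖) := by
  obtain ⟨w, h1, h2⟩ := exists_schwartz_seq u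
  obtain ⟨h, h3⟩ := tendsto_of_relBounded hA L hL hb h1 h2
  exact ⟨h, le_of_tendsto_of_tendsto' h3.norm ((h2.norm.add h1.norm).const_mul K) fun k => hb _⟩

theorem mulOp_emb {m : Phase n → ℂ} (hm : m.HasTemperateGrowth) (w : Sch n) :
    ∃ h : emb w ∈ (mulOp m).domain, mulOp m ⟨emb w, h⟩ = emb (smulS m w) := by
  refine mulOp_eq ?_
  filter_upwards [coeFn_emb w, coeFn_emb (smulS m w)] with p h1 h2
  rw [h1, h2, smulS_apply hm]

theorem vGradV_emb (w : Sch n) : ∃ h : emb w ∈ (vGradV n).domain,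
    vGradV n ⟨emb w, h⟩ = emb (∑ i, smv i (sdv i w)) := by
  refine maximal_eq ?_
  have : (∑ i, mulV i ∘L dv i) (toDist n (emb w)) = ∑ i, mulV i (dv i (toDist n (emb w))) := by
    simp
  rw [this]
  simp only [dv_toDist_emb, mulV_toDist_emb, map_sum]

/-! ### The bracket, the symbol `v·x/⟨x⟩`, and positivity of `τ`. -/

theorem bracket_pos (x : Conf n) : 0 < bracket x := Real.sqrt_pos.2 (by positivity)

theorem one_le_bracket (x : Conf n) : 1 ≤ bracket x :=
  Real.one_le_sqrt.2 (le_add_of_nonneg_right (by positivity))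

theorem bracket_temperate : (fun p : Phase n => bracket p.1).HasTemperateGrowth := by
  have h : (fun x : Conf n => bracket x) = fun x => (1 + ‖x‖ ^ 2) ^ (1 / 2 : ℝ) :=
    funext fun x => Real.sqrt_eq_rpow _
  have h1 : (fun x : Conf n => bracket x).HasTemperateGrowth := by
    rw [h]
    exact Function.hasTemperateGrowth_one_add_norm_sq_rpow (Conf n) (1 / 2)
  exact h1.comp (ContinuousLinearMap.fst ℝ (Conf n) (Conf n)).hasTemperateGrowth

/-- The function `x_i / ⟨x⟩`. -/
def cxb (i : Fin n) : Phase n → ℂ := fun p => ((p.1 i / bracket p.1 : ℝ) : ℂ)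

theorem cxb_temperate (i : Fin n) : (cxb i : Phase n → ℂ).HasTemperateGrowth := by
  have h1 : (fun p : Phase n => p.1 i).HasTemperateGrowth :=
    ((EuclideanSpace.proj i : Conf n →L[ℝ] ℝ) ∘L
      ContinuousLinearMap.fst ℝ (Conf n) (Conf n)).hasTemperateGrowth
  have h2 := temperate_inv bracket_temperate one_pos fun p : Phase n => one_le_bracket p.1
  exact Function.HasTemperateGrowth.comp Function.Complex.hasTemperateGrowth_ofReal (h1.mul h2)

theorem norm_cxb_le (i : Fin n) (p : Phase n) : ‖cxb i p‖ ≤ 1 := by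
  rw [cxb, Complex.norm_real, norm_div, Real.norm_of_nonneg (bracket_pos _).le,
    div_le_one (bracket_pos _)]
  refine (PiLp.norm_apply_le p.1 i).trans (Real.le_sqrt_of_sq_le ?_)
  linarith

/-- The symbol `v·x/⟨x⟩` of `mulVX`. -/
def cvx (n : ℕ) : Phase n → ℂ := fun p => ((inner ℝ p.2 p.1 / bracket p.1 : ℝ) : ℂ)

theorem cvx_eq (p : Phase n) : cvx n p = ∑ i, cxb i p * cv i p := by
  simp only [cvx, cxb, cv, PiLp.inner_apply, RCLike.inner_apply, conj_trivial, Finset.sum_div]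
  push_cast
  exact Finset.sum_congr rfl fun i _ => by ring

theorem cvx_temperate : (cvx n).HasTemperateGrowth := by
  rw [show cvx n = fun p => ∑ i, cxb i p * cv i p from funext cvx_eq]
  exact Function.HasTemperateGrowth.sum fun i _ => (cxb_temperate i).mul (cv_temperate i)

theorem smulS_cvx (u : Sch n) : smulS (cvx n) u = ∑ i, smulS (cxb i) (smv i u) := by
  ext p
  have h : ∀ i (w : Sch n), smv i w p = cv i p * w p := fun i w =>
    smulS_apply (cv_temperate i) w p
  rw [smulS_apply cvx_temperate, cvx_eq, Finset.sum_mul, _root_.sum_apply]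
  refine Finset.sum_congr rfl fun i _ => ?_
  rw [smulS_apply (cxb_temperate i), h, mul_assoc]

theorem norm_P0_add_norm_R0_le {z : ℂ} (hz : z ∉ halfLine) (f : L2 n) :
    ∃ h : R0 n z f ∈ (P0 n).domain,
      ‖P0 n ⟨R0 n z f, h⟩‖ + ‖R0 n z f‖ ≤ (1 + (‖z‖ + 1) * ‖R0 n z‖) * ‖f‖ := by
  obtain ⟨h, hf⟩ := (isResolventAt_R0 hz).1 f
  refine ⟨h, ?_⟩
  have h1 : P0 n ⟨R0 n z f, h⟩ = f + z • R0 n z f := by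
    rw [← sub_eq_iff_eq_add]
    exact hf
  rw [h1]
  have h2 := norm_add_le f (z • R0 n z f)
  rw [norm_smul] at h2
  have h3 := mul_le_mul_of_nonneg_left ((R0 n z).le_opNorm f)
    (by positivity : 0 ≤ ‖z‖ + 1)
  linarith

/-- A bound relative to `P₀` suffices, since `P₀ R₀(z) = 1 + z R₀(z)` is bounded. -/
theorem compNorm_lt_top_of_relBounded {A : L2 n →ₗ.[ℂ] L2 n} (hA : SeqClosed A)
    (L : Sch n →ₗ[ℂ] Sch n) (hL : ∀ w, ∃ h : emb w ∈ A.domain, A ⟨emb w, h⟩ = emb (L w)) {K : ℝ}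
    (hb : ∀ w, ‖emb (L w)‖ ≤ K * (‖emb (opT 0 w)‖ + ‖emb w‖)) (hK : 0 ≤ K) {z : ℂ}
    (hz : z ∉ halfLine) : compNorm A (R0 n z) < ⊤ := by
  set M : ℝ≥0 := (K * (1 + (‖z‖ + 1) * ‖R0 n z‖)).toNNReal
  refine lt_of_le_of_lt (iInf₂_le M fun f => ?_) ENNReal.coe_lt_top
  obtain ⟨h, hf⟩ := norm_P0_add_norm_R0_le hz f
  obtain ⟨h', hf'⟩ := norm_le_of_relBounded hA L hL hb ⟨R0 n z f, h⟩
  refine ⟨h', hf'.trans ?_⟩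
  rw [Real.coe_toNNReal _ (by positivity), mul_assoc]
  gcongr

theorem norm_sum_smv_sdv_le (w : Sch n) : ‖emb ((∑ i, smv i ∘ₗ sdv i) w)‖ ≤
    (3 * n * (n + 1)) * (‖emb (opT 0 w)‖ + ‖emb w‖) := by
  rw [LinearMap.sum_apply, map_sum]
  refine (norm_sum_le _ _).trans ((Finset.sum_le_card_nsmul _ _ _
    fun i _ => norm_smv_sdv_le i w).trans ?_)
  rw [Finset.card_univ, Fintype.card_fin, nsmul_eq_mul]
  have h1 : ‖emb (opT 0 w)‖ + n * ‖emb w‖ ≤ (n + 1) * (‖emb (opT 0 w)‖ + ‖emb w‖) := by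
    have : 0 ≤ n * ‖emb (opT 0 w)‖ := by positivity
    linarith [norm_nonneg (emb w)]
  calc _ ≤ (n : ℝ) * (3 * ((n + 1) * (‖emb (opT 0 w)‖ + ‖emb w‖))) := by gcongr
    _ = _ := by ring

theorem compNorm_vGradV_lt_top {z : ℂ} (hz : z ∉ halfLine) :
    compNorm (vGradV n) (R0 n z) < ⊤ :=
  compNorm_lt_top_of_relBounded (seqClosed_maximal _) (∑ i, smv i ∘ₗ sdv i)
    (fun w => by
      obtain ⟨h, h'⟩ := vGradV_emb w
      exact ⟨h, h'.trans (by simp [LinearMap.sum_apply])⟩)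
    norm_sum_smv_sdv_le (by positivity) hz

theorem norm_smulS_cvx_le (w : Sch n) :
    ‖emb (smulS (cvx n) w)‖ ≤ (2 * n) * (‖emb (opT 0 w)‖ + ‖emb w‖) := by
  rw [smulS_cvx, map_sum]
  refine (norm_sum_le _ _).trans ((Finset.sum_le_card_nsmul _ _
    (2 * (‖emb (opT 0 w)‖ + ‖emb w‖)) fun i _ => ?_).trans ?_)
  · refine (norm_smulS_le (cxb_temperate i) (norm_cxb_le i) _).trans ?_
    rw [one_mul]
    exact norm_smv_le i w
  · rw [Finset.card_univ, Fintype.card_fin, nsmul_eq_mul]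
    exact le_of_eq (by ring)

theorem compNorm_mulVX_lt_top {z : ℂ} (hz : z ∉ halfLine) :
    compNorm (mulVX n) (R0 n z) < ⊤ :=
  compNorm_lt_top_of_relBounded (seqClosed_mulOp _) (smulS (cvx n)) (mulOp_emb cvx_temperate)
    norm_smulS_cvx_le (by positivity) hz

theorem emb_injective : Function.Injective (emb : Sch n →ₗ[ℂ] L2 n) :=
  SchwartzMap.injective_toLp 2 volume

theorem gauss_ne_zero (v : Conf n) : gaussS (Conf n) v ≠ 0 := by
  rw [gaussS_apply]
  exact Complex.ofReal_ne_zero.2 (Real.exp_ne_zero _)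

theorem emb_baseS_gauss_ne_zero : emb (baseS (gaussS (Conf n))) ≠ 0 := by
  intro h
  rw [← map_zero emb] at h
  have h1 := DFunLike.congr_fun (emb_injective h) 0
  rw [baseS_apply] at h1
  exact mul_ne_zero (gauss_ne_zero _) (gauss_ne_zero _) h1

theorem R0_ne_zero {z : ℂ} (hz : z ∉ halfLine) : R0 n z ≠ 0 := by
  intro h
  obtain ⟨hd, -⟩ := P0_emb (baseS (gaussS (Conf n)))
  have := (isResolventAt_R0 (n := n) hz).2 ⟨_, hd⟩
  rw [h] at this
  exact emb_baseS_gauss_ne_zero this.symm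

/-- Finiteness of the norms keeps the minimum away from `0`. That `R₀(z) ≠ 0` keeps it away from
`∞`, which the conversion to a real number would also send to `0`. -/
theorem tau_pos {z : ℂ} (hz : z ∉ halfLine) : 0 < tau n z := by
  have hR : ENNReal.ofReal ‖R0 n z‖ ≠ 0 :=
    (ENNReal.ofReal_pos.2 (norm_pos_iff.2 (R0_ne_zero hz))).ne'
  refine ENNReal.toReal_pos (lt_min ?_ ?_).ne' (ne_top_of_le_ne_top ?_ (min_le_left _ _))
  · rw [ENNReal.inv_pos]
    exact ENNReal.add_ne_top.2 ⟨ENNReal.add_ne_top.2 ⟨(compNorm_vGradV_lt_top hz).ne,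
      (compNorm_mulVX_lt_top hz).ne⟩, ENNReal.ofReal_ne_top⟩
  · rw [ENNReal.rpow_neg, ENNReal.inv_pos]
    exact ENNReal.rpow_ne_top_of_nonneg (by norm_num) ENNReal.ofReal_ne_top
  · rw [Ne, ENNReal.inv_eq_top]
    exact fun h => hR (add_eq_zero.1 h).2

/-- The quantity `τ(z)` bounds the norm of `A R₀(z)` if it enters the definition of `τ`. -/
theorem compNorm_le_inv_tau {z : ℂ} (hz : z ∉ halfLine) :
    compNorm (vGradV n) (R0 n z) ≤ ENNReal.ofReal (tau n z)⁻¹ ∧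
      compNorm (mulVX n) (R0 n z) ≤ ENNReal.ofReal (tau n z)⁻¹ := by
  set S := compNorm (vGradV n) (R0 n z) + compNorm (mulVX n) (R0 n z) +
    ENNReal.ofReal ‖R0 n z‖ with hS
  have h1 : ENNReal.ofReal (tau n z) ≤ S⁻¹ := by
    rw [tau]
    exact ENNReal.ofReal_toReal_le.trans (min_le_left _ _)
  have h2 : S ≤ ENNReal.ofReal (tau n z)⁻¹ := by
    rw [ENNReal.ofReal_inv_of_pos (tau_pos hz)]
    exact ENNReal.le_inv_iff_le_inv.1 h1
  constructor
  · exact (le_self_add.trans le_self_add).trans h2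
  · exact (le_add_self.trans le_self_add).trans h2

theorem exists_bound_of_compNorm_lt {H : Type*} [NormedAddCommGroup H] [NormedSpace ℂ H]
    {A : H →ₗ.[ℂ] H} {R : H →L[ℂ] H} {c : ℝ} (h : compNorm A R < ENNReal.ofReal c) (f : H) :
    ∃ h : R f ∈ A.domain, ‖A ⟨R f, h⟩‖ ≤ c * ‖f‖ := by
  obtain ⟨C, h⟩ := iInf_lt_iff.1 h
  obtain ⟨hC, hCc⟩ := iInf_lt_iff.1 h
  obtain ⟨h', h''⟩ := hC f
  refine ⟨h', h''.trans ?_⟩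
  gcongr
  rw [← ENNReal.ofReal_coe_nnreal] at hCc
  exact (ENNReal.ofReal_lt_ofReal_iff_of_nonneg C.2).1 hCc |>.le

end

section

variable {n : ℕ}

/-! ### An upper bound for `τ` -/

theorem sdv_tensorS (i : Fin n) (f g : 𝓢(Conf n, ℂ)) (p : Phase n) :
    sdv i (tensorS f g) p = f p.1 * fderiv ℝ g p.2 (EuclideanSpace.single i 1) := by
  have h1 : HasFDerivAt (fun p : Phase n => f p.1) _ p :=
    HasFDerivAt.comp p (f.differentiableAt (x := p.1)).hasFDerivAt (hasFDerivAt_fst (p := p))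
  have h2 : HasFDerivAt (fun p : Phase n => g p.2) _ p :=
    HasFDerivAt.comp p (g.differentiableAt (x := p.2)).hasFDerivAt (hasFDerivAt_snd (p := p))
  rw [sdv, sder_apply, show (tensorS f g : Phase n → ℂ) = _ from funext (tensorS_apply f g)]
  refine (DFunLike.congr_fun (h1.mul h2).fderiv (ev i)).trans ?_
  simp [ev]

theorem ann_tensorS_gauss (i : Fin n) (f : 𝓢(Conf n, ℂ)) :
    ann i (tensorS f (gaussS (Conf n))) = 0 := by
  ext p
  have h3 : smv i (tensorS f (gaussS (Conf n))) p = cv i p * tensorS f (gaussS (Conf n)) p :=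
    smulS_apply (cv_temperate i) _ p
  rw [ann_apply, _root_.add_apply, _root_.smul_apply, h3, sdv_tensorS, fderiv_gaussS,
    tensorS_apply]
  simp [cv]
  ring

/-- The vector obtained by applying `k` times the creation operator `cre i`. -/
def herm (i : Fin n) (k : ℕ) (φ : Sch n) : Sch n := (cre i)^[k] φ

theorem herm_succ (i : Fin n) (k : ℕ) (φ : Sch n) : herm i (k + 1) φ = cre i (herm i k φ) :=
  Function.iterate_succ_apply' _ _ _

theorem sdx_herm (i j : Fin n) (k : ℕ) (φ : Sch n) : sdx j (herm i k φ) = herm i k (sdx j φ) := by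
  induction k with
  | zero => rfl
  | succ k ih => rw [herm_succ, herm_succ, sdx_cre, ih]

section

variable {i : Fin n} {φ : Sch n} (h : ∀ j, ann j φ = 0)
include h

theorem ann_sdx_eq_zero (j l : Fin n) : ann j (sdx l φ) = 0 := by
  rw [← sdx_ann, h, map_zero]

theorem ann_herm_of_ne {j : Fin n} (hj : j ≠ i) (k : ℕ) : ann j (herm i k φ) = 0 := by
  induction k with
  | zero => exact h j
  | succ k ih => rw [herm_succ, ann_cre, ih, if_neg hj, map_zero, zero_smul, add_zero]

theorem ann_herm_succ (k : ℕ) : ann i (herm i (k + 1) φ) = ((k : ℂ) + 1) • herm i k φ := by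
  induction k with
  | zero =>
    rw [herm_succ, ann_cre, if_pos rfl]
    simp [herm, h]
  | succ k ih =>
    rw [herm_succ, ann_cre, ih, if_pos rfl, map_smul, ← herm_succ]
    push_cast
    module

theorem norm_herm_succ_sq (k : ℕ) :
    ‖emb (herm i (k + 1) φ)‖ ^ 2 = (k + 1) * ‖emb (herm i k φ)‖ ^ 2 := by
  rw [← re_inner_self, ← re_inner_self]
  nth_rw 2 [herm_succ]
  rw [inner_cre, ann_herm_succ h, map_smul, inner_smul_left]
  rw [show (starRingEnd ℂ) ((k : ℂ) + 1) = (((k : ℝ) + 1 : ℝ) : ℂ) by simp, Complex.re_ofReal_mul]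

theorem inner_herm_of_lt {k l : ℕ} (hkl : k < l) :
    inner ℂ (emb (herm i l φ)) (emb (herm i k φ)) = 0 := by
  induction k generalizing l with
  | zero =>
    obtain ⟨l, rfl⟩ := Nat.exists_eq_succ_of_ne_zero hkl.ne'
    rw [herm_succ, ← inner_ann]
    simp [herm, h]
  | succ k ih =>
    obtain ⟨l, rfl⟩ := Nat.exists_eq_succ_of_ne_zero (Nat.ne_zero_of_lt hkl)
    rw [herm_succ i k, inner_cre, ann_herm_succ h, map_smul, inner_smul_left,
      ih (Nat.lt_of_succ_lt_succ hkl), mul_zero]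

theorem norm_herm (k : ℕ) :
    ‖emb (herm i k φ)‖ = Real.sqrt (k.factorial) * ‖emb φ‖ := by
  refine (pow_left_inj₀ (norm_nonneg _) (by positivity) two_ne_zero).1 ?_
  rw [mul_pow, Real.sq_sqrt (by positivity)]
  induction k with
  | zero => simp [herm]
  | succ k ih =>
    rw [norm_herm_succ_sq h, ih, Nat.factorial_succ]
    push_cast
    ring

/-- Multiplication by `v_j` costs only `√k` on the `k`-th Hermite level, so the transport term is of
lower order there. -/
theorem norm_smv_herm_le (j : Fin n) (k : ℕ) :
    ‖emb (smv j (herm i k φ))‖ ≤ 2 * (Real.sqrt (k + 1) * ‖emb (herm i k φ)‖) := by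
  have h1 : ‖emb (cre j (herm i k φ))‖ ≤ Real.sqrt (k + 1) * ‖emb (herm i k φ)‖ := by
    refine (pow_le_pow_iff_left₀ (norm_nonneg _) (by positivity) two_ne_zero).1 ?_
    rw [mul_pow, Real.sq_sqrt (by positivity)]
    by_cases hj : j = i
    · rw [hj, ← herm_succ, norm_herm_succ_sq h]
    · rw [norm_cre_sq, ann_herm_of_ne h hj, map_zero, norm_zero]
      nlinarith [mul_nonneg (Nat.cast_nonneg (α := ℝ) k) (sq_nonneg ‖emb (herm i k φ)‖)]
  have h2 : ‖emb (ann j (herm i k φ))‖ ≤ ‖emb (cre j (herm i k φ))‖ := by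
    refine (pow_le_pow_iff_left₀ (norm_nonneg _) (norm_nonneg _) two_ne_zero).1 ?_
    rw [norm_cre_sq]
    exact le_add_of_nonneg_right (sq_nonneg _)
  rw [← ann_add_cre, map_add]
  linarith [norm_add_le (emb (ann j (herm i k φ))) (emb (cre j (herm i k φ)))]

theorem norm_opT_herm_le (z : ℂ) (k : ℕ) :
    ‖emb (opT z (herm i k φ))‖ ≤ (k + ‖z‖) * ‖emb (herm i k φ)‖ +
      ∑ j, 2 * (Real.sqrt (k + 1) * ‖emb (herm i k (sdx j φ))‖) := by
  have h1 : ∑ j, cre j (ann j (herm i k φ)) = (k : ℂ) • herm i k φ := by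
    rw [Finset.sum_eq_single i (fun j _ hj => by rw [ann_herm_of_ne h hj, map_zero])
      (fun hi => absurd (Finset.mem_univ i) hi)]
    cases k with
    | zero => simp [herm, h]
    | succ k => rw [ann_herm_succ h, map_smul, herm_succ]; push_cast; rfl
  have h2 : opT z (herm i k φ) = ((k : ℂ) - z) • herm i k φ +
      ∑ j, smv j (herm i k (sdx j φ)) := by
    rw [opT_apply, h1]
    simp only [sdx_herm]
    module
  rw [h2, map_add, map_smul, map_sum]
  refine (norm_add_le _ _).trans (add_le_add ?_ ((norm_sum_le _ _).trans ?_))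
  · rw [norm_smul]
    gcongr
    refine (norm_sub_le _ _).trans ?_
    rw [Complex.norm_natCast]
  · exact Finset.sum_le_sum fun j _ => norm_smv_herm_le (fun l => ann_sdx_eq_zero h l j) j k

/-- Since `2 v_j ∂_{v_j} = ann_j² - cre_j² - 1`, pairing with level `k + 2` isolates `-cre_i²`. The
norm of that level is `√((k + 1)(k + 2))` times that of level `k`. -/
theorem le_norm_vGradV_herm (k : ℕ) : ((k : ℝ) + 1) / 2 * ‖emb (herm i k φ)‖ ≤
    ‖emb (∑ j, smv j (sdv j (herm i k φ)))‖ := by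
  set w := herm i k φ with hw
  have h1 : ∀ j, (2 : ℂ) • smv j (sdv j w) = ann j (ann j w) - cre j (cre j w) - w := fun j => by
    rw [← map_smul, ← ann_sub_cre, ← ann_add_cre, map_sub, map_sub, ann_cre, if_pos rfl]
    module
  have h2 : ∀ j, inner ℂ (emb (herm i (k + 2) φ)) (emb ((2 : ℂ) • smv j (sdv j w))) =
      if j = i then -inner ℂ (emb (herm i (k + 2) φ)) (emb (herm i (k + 2) φ)) else 0 := by
    intro j
    have e0 : inner ℂ (emb (herm i (k + 2) φ)) (emb w) = 0 := inner_herm_of_lt h (by omega)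
    rw [h1, map_sub, map_sub, inner_sub_right, inner_sub_right, e0, sub_zero]
    split_ifs with hj
    · subst hj
      have e1 : inner ℂ (emb (herm j (k + 2) φ)) (emb (ann j (ann j w))) = 0 := by
        rw [inner_ann, inner_ann, ← herm_succ, ← herm_succ]
        exact inner_herm_of_lt h (by omega)
      rw [e1, zero_sub, hw, ← herm_succ, ← herm_succ]
    · rw [ann_herm_of_ne h hj, map_zero, map_zero, inner_zero_right, inner_cre,
        ann_herm_of_ne h hj, map_zero, inner_zero_left, sub_zero]
  have h3 : inner ℂ (emb (herm i (k + 2) φ)) ((2 : ℂ) • emb (∑ j, smv j (sdv j w))) =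
      -inner ℂ (emb (herm i (k + 2) φ)) (emb (herm i (k + 2) φ)) := by
    rw [← map_smul, Finset.smul_sum, map_sum, inner_sum, Finset.sum_congr rfl fun j _ => h2 j]
    simp
  have h4 : ‖emb (herm i (k + 2) φ)‖ ^ 2 ≤
      ‖emb (herm i (k + 2) φ)‖ * (2 * ‖emb (∑ j, smv j (sdv j w))‖) := by
    have := norm_inner_le_norm (𝕜 := ℂ) (emb (herm i (k + 2) φ))
      ((2 : ℂ) • emb (∑ j, smv j (sdv j w)))
    rw [h3, norm_neg, inner_self_eq_norm_sq_to_K, norm_smul, Complex.norm_ofNat] at this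
    simpa using this
  have h5 := le_of_sq_le_mul (norm_nonneg _) (by positivity) h4
  have h6 : ((k : ℝ) + 1) * ‖emb w‖ ≤ ‖emb (herm i (k + 2) φ)‖ := by
    refine (pow_le_pow_iff_left₀ (by positivity) (norm_nonneg _) two_ne_zero).1 ?_
    rw [norm_herm_succ_sq h, norm_herm_succ_sq h, mul_pow, ← mul_assoc]
    gcongr
    push_cast
    nlinarith [Nat.cast_nonneg (α := ℝ) k]
  linarith

end

theorem emb_tensorS_gauss_ne_zero :
    emb (tensorS (gaussS (Conf n)) (gaussS (Conf n))) ≠ 0 := by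
  intro h0
  rw [← map_zero emb] at h0
  have h1 := DFunLike.congr_fun (emb_injective h0) ((0, 0) : Phase n)
  rw [tensorS_apply] at h1
  exact mul_ne_zero (gauss_ne_zero _) (gauss_ne_zero _) h1

/-- On level `k` the operator `v·∇_v` has size at least `(k + 1)/2`, whereas `P₀ - z` has size at
most `k + O(√k)`; let `k` grow. -/
theorem half_le_of_vGradV_bound {z : ℂ} (hn : 1 ≤ n) {c : ℝ} (hc : ∀ u : Sch n,
    ‖emb (∑ i, smv i (sdv i u))‖ ≤ c * ‖emb (opT z u)‖) : 1 / 2 ≤ c := by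
  by_contra! hlt
  set i : Fin n := ⟨0, hn⟩
  obtain ⟨φ, h, ha⟩ : ∃ φ : Sch n, (∀ j, ann j φ = 0) ∧ 0 < ‖emb φ‖ :=
    ⟨_, fun j => ann_tensorS_gauss j _, norm_pos_iff.2 emb_tensorS_gauss_ne_zero⟩
  set a := ‖emb φ‖
  set B := 2 * ∑ j, ‖emb (sdx j φ)‖ with hB
  have hB0 : 0 ≤ B := mul_nonneg two_pos.le (Finset.sum_nonneg fun _ _ => norm_nonneg _)
  have hc0 : 0 ≤ c := by
    by_contra! hc0
    have h1 := hc φ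
    have h2 := le_norm_vGradV_herm (i := i) h 0
    simp only [herm, Function.iterate_zero, id, CharP.cast_eq_zero, zero_add] at h2
    have : 0 < ‖emb (opT z φ)‖ ∨ ‖emb (opT z φ)‖ = 0 := (norm_nonneg _).lt_or_eq.imp id Eq.symm
    rcases this with h3 | h3 <;> nlinarith
  have key : ∀ k : ℕ, ((k : ℝ) + 1) / 2 * a ≤ c * ((k + ‖z‖) * a + Real.sqrt (k + 1) * B) := by
    intro k
    have h1 := (le_norm_vGradV_herm (i := i) h k).trans ((hc _).trans
      (mul_le_mul_of_nonneg_left (norm_opT_herm_le h z k) hc0))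
    simp only [norm_herm h, norm_herm (ann_sdx_eq_zero h · _)] at h1
    have hf : 0 < Real.sqrt (k.factorial) := Real.sqrt_pos.2 (by positivity)
    refine le_of_mul_le_mul_left ?_ hf
    calc _ = ((k : ℝ) + 1) / 2 * (Real.sqrt (k.factorial) * a) := by ring
      _ ≤ _ := h1
      _ = _ := by
        rw [hB]
        simp only [mul_add, Finset.mul_sum]
        congr 1
        · ring
        · exact Finset.sum_congr rfl fun j _ => by ring
  obtain ⟨m, hm⟩ := exists_nat_gt ((c * B + c * ‖z‖ * a) / ((1 / 2 - c) * a))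
  rw [div_lt_iff₀ (mul_pos (by linarith) ha)] at hm
  -- This level makes `√(k + 1) = m + 1` exact.
  have hk := key ((m + 1) ^ 2 - 1)
  have hcast : (((m + 1) ^ 2 - 1 : ℕ) : ℝ) = (m + 1) ^ 2 - 1 := by
    rw [Nat.cast_sub (Nat.one_le_pow _ _ (by omega))]
    push_cast
    ring
  rw [hcast, sub_add_cancel, Real.sqrt_sq (by positivity)] at hk
  have hm0 : (0 : ℝ) ≤ m := Nat.cast_nonneg m
  have h1 : 0 ≤ (c * ‖z‖ * a) * m := by positivity
  have h2 : 0 ≤ c * a := by positivity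
  nlinarith [mul_lt_mul_of_pos_right hm (by positivity : (0 : ℝ) < m + 1),
    mul_pos (sub_pos.2 hlt) ha]

theorem emb_eq_R0_opT {z : ℂ} (hz : z ∉ halfLine) (u : Sch n) :
    emb u = R0 n z (emb (opT z u)) := by
  obtain ⟨hd, hP⟩ := P0_emb u
  have h4 := (isResolventAt_R0 (n := n) hz).2 ⟨emb u, hd⟩
  have h5 : P0 n ⟨emb u, hd⟩ - z • emb u = emb (opT z u) := by
    rw [hP, opT_shift z 0, map_add, map_smul]
    module
  rw [h5] at h4
  exact h4.symm

/-- Needed because the Gaussian decay in `v` is only available for a fixed range of exponents, while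
the claim is stated with `τ`. -/
theorem tau_le_two {z : ℂ} (hn : 1 ≤ n) (hz : z ∉ halfLine) : tau n z ≤ 2 := by
  by_contra! hlt
  have hτ : (tau n z)⁻¹ < 1 / 2 := by
    rw [one_div]
    exact inv_strictAnti₀ two_pos hlt
  obtain ⟨c, hc1, hc2⟩ := exists_between hτ
  have h1 : compNorm (vGradV n) (R0 n z) < ENNReal.ofReal c :=
    (compNorm_le_inv_tau hz).1.trans_lt
      ((ENNReal.ofReal_lt_ofReal_iff ((inv_pos.2 (tau_pos hz)).trans hc1)).2 hc1)
  refine absurd (half_le_of_vGradV_bound (z := z) hn fun u => ?_) (not_le.2 hc2)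
  obtain ⟨h2, h3⟩ := exists_bound_of_compNorm_lt h1 (emb (opT z u))
  obtain ⟨h6, h7⟩ := vGradV_emb u
  have h8 : vGradV n ⟨R0 n z (emb (opT z u)), h2⟩ = vGradV n ⟨emb u, h6⟩ :=
    congrArg _ (Subtype.ext (emb_eq_R0_opT hz u).symm)
  rwa [h8, h7] at h3

end

section

/-! ### The perturbation on the domain of the free operator -/

section Graph

variable {H : Type*} [NormedAddCommGroup H] [NormedSpace ℂ H]

/-- The vector `u` is in the domain of `A`, and `A u = w`. -/
def HasValue (A : H →ₗ.[ℂ] H) (u w : H) : Prop := ∃ h : u ∈ A.domain, A ⟨u, h⟩ = w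

theorem HasValue.neg {A : H →ₗ.[ℂ] H} {u w : H} (h : HasValue A u w) : HasValue (-A) u (-w) := by
  obtain ⟨h, rfl⟩ := h
  exact ⟨h, rfl⟩

theorem HasValue.add {A B : H →ₗ.[ℂ] H} {u w w' : H} (h : HasValue A u w)
    (h' : HasValue B u w') : HasValue (A + B) u (w + w') := by
  obtain ⟨h, rfl⟩ := h
  obtain ⟨h', rfl⟩ := h'
  exact ⟨⟨h, h'⟩, rfl⟩

theorem HasValue.sum {ι : Type*} {s : Finset ι} {A : ι → H →ₗ.[ℂ] H} {u : H} {w : ι → H}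
    (h : ∀ i ∈ s, HasValue (A i) u (w i)) : HasValue (∑ i ∈ s, A i) u (∑ i ∈ s, w i) := by
  classical
  induction s using Finset.induction_on with
  | empty => exact ⟨trivial, rfl⟩
  | insert a s ha ih =>
    rw [Finset.sum_insert ha, Finset.sum_insert ha]
    exact (h a (Finset.mem_insert_self a s)).add
      (ih fun i hi => h i (Finset.mem_insert_of_mem hi))

theorem HasValue.comp {A B : H →ₗ.[ℂ] H} {u w y : H} (h : HasValue B u w)
    (h' : HasValue A w y) : HasValue (compOp A B) u y := by
  obtain ⟨h, rfl⟩ := h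
  obtain ⟨h', rfl⟩ := h'
  exact ⟨mem_compDomain.2 ⟨h, h'⟩, rfl⟩

theorem HasValue.unique {A : H →ₗ.[ℂ] H} {u w w' : H} (h : HasValue A u w)
    (h' : HasValue A u w') : w = w' := by
  obtain ⟨h, rfl⟩ := h
  obtain ⟨h', rfl⟩ := h'
  rfl

end Graph

variable {n : ℕ}

theorem coeFn_finset_sum {ι : Type*} (s : Finset ι) (f : ι → L2 n) :
    ((∑ i ∈ s, f i : L2 n) : Phase n → ℂ) =ᵐ[volume] fun p => ∑ i ∈ s, f i p := by
  classical
  induction s using Finset.induction_on with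
  | empty =>
    filter_upwards [Lp.coeFn_zero ℂ 2 (volume : Measure (Phase n))] with p hp
    simp only [Finset.sum_empty]
    exact hp
  | insert a s ha ih =>
    rw [Finset.sum_insert ha]
    filter_upwards [ih, Lp.coeFn_add (f a) (∑ i ∈ s, f i)] with p h1 h2
    rw [h2, Pi.add_apply, h1, Finset.sum_insert ha]

/-- Vector fields which are bounded, continuous, and vanish at infinity. -/
structure Vanishing (b : Conf n → Conf n) (M : ℝ) : Prop where
  continuous : Continuous b
  norm_le : ∀ x, ‖b x‖ ≤ M
  tendsto : Filter.Tendsto b (Filter.cocompact (Conf n)) (nhds 0)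

theorem Vanishing.memLp {b : Conf n → Conf n} {M : ℝ} (h : Vanishing b M) (i : Fin n) (d : L2 n) :
    MemLp (fun p : Phase n => ((b p.1 i : ℝ) : ℂ) * d p) 2 volume := by
  have hc : Continuous fun p : Phase n => ((b p.1 i : ℝ) : ℂ) := by
    have := h.continuous
    fun_prop
  refine (Lp.memLp d).of_le_mul (c := M)
    (hc.aestronglyMeasurable.mul (Lp.aestronglyMeasurable d)) (Filter.Eventually.of_forall fun p => ?_)
  rw [norm_mul, Complex.norm_real]
  gcongr
  exact (PiLp.norm_apply_le _ i).trans (h.norm_le p.1)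

variable {V : Conf n → ℝ} {M : ℝ}

theorem hasValue_W (h : Vanishing (gradient V) M) {u : L2 n} {d : Fin n → L2 n}
    (hd : ∀ i, HasValue (maximal (dv i)) u (d i)) : ∃ w, HasValue (W V) u w ∧
      w =ᵐ[volume] fun p => -∑ i, ((gradient V p.1 i : ℝ) : ℂ) * d i p := by
  refine ⟨_, (HasValue.sum fun i _ => (hd i).comp
    (mulOp_eq (MemLp.coeFn_toLp (h.memLp i (d i))))).neg, ?_⟩
  have h1 : ∀ᵐ p, ∀ i, (h.memLp i (d i)).toLp _ p = ((gradient V p.1 i : ℝ) : ℂ) * d i p :=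
    ae_all_iff.2 fun i => MemLp.coeFn_toLp (h.memLp i (d i))
  filter_upwards [h1, coeFn_finset_sum Finset.univ fun i => (h.memLp i (d i)).toLp _,
    Lp.coeFn_neg (∑ i, (h.memLp i (d i)).toLp _)] with p h1 h2 h3
  rw [h3, Pi.neg_apply, h2]
  simp only [h1]

theorem hasValue_dv_emb (i : Fin n) (u : Sch n) :
    HasValue (maximal (dv i)) (emb u) (emb (sdv i u)) :=
  maximal_eq (dv_toDist_emb i u)

theorem hasValue_P_emb (h : Vanishing (gradient V) M) (u : Sch n) : ∃ w,
    HasValue (P V) (emb u) (emb (opT 0 u) + w) ∧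
      w =ᵐ[volume] fun p => -∑ i, ((gradient V p.1 i : ℝ) : ℂ) * sdv i u p := by
  obtain ⟨w, hw, hw'⟩ := hasValue_W h fun i => hasValue_dv_emb i u
  refine ⟨w, HasValue.add (P0_emb u) hw, ?_⟩
  have h1 : ∀ᵐ p, ∀ i, emb (sdv i u) p = sdv i u p := ae_all_iff.2 fun i => coeFn_emb (sdv i u)
  filter_upwards [h1, hw'] with p h1 h2
  simp only [h2, h1]

/-! ### Translations in the configuration space -/

/-- Translation of Schwartz functions. -/
def trans (a : Phase n) : Sch n →ₗ[ℂ] Sch n := (SchwartzMap.compSubConstCLM ℂ a).toLinearMap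

theorem trans_apply (a : Phase n) (u : Sch n) (p : Phase n) : trans a u p = u (p - a) := rfl

theorem sder_trans (m a : Phase n) (u : Sch n) : sder m (trans a u) = trans a (sder m u) := by
  ext p
  rw [trans_apply, sder_apply, sder_apply, show (trans a u : Phase n → ℂ) = fun p => u (p - a)
    from funext (trans_apply a u), fderiv_comp_sub]

theorem smv_trans (i : Fin n) (a : Conf n) (u : Sch n) :
    smv i (trans (a, 0) u) = trans (a, 0) (smv i u) := by
  ext p
  have h : ∀ (w : Sch n) p, smv i w p = cv i p * w p := fun w => smulS_apply (cv_temperate i) w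
  rw [trans_apply, h, h, trans_apply]
  simp [cv]

theorem opT_trans (z : ℂ) (a : Conf n) (u : Sch n) :
    opT z (trans (a, 0) u) = trans (a, 0) (opT z u) := by
  have h1 : ∀ i (u : Sch n), sdv i (trans (a, 0) u) = trans (a, 0) (sdv i u) := fun i =>
    sder_trans _ _
  have h2 : ∀ i (u : Sch n), sdx i (trans (a, 0) u) = trans (a, 0) (sdx i u) := fun i =>
    sder_trans _ _
  simp only [opT_apply, ann_apply, cre_apply, h1, h2, smv_trans, map_add, map_sub, map_neg,
    map_smul, map_sum]

theorem norm_sq_L2 (f : L2 n) : ‖f‖ ^ 2 = ∫ p, ‖f p‖ ^ 2 := by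
  rw [← re_inner_self, MeasureTheory.L2.inner_def]
  have : ∀ p, inner ℂ (f p) (f p) = ((‖f p‖ ^ 2 : ℝ) : ℂ) := fun p => by
    rw [inner_self_eq_norm_sq_to_K]
    norm_cast
  simp only [this]
  rw [integral_complex_ofReal, Complex.ofReal_re]

theorem norm_sq_emb (u : Sch n) : ‖emb u‖ ^ 2 = ∫ p, ‖u p‖ ^ 2 := by
  rw [norm_sq_L2]
  refine integral_congr_ae ?_
  filter_upwards [coeFn_emb u] with p hp
  rw [hp]

theorem norm_emb_trans (a : Phase n) (u : Sch n) : ‖emb (trans a u)‖ = ‖emb u‖ := by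
  refine (pow_left_inj₀ (norm_nonneg _) (norm_nonneg _) two_ne_zero).1 ?_
  rw [norm_sq_emb, norm_sq_emb]
  exact integral_sub_right_eq_self (fun p => ‖u p‖ ^ 2) a

/-- Dominated convergence: each point is translated to infinity along the first axis, where `b`
vanishes. -/
theorem Vanishing.tendsto_integral {b : Conf n → Conf n} (h : Vanishing b M) (hn : 1 ≤ n)
    (ψ : Fin n → Sch n) : Filter.Tendsto (fun k : ℕ => ∫ p : Phase n,
      ‖∑ i, ((b (p.1 + (k : ℝ) • EuclideanSpace.single ⟨0, hn⟩ 1) i : ℝ) : ℂ) * ψ i p‖ ^ 2)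
      Filter.atTop (nhds 0) := by
  have hM : MemLp (fun p : Phase n => M * ∑ i, ‖ψ i p‖) 2 volume :=
    (memLp_finsetSum _ fun i _ => ((ψ i).memLp 2 volume).norm).const_mul M
  have hb : ∀ (x : Conf n) (p : Phase n),
      ‖∑ i, ((b x i : ℝ) : ℂ) * ψ i p‖ ≤ M * ∑ i, ‖ψ i p‖ := fun x p => by
    rw [Finset.mul_sum]
    refine (norm_sum_le _ _).trans (Finset.sum_le_sum fun i _ => ?_)
    rw [norm_mul, Complex.norm_real]
    gcongr
    exact (PiLp.norm_apply_le _ i).trans (h.norm_le x)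
  have hbc := h.continuous
  have hψ : ∀ i, Continuous (ψ i) := fun i => (ψ i).continuous
  rw [← integral_zero (Phase n) ℝ (μ := volume)]
  refine tendsto_integral_of_dominated_convergence (fun p => (M * ∑ i, ‖ψ i p‖) ^ 2)
    (fun k => Continuous.aestronglyMeasurable (by fun_prop)) hM.integrable_sq
    (fun k => Filter.Eventually.of_forall fun p => ?_) (Filter.Eventually.of_forall fun p => ?_)
  · rw [norm_pow, norm_norm]
    gcongr
    exact hb _ p
  · have h1 : Filter.Tendsto (fun k : ℕ => p.1 + (k : ℝ) • EuclideanSpace.single ⟨0, hn⟩ (1 : ℝ))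
        Filter.atTop (Filter.cocompact (Conf n)) := by
      rw [← Metric.cobounded_eq_cocompact]
      refine tendsto_norm_atTop_iff_cobounded.1 (Filter.tendsto_atTop_mono (fun k => ?_)
        (Filter.tendsto_atTop_add_const_right _ (-‖p.1‖) tendsto_natCast_atTop_atTop))
      have := norm_sub_norm_le ((k : ℝ) • EuclideanSpace.single (⟨0, hn⟩ : Fin n) (1 : ℝ)) (-p.1)
      rw [norm_smul, PiLp.norm_single, norm_one, mul_one, Real.norm_natCast, norm_neg,
        sub_neg_eq_add, add_comm _ p.1] at this
      linarith
    have h2 := h.tendsto.comp h1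
    have h3 : ∀ i, Filter.Tendsto (fun k : ℕ =>
        ((b (p.1 + (k : ℝ) • EuclideanSpace.single ⟨0, hn⟩ (1 : ℝ)) i : ℝ) : ℂ))
        Filter.atTop (nhds 0) := fun i => by
      have hc : Continuous fun y : Conf n => ((y i : ℝ) : ℂ) := by fun_prop
      have := (hc.tendsto 0).comp h2
      rwa [PiLp.zero_apply, Complex.ofReal_zero] at this
    have h4 := (tendsto_finsetSum Finset.univ fun i _ => (h3 i).mul_const (ψ i p)).norm.pow 2
    simpa using h4

/-- A lower bound for `P - z` implies the same lower bound for `P₀ - z`. -/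
theorem norm_le_opT_of_norm_le_P (h : Vanishing (gradient V) M) (hn : 1 ≤ n) {z : ℂ} {K : ℝ}
    (hK : 0 ≤ K) (hP : ∀ u : (P V).domain, ‖(u : L2 n)‖ ≤ K * ‖P V u - z • (u : L2 n)‖) (φ : Sch n) :
    ‖emb φ‖ ≤ K * ‖emb (opT z φ)‖ := by
  set a : ℕ → Conf n := fun k => (k : ℝ) • EuclideanSpace.single ⟨0, hn⟩ 1
  have h1 : ∀ k, ‖emb φ‖ ≤ K * (‖emb (opT z φ)‖ + Real.sqrt (∫ p : Phase n,
      ‖∑ i, ((gradient V (p.1 + a k) i : ℝ) : ℂ) * sdv i φ p‖ ^ 2)) := by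
    intro k
    -- `P₀` commutes with translations in `x`, so only the perturbation notices that `φ` was moved;
    -- undoing the translation shifts `∇V` instead.
    obtain ⟨w, ⟨hw, hw'⟩, hwe⟩ := hasValue_P_emb h (trans (a k, 0) φ)
    have e1 := hP ⟨_, hw⟩
    rw [hw', norm_emb_trans] at e1
    refine e1.trans (mul_le_mul_of_nonneg_left ?_ hK)
    have e2 : emb (opT 0 (trans (a k, 0) φ)) + w - z • emb (trans (a k, 0) φ) =
        emb (trans (a k, 0) (opT z φ)) + w := by
      rw [← opT_trans, opT_shift z 0, map_add, map_smul]
      module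
    refine (congrArg norm e2).trans_le ((norm_add_le _ _).trans ?_)
    rw [norm_emb_trans]
    gcongr
    refine Real.le_sqrt_of_sq_le (le_of_eq ?_)
    rw [norm_sq_L2, ← integral_sub_right_eq_self (fun p : Phase n =>
      ‖∑ i, ((gradient V (p.1 + a k) i : ℝ) : ℂ) * sdv i φ p‖ ^ 2) ((a k, 0) : Phase n)]
    refine integral_congr_ae ?_
    filter_upwards [hwe] with p hp
    have e3 : ∀ i, sdv i (trans (a k, 0) φ) p = sdv i φ (p - (a k, 0)) := fun i => by
      rw [sdv, sder_trans, trans_apply]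
    rw [hp, norm_neg]
    simp only [e3, Prod.fst_sub, sub_add_cancel]
  have h2 := (h.tendsto_integral hn fun i => sdv i φ).sqrt
  rw [Real.sqrt_zero] at h2
  have h3 := (h2.const_add ‖emb (opT z φ)‖).const_mul K
  rw [add_zero] at h3
  exact ge_of_tendsto' h3 h1

/-! ### The half-line is contained in the spectrum -/

theorem norm_sq_baseS (g : 𝓢(Conf n, ℂ)) : ‖emb (baseS g)‖ ^ 2 =
    (∫ v, ‖gaussS (Conf n) v‖ ^ 2) * ‖g.toLp 2 volume‖ ^ 2 := by
  have h1 : ‖g.toLp 2 volume‖ ^ 2 = ∫ x, ‖g x‖ ^ 2 := by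
    rw [← re_inner_self (g.toLp 2 volume), SchwartzMap.inner_toL2_toL2_eq g g volume]
    have : ∀ p, inner ℂ (g p) (g p) = ((‖g p‖ ^ 2 : ℝ) : ℂ) := fun p => by
      rw [inner_self_eq_norm_sq_to_K]
      norm_cast
    simp only [this]
    rw [integral_complex_ofReal, Complex.ofReal_re]
  have hmp : MeasurePreserving (shear n) (volume : Measure (Phase n)) volume :=
    measurePreserving_sub_prod (volume : Measure (Conf n)) volume
  rw [norm_sq_emb, h1, mul_comm, ← integral_prod_mul, ← Measure.volume_eq_prod,
    ← hmp.integral_comp (shear n).toHomeomorph.measurableEmbedding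
      fun p : Phase n => ‖g p.1‖ ^ 2 * ‖gaussS (Conf n) p.2‖ ^ 2]
  refine integral_congr_ae (Filter.Eventually.of_forall fun p => ?_)
  simp only [baseS_apply, shear_apply, norm_mul, mul_pow]

open FourierTransform in
open Laplacian in
/-- The half-line is contained in the approximate spectrum of `-Δ`. -/
theorem exists_approx_eigenfunction (hn : 1 ≤ n) {z : ℂ} (hz : z ∈ halfLine) {ε : ℝ} (hε : 0 < ε) :
    ∃ g : 𝓢(Conf n, ℂ), g.toLp 2 volume ≠ 0 ∧
      ‖(-Δ g - z • g).toLp 2 volume‖ ≤ ε * ‖g.toLp 2 volume‖ := by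
  set m : Conf n → ℂ := fun ξ => (((2 * Real.pi) ^ 2 * ‖ξ‖ ^ 2 : ℝ) : ℂ) - z with hm
  have hmt : m.HasTemperateGrowth := temperate_symbol z
  -- A zero of the symbol, which exists because `z ≥ 0`. The approximate eigenfunction is the
  -- inverse Fourier transform of a bump at `ξ₀`, supported where the symbol is below `ε`.
  set ξ₀ : Conf n := (Real.sqrt z.re / (2 * Real.pi)) • EuclideanSpace.single ⟨0, hn⟩ 1
  have hm0 : m ξ₀ = 0 := by
    have h1 : ‖ξ₀‖ = Real.sqrt z.re / (2 * Real.pi) := by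
      rw [norm_smul, PiLp.norm_single, norm_one, mul_one, Real.norm_of_nonneg (by positivity)]
    have h2 : (2 * Real.pi) ^ 2 * ‖ξ₀‖ ^ 2 = z.re := by
      rw [h1, ← mul_pow, mul_div_cancel₀ _ (by positivity), Real.sq_sqrt hz.1]
    simp only [hm]
    rw [h2, sub_eq_zero]
    exact Complex.ext rfl (by rw [Complex.ofReal_im, hz.2])
  obtain ⟨δ, hδ, hmδ⟩ := Metric.continuousAt_iff.1 hmt.1.continuous.continuousAt ε hε
  let χ : ContDiffBump ξ₀ := ⟨δ / 2, δ, by positivity, by linarith⟩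
  have hχs : HasCompactSupport fun ξ => ((χ ξ : ℝ) : ℂ) :=
    χ.hasCompactSupport.comp_left (g := fun r : ℝ => (r : ℂ)) Complex.ofReal_zero
  have hχc : ContDiff ℝ ∞ fun ξ => ((χ ξ : ℝ) : ℂ) := Complex.ofRealCLM.contDiff.comp χ.contDiff
  set f : 𝓢(Conf n, ℂ) := hχs.toSchwartzMap hχc with hf
  have hfa : ∀ ξ, f ξ = χ ξ := fun ξ => rfl
  have hfn : f.toLp 2 volume ≠ 0 := by
    intro h0
    have h1 : f = 0 := SchwartzMap.injective_toLp 2 volume (h0.trans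
      (map_zero (SchwartzMap.toLpCLM ℂ ℂ 2 volume)).symm)
    have h2 := DFunLike.congr_fun h1 ξ₀
    rw [hfa, χ.one_of_mem_closedBall (Metric.mem_closedBall_self (by positivity))] at h2
    exact one_ne_zero h2
  have hpl : ‖((𝓕⁻ f : 𝓢(Conf n, ℂ))).toLp 2 volume‖ = ‖f.toLp 2 volume‖ := by
    rw [← SchwartzMap.norm_fourier_toL2_eq, FourierTransform.fourier_fourierInv_eq]
  refine ⟨𝓕⁻ f, fun h0 => hfn ?_, ?_⟩
  · rw [← norm_eq_zero, ← hpl, h0, norm_zero]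
  · rw [laplacian_sub_eq_multiplier, fourierMultiplierCLM_apply,
      FourierTransform.fourier_fourierInv_eq, hpl]
    rw [← SchwartzMap.norm_fourier_toL2_eq, FourierTransform.fourier_fourierInv_eq]
    refine Lp.norm_le_mul_norm_of_ae_le_mul ?_
    filter_upwards [f.coeFn_toLp 2 volume,
      (SchwartzMap.smulLeftCLM ℂ m f).coeFn_toLp 2 volume] with ξ h1 h2
    rw [h1, h2, SchwartzMap.smulLeftCLM_apply_apply hmt, norm_smul]
    by_cases hξ : dist ξ ξ₀ < δ
    · have := hmδ hξ
      rw [hm0, dist_zero_right] at this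
      gcongr
    · rw [hfa, χ.zero_of_le_dist (not_lt.1 hξ)]
      simp

/-- A bounded inverse would give a lower bound for `P₀ - z`. On base functions `P₀` is `-Δ` and
norms are proportional to those of `g`, so an approximate eigenfunction of `-Δ` contradicts it. -/
theorem not_mem_resolventSet_P (h : Vanishing (gradient V) M) (hn : 1 ≤ n) {z : ℂ}
    (hz : z ∈ halfLine) : z ∉ resolventSet (P V) := by
  rintro ⟨R, hR⟩
  have h1 := norm_le_opT_of_norm_le_P h hn (z := z) (norm_nonneg R) fun u => by
    conv_lhs => rw [← hR.2 u]
    exact R.le_opNorm _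
  -- The tolerance is chosen so that its product with `‖R‖` is below one.
  obtain ⟨g, hg, hgε⟩ := exists_approx_eigenfunction hn hz
    (by positivity : 0 < (2 * (‖R‖ + 1))⁻¹)
  have h2 := h1 (baseS g)
  rw [opT_baseS, lapx_baseS] at h2
  set c := ∫ v, ‖gaussS (Conf n) v‖ ^ 2
  have hc : 0 ≤ c := integral_nonneg fun v => by positivity
  have hb : ∀ g : 𝓢(Conf n, ℂ), ‖emb (baseS g)‖ = Real.sqrt c * ‖g.toLp 2 volume‖ := fun g => by
    refine (pow_left_inj₀ (norm_nonneg _) (by positivity) two_ne_zero).1 ?_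
    rw [norm_sq_baseS, mul_pow, Real.sq_sqrt hc]
  have hc0 : 0 < Real.sqrt c := by
    refine lt_of_le_of_ne (Real.sqrt_nonneg c) fun h0 => ?_
    have h3 := hb (gaussS (Conf n))
    rw [← h0, zero_mul, norm_eq_zero] at h3
    exact emb_baseS_gauss_ne_zero h3
  rw [hb, hb, mul_left_comm] at h2
  have h3 := le_of_mul_le_mul_left h2 hc0
  have h4 : ‖g.toLp 2 volume‖ ≤ ‖R‖ * ((2 * (‖R‖ + 1))⁻¹ * ‖g.toLp 2 volume‖) :=
    h3.trans (mul_le_mul_of_nonneg_left hgε (norm_nonneg R))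
  have hgp : 0 < ‖g.toLp 2 volume‖ := norm_pos_iff.2 hg
  have h5 : ‖R‖ * (2 * (‖R‖ + 1))⁻¹ < 1 := by
    rw [← div_eq_mul_inv, div_lt_one (by positivity)]
    linarith [norm_nonneg R]
  nlinarith

/-- A point `z` of the half-line is not isolated in the spectrum, since `z + r` is again on the
half-line. -/
theorem discreteSpectrum_P_not_mem_halfLine (h : Vanishing (gradient V) M) (hn : 1 ≤ n) {z : ℂ}
    (hz : z ∈ discreteSpectrum (P V)) : z ∉ halfLine := by
  intro hzh
  obtain ⟨-, r, hr, hres, -⟩ := hz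
  refine not_mem_resolventSet_P h hn (z := z + r) ⟨?_, ?_⟩ (hres _ ?_ ?_)
  · rw [Complex.add_re, Complex.ofReal_re]
    exact add_nonneg hzh.1 hr.le
  · rw [Complex.add_im, Complex.ofReal_im, hzh.2, add_zero]
  · rw [Metric.mem_closedBall, dist_eq_norm, add_sub_cancel_left, Complex.norm_real,
      Real.norm_of_nonneg hr.le]
  · rw [Ne, add_eq_left, Complex.ofReal_eq_zero]
    exact hr.ne'

end

section

variable {n : ℕ}

/-! ### Multiplication by bounded functions -/

theorem memLp_mul_of_bound {g : Phase n → ℂ} (hg : Continuous g) {c : ℝ} (hc : ∀ p, ‖g p‖ ≤ c)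
    (u : L2 n) : u ∈ (mulOp g).domain :=
  (Lp.memLp u).of_le_mul (c := c) (hg.aestronglyMeasurable.mul (Lp.aestronglyMeasurable u))
    (Filter.Eventually.of_forall fun p => by
      rw [norm_mul]
      exact mul_le_mul_of_nonneg_right (hc p) (norm_nonneg _))

/-- Multiplication by a bounded continuous function, as a bounded operator. -/
def bmul (g : Phase n → ℂ) (hg : Continuous g) {c : ℝ} (hc : ∀ p, ‖g p‖ ≤ c) :
    L2 n →L[ℂ] L2 n :=
  LinearMap.mkContinuous
    { toFun := fun u => mulOp g ⟨u, memLp_mul_of_bound hg hc u⟩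
      map_add' := fun u w => LinearPMap.map_add (mulOp g) ⟨u, memLp_mul_of_bound hg hc u⟩
        ⟨w, memLp_mul_of_bound hg hc w⟩
      map_smul' := fun a u => LinearPMap.map_smul (mulOp g) a ⟨u, memLp_mul_of_bound hg hc u⟩ } c
    fun u => Lp.norm_le_mul_norm_of_ae_le_mul (by
      filter_upwards [mulOp_coeFn g ⟨u, memLp_mul_of_bound hg hc u⟩] with p hp
      refine (congrArg norm hp).trans_le ?_
      rw [norm_mul]
      exact mul_le_mul_of_nonneg_right (hc p) (norm_nonneg _))

section

variable {g : Phase n → ℂ} {hg : Continuous g} {c : ℝ} {hc : ∀ p, ‖g p‖ ≤ c}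

theorem coeFn_bmul (u : L2 n) : bmul g hg hc u =ᵐ[volume] fun p => g p * u p :=
  mulOp_coeFn g ⟨u, memLp_mul_of_bound hg hc u⟩

theorem bmul_emb (ht : g.HasTemperateGrowth) (w : Sch n) :
    bmul g hg hc (emb w) = emb (smulS g w) := by
  refine Lp.ext ?_
  filter_upwards [coeFn_bmul (hg := hg) (hc := hc) (emb w), coeFn_emb w,
    coeFn_emb (smulS g w)] with p h1 h2 h3
  rw [h1, h2, h3, smulS_apply ht]

end

/-- Fatou's lemma; the pointwise bounds `c k` may blow up, as only the norms are uniform. -/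
theorem memLp_of_tendsto {g : ℕ → Phase n → ℂ} (hg : ∀ k, Continuous (g k)) {c : ℕ → ℝ}
    (hc : ∀ k p, ‖g k p‖ ≤ c k) {g' : Phase n → ℂ}
    (hlim : ∀ p, Filter.Tendsto (fun k => g k p) Filter.atTop (nhds (g' p))) {u : L2 n} {C : ℝ}
    (hC : ∀ k, ‖bmul (g k) (hg k) (hc k) u‖ ≤ C) : MemLp (fun p => g' p * u p) 2 volume := by
  have hm : ∀ k, AEStronglyMeasurable (fun p => g k p * u p) volume := fun k =>
    (hg k).aestronglyMeasurable.mul (Lp.aestronglyMeasurable u)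
  have hl : ∀ᵐ p, Filter.Tendsto (fun k => g k p * u p) Filter.atTop (nhds (g' p * u p)) :=
    Filter.Eventually.of_forall fun p => (hlim p).mul_const _
  refine ⟨aestronglyMeasurable_of_tendsto_ae _ hm hl, ?_⟩
  refine (Lp.eLpNorm_lim_le_liminf_eLpNorm (p := 2) hm _ hl).trans_lt ?_
  refine lt_of_le_of_lt (b := ENNReal.ofReal C) ?_ ENNReal.ofReal_lt_top
  refine (Filter.liminf_le_liminf (v := fun _ => ENNReal.ofReal C)
    (Filter.Eventually.of_forall fun k => ?_)).trans (by rw [Filter.liminf_const])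
  rw [← eLpNorm_congr_ae (coeFn_bmul (hg := hg k) (hc := hc k) u), ← Lp.enorm_def, ← ofReal_norm]
  exact ENNReal.ofReal_le_ofReal (hC k)

/-! ### Regularized exponential weights -/

/-- The weight `exp (κ f / (1 + ε f))`. -/
def wt (f : Phase n → ℝ) (κ ε : ℝ) (p : Phase n) : ℝ :=
  Real.exp (κ * (f p * (1 + ε * f p)⁻¹))

/-- The factor `κ exp (κ f / (1 + ε f)) / (1 + ε f)²` in the derivative of the weight. -/
def wd (f : Phase n → ℝ) (κ ε : ℝ) (p : Phase n) : ℝ :=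
  κ * ((1 + ε * f p)⁻¹ * (1 + ε * f p)⁻¹) * wt f κ ε p

theorem wt_pos (f : Phase n → ℝ) (κ ε : ℝ) (p : Phase n) : 0 < wt f κ ε p := Real.exp_pos _

section Weight

variable {f : Phase n → ℝ} (hf : f.HasTemperateGrowth) (h0 : ∀ p, 0 ≤ f p) {κ ε : ℝ}
  (hκ : 0 ≤ κ) (hε : 0 < ε)

include h0 hε in
theorem one_le_one_add (p : Phase n) : 1 ≤ 1 + ε * f p :=
  le_add_of_nonneg_right (mul_nonneg hε.le (h0 p))

include h0 hκ hε

theorem wt_le_exp (p : Phase n) : wt f κ ε p ≤ Real.exp (κ * f p) := by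
  refine Real.exp_le_exp.2 (mul_le_mul_of_nonneg_left ?_ hκ)
  exact mul_le_of_le_one_right (h0 p) (inv_le_one_of_one_le₀ (one_le_one_add h0 hε p))

theorem exponent_le (p : Phase n) : κ * (f p * (1 + ε * f p)⁻¹) ≤ κ * ε⁻¹ := by
  refine mul_le_mul_of_nonneg_left ?_ hκ
  have h1 := one_le_one_add h0 hε p
  rw [← div_eq_mul_inv, ← one_div, div_le_div_iff₀ (by linarith) hε]
  linarith

theorem wt_le (p : Phase n) : wt f κ ε p ≤ Real.exp (κ * ε⁻¹) :=
  Real.exp_le_exp.2 (exponent_le h0 hκ hε p)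

omit h0 hε in
theorem wd_nonneg (p : Phase n) : 0 ≤ wd f κ ε p :=
  mul_nonneg (mul_nonneg hκ (mul_self_nonneg _)) (wt_pos f κ ε p).le

/-- The regularization only decreases the logarithmic derivative, so the constant `κ` is uniform in
`ε`. -/
theorem wd_le (p : Phase n) : wd f κ ε p ≤ κ * wt f κ ε p := by
  have h1 := inv_le_one_of_one_le₀ (one_le_one_add h0 hε p)
  have h2 : 0 ≤ (1 + ε * f p)⁻¹ := inv_nonneg.2 (by linarith [one_le_one_add h0 hε p])
  refine mul_le_mul_of_nonneg_right (mul_le_of_le_one_right hκ ?_) (wt_pos f κ ε p).le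
  exact mul_le_one₀ h1 h2 h1

include hf

omit hκ in
theorem inv_temperate : (fun p => (1 + ε * f p)⁻¹).HasTemperateGrowth :=
  temperate_inv ((Function.HasTemperateGrowth.const 1).add
    ((Function.HasTemperateGrowth.const ε).mul hf)) one_pos (one_le_one_add h0 hε)

theorem wt_temperate : (wt f κ ε).HasTemperateGrowth :=
  temperate_exp ((Function.HasTemperateGrowth.const κ).mul (hf.mul (inv_temperate hf h0 hε)))
    (exponent_le h0 hκ hε)

theorem wd_temperate : (wd f κ ε).HasTemperateGrowth :=
  ((Function.HasTemperateGrowth.const κ).mul ((inv_temperate hf h0 hε).mul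
    (inv_temperate hf h0 hε))).mul (wt_temperate hf h0 hκ hε)

omit hκ in
theorem fderiv_wt (p m : Phase n) : fderiv ℝ (wt f κ ε) p m = wd f κ ε p * fderiv ℝ f p m := by
  have h1 := (hf.1.differentiable (by simp) p).hasFDerivAt
  have hne : 1 + ε * f p ≠ 0 := by linarith [one_le_one_add h0 hε p]
  have h2 : HasFDerivAt (wt f κ ε) _ p :=
    ((h1.mul ((hasDerivAt_inv hne).comp_hasFDerivAt p ((h1.const_mul ε).const_add 1))).const_mul
      κ).exp
  have h3 : Real.exp (κ * (f * Inv.inv ∘ fun x => 1 + ε * f x) p) = wt f κ ε p := rfl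
  rw [h2.fderiv, h3, wd]
  simp only [_root_.smul_apply, _root_.add_apply, smul_eq_mul, Function.comp_apply]
  field_simp
  ring

end Weight

/-- A real function as a complex function. -/
def toC (f : Phase n → ℝ) : Phase n → ℂ := fun p => ((f p : ℝ) : ℂ)

theorem toC_temperate {f : Phase n → ℝ} (hf : f.HasTemperateGrowth) :
    (toC f).HasTemperateGrowth :=
  Function.HasTemperateGrowth.comp Function.Complex.hasTemperateGrowth_ofReal hf

theorem conj_toC (f : Phase n → ℝ) (p : Phase n) : starRingEnd ℂ (toC f p) = toC f p :=
  Complex.conj_ofReal _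

theorem norm_toC {f : Phase n → ℝ} {p : Phase n} (h : 0 ≤ f p) : ‖toC f p‖ = f p := by
  rw [toC, Complex.norm_real, Real.norm_of_nonneg h]

theorem smulS_mul {g h : Phase n → ℂ} (hg : g.HasTemperateGrowth) (hh : h.HasTemperateGrowth)
    (u : Sch n) : smulS (fun p => g p * h p) u = smulS g (smulS h u) := by
  ext p
  have h1 : smulS (fun p => g p * h p) u p = g p * h p * u p := smulS_apply (hg.mul hh) u p
  rw [h1, smulS_apply hg, smulS_apply hh, mul_assoc]

theorem fderiv_toC {f : Phase n → ℝ} (hf : f.HasTemperateGrowth) (p m : Phase n) :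
    fderiv ℝ (toC f) p m = ((fderiv ℝ f p m : ℝ) : ℂ) := by
  have h1 : HasFDerivAt (toC f) _ p :=
    Complex.ofRealCLM.hasFDerivAt.comp p (hf.1.differentiable (by simp) p).hasFDerivAt
  rw [h1.fderiv]
  rfl

theorem sder_wt {f f' : Phase n → ℝ} (hf : f.HasTemperateGrowth) (h0 : ∀ p, 0 ≤ f p) {κ ε : ℝ}
    (hκ : 0 ≤ κ) (hε : 0 < ε) (hf' : f'.HasTemperateGrowth) {m : Phase n}
    (h : ∀ p, fderiv ℝ f p m = f' p) (u : Sch n) :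
    sder m (smulS (toC (wt f κ ε)) u) =
      smulS (toC (wt f κ ε)) (sder m u) + smulS (toC (wd f κ ε)) (smulS (toC f') u) := by
  have h1 := toC_temperate (wd_temperate hf h0 hκ hε)
  rw [← smulS_mul h1 (toC_temperate hf')]
  refine sder_smulS (toC_temperate (wt_temperate hf h0 hκ hε)) (h1.mul (toC_temperate hf')) m
    (fun p => ?_) u
  rw [fderiv_toC (wt_temperate hf h0 hκ hε), fderiv_wt hf h0 hε, h]
  simp [toC]

theorem norm_smulS_wd_le {f : Phase n → ℝ} (hf : f.HasTemperateGrowth) (h0 : ∀ p, 0 ≤ f p) {κ ε : ℝ}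
    (hκ : 0 ≤ κ) (hε : 0 < ε) (u : Sch n) :
    ‖emb (smulS (toC (wd f κ ε)) u)‖ ≤ κ * ‖emb (smulS (toC (wt f κ ε)) u)‖ := by
  refine Lp.norm_le_mul_norm_of_ae_le_mul ?_
  filter_upwards [coeFn_emb (smulS (toC (wd f κ ε)) u),
    coeFn_emb (smulS (toC (wt f κ ε)) u)] with p h1 h2
  rw [h1, h2, smulS_apply (toC_temperate (wd_temperate hf h0 hκ hε)),
    smulS_apply (toC_temperate (wt_temperate hf h0 hκ hε)), norm_mul, norm_mul,
    norm_toC (wd_nonneg hκ p), norm_toC (wt_pos _ _ _ p).le, ← mul_assoc]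
  exact mul_le_mul_of_nonneg_right (wd_le h0 hκ hε p) (norm_nonneg _)

theorem smulS_toC_zero (u : Sch n) : smulS (toC fun _ => 0) u = 0 := by
  have := smulS_const 0 u
  rw [zero_smul] at this
  rw [← this]
  congr 1

/-- The bounded operator of multiplication by a regularized exponential weight. -/
def wop {f : Phase n → ℝ} (hf : f.HasTemperateGrowth) (h0 : ∀ p, 0 ≤ f p) {κ ε : ℝ}
    (hκ : 0 ≤ κ) (hε : 0 < ε) : L2 n →L[ℂ] L2 n :=
  bmul (toC (wt f κ ε)) (toC_temperate (wt_temperate hf h0 hκ hε)).1.continuous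
    (c := Real.exp (κ * ε⁻¹)) fun p => by
      rw [norm_toC (wt_pos f κ ε p).le]
      exact wt_le h0 hκ hε p

/-- If the regularized weights of `u` are bounded in `L²`, then so is the weight of `u`. -/
theorem memLp_exp_of_wop {f : Phase n → ℝ} (hf : f.HasTemperateGrowth) (h0 : ∀ p, 0 ≤ f p) {κ : ℝ}
    (hκ : 0 ≤ κ) {u : L2 n} {C : ℝ} (hC : ∀ ε (hε : 0 < ε), ‖wop hf h0 hκ hε u‖ ≤ C) :
    MemLp (fun p => ((Real.exp (κ * f p) : ℝ) : ℂ) * u p) 2 volume := by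
  have hpos : ∀ k : ℕ, (0 : ℝ) < 1 / ((k : ℝ) + 1) := fun k => by positivity
  refine memLp_of_tendsto (g := fun k : ℕ => toC (wt f κ (1 / ((k : ℝ) + 1)))) _ _ (fun p => ?_)
    (fun k => hC _ (hpos k))
  have h1 : Filter.Tendsto (fun k : ℕ => 1 + 1 / ((k : ℝ) + 1) * f p) Filter.atTop (nhds 1) := by
    simpa using (tendsto_one_div_add_atTop_nhds_zero_nat.mul_const (f p)).const_add 1
  have h2 := (h1.inv₀ one_ne_zero).const_mul (f p)
  rw [inv_one, mul_one] at h2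
  exact (Complex.continuous_ofReal.tendsto _).comp
    ((Real.continuous_exp.tendsto _).comp (h2.const_mul κ))

theorem wop_emb {f : Phase n → ℝ} (hf : f.HasTemperateGrowth) (h0 : ∀ p, 0 ≤ f p) {κ ε : ℝ}
    (hκ : 0 ≤ κ) (hε : 0 < ε) (w : Sch n) :
    wop hf h0 hκ hε (emb w) = emb (smulS (toC (wt f κ ε)) w) :=
  bmul_emb (toC_temperate (wt_temperate hf h0 hκ hε)) w

theorem coeFn_wop {f : Phase n → ℝ} (hf : f.HasTemperateGrowth) (h0 : ∀ p, 0 ≤ f p) {κ ε : ℝ}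
    (hκ : 0 ≤ κ) (hε : 0 < ε) (u : L2 n) :
    wop hf h0 hκ hε u =ᵐ[volume] fun p => ((wt f κ ε p : ℝ) : ℂ) * u p :=
  coeFn_bmul u

/-- The pointwise absolute value of an element of `L²`. -/
def absL (u : L2 n) : L2 n :=
  MemLp.toLp (fun p => ((‖u p‖ : ℝ) : ℂ)) (Lp.memLp u).norm.ofReal

theorem coeFn_absL (u : L2 n) : absL u =ᵐ[volume] fun p => ((‖u p‖ : ℝ) : ℂ) :=
  MemLp.coeFn_toLp (Lp.memLp u).norm.ofReal

theorem norm_absL_le (u : L2 n) : ‖absL u‖ ≤ ‖u‖ := by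
  refine Lp.norm_le_norm_of_ae_le ?_
  filter_upwards [coeFn_absL u] with p hp
  rw [hp, Complex.norm_real, norm_norm]

/-- Replacing the functions by their absolute values makes the pointwise majorant an element of
`L²`, to which the triangle inequality applies. -/
theorem norm_le_of_ae_le_sum {β : L2 n} {c d : Fin n → L2 n} {A B : ℝ} (hA : 0 ≤ A) (hB : 0 ≤ B)
    (h : ∀ᵐ p, ‖β p‖ ≤ ∑ i, (A * ‖c i p‖ + B * ‖d i p‖)) :
    ‖β‖ ≤ ∑ i, (A * ‖c i‖ + B * ‖d i‖) := by
  set g : Fin n → L2 n := fun i => (A : ℂ) • absL (c i) + (B : ℂ) • absL (d i)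
  have hg : ∀ᵐ p, ∀ i, g i p = ((A * ‖c i p‖ + B * ‖d i p‖ : ℝ) : ℂ) := by
    refine ae_all_iff.2 fun i => ?_
    filter_upwards [Lp.coeFn_add ((A : ℂ) • absL (c i)) ((B : ℂ) • absL (d i)),
      Lp.coeFn_smul (A : ℂ) (absL (c i)), Lp.coeFn_smul (B : ℂ) (absL (d i)),
      coeFn_absL (c i), coeFn_absL (d i)] with p h1 h2 h3 h4 h5
    refine h1.trans ?_
    rw [Pi.add_apply, h2, h3, Pi.smul_apply, Pi.smul_apply, h4, h5]
    push_cast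
    rfl
  have h1 : ‖β‖ ≤ ‖∑ i, g i‖ := by
    refine Lp.norm_le_norm_of_ae_le ?_
    filter_upwards [h, hg, coeFn_finset_sum Finset.univ g] with p e1 e2 e3
    rw [e3]
    simp only [e2]
    rw [← Complex.ofReal_sum, Complex.norm_real]
    exact e1.trans (Real.le_norm_self _)
  refine h1.trans ((norm_sum_le _ _).trans (Finset.sum_le_sum fun i _ => ?_))
  refine (norm_add_le _ _).trans ?_
  rw [norm_smul, norm_smul, Complex.norm_real, Complex.norm_real, Real.norm_of_nonneg hA,
    Real.norm_of_nonneg hB]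
  gcongr
  · exact norm_absL_le _
  · exact norm_absL_le _

end

section

variable {n : ℕ}

/-! ### Eigenfunctions -/

variable {V : Conf n → ℝ} {M : ℝ}

theorem mem_P0_domain {u : L2 n} (h : u ∈ (P V).domain) : u ∈ (P0 n).domain := by
  have h1 : (P V).domain = (P0 n).domain ⊓ (W V).domain := LinearPMap.add_domain _ _
  rw [h1] at h
  exact (Submodule.mem_inf.1 h).1

/-- Approximation of eigenfunctions of `P` by Schwartz functions. -/
theorem exists_seq_of_eigenfunction (h : Vanishing (gradient V) M) {z : ℂ} {u : L2 n}
    (hu : HasValue (P V) u (z • u)) :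
    ∃ (w : ℕ → Sch n) (f : L2 n) (d y : Fin n → L2 n),
      Filter.Tendsto (fun k => emb (w k)) Filter.atTop (nhds u) ∧
      Filter.Tendsto (fun k => emb (opT 0 (w k))) Filter.atTop (nhds f) ∧
      (∀ i, Filter.Tendsto (fun k => emb (sdv i (w k))) Filter.atTop (nhds (d i))) ∧
      (∀ i, Filter.Tendsto (fun k => emb (smv i (w k))) Filter.atTop (nhds (y i))) ∧
      (∀ i, y i =ᵐ[volume] fun p => cv i p * u p) ∧
      ((f - z • u : L2 n) : Phase n → ℂ) =ᵐ[volume]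
        fun p => ∑ i, ((gradient V p.1 i : ℝ) : ℂ) * d i p := by
  have hu0 : u ∈ (P0 n).domain := mem_P0_domain hu.1
  obtain ⟨w, h1, h2⟩ := exists_schwartz_seq ⟨u, hu0⟩
  have hd : ∀ i, ∃ d, HasValue (maximal (dv i)) u d ∧
      Filter.Tendsto (fun k => emb (sdv i (w k))) Filter.atTop (nhds d) := fun i => by
    obtain ⟨e, he⟩ := tendsto_of_relBounded (A := maximal (dv i)) (seqClosed_maximal _) (sdv i)
      (hasValue_dv_emb i) (K := 1) (fun w => by rw [one_mul]; exact norm_sdv_le i w) h1 h2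
    exact ⟨_, ⟨e, rfl⟩, he⟩
  have hy : ∀ i, ∃ y : L2 n, y =ᵐ[volume] (fun p => cv i p * u p) ∧
      Filter.Tendsto (fun k => emb (smv i (w k))) Filter.atTop (nhds y) := fun i => by
    obtain ⟨e, he⟩ := tendsto_of_relBounded (A := mulOp (cv i)) (seqClosed_mulOp _) (smv i)
      (mulOp_emb (cv_temperate i)) (norm_smv_le i) h1 h2
    exact ⟨_, mulOp_coeFn (cv i) _, he⟩
  choose d hd1 hd2 using hd
  choose y hy1 hy2 using hy
  obtain ⟨e, he, he'⟩ := hasValue_W h hd1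
  refine ⟨w, P0 n ⟨u, hu0⟩, d, y, h1, h2, hd2, hy2, hy1, ?_⟩
  have h0 : HasValue (P0 n) u (P0 n ⟨u, hu0⟩) := ⟨hu0, rfl⟩
  have h3 : HasValue (P V) u (P0 n ⟨u, hu0⟩ + e) := HasValue.add h0 he
  have h4 : P0 n ⟨u, hu0⟩ + e = z • u := h3.unique hu
  have h5 : P0 n ⟨u, hu0⟩ - z • u = -e := by rw [← h4]; abel
  rw [h5]
  filter_upwards [he', Lp.coeFn_neg e] with p hp1 hp2
  rw [hp2, Pi.neg_apply, hp1, neg_neg]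

/-! ### Decay in the velocity variable -/

/-- The energy identity for `P₀` with a weight depending on `v` only. -/
theorem re_inner_smulS_opT {G : Phase n → ℂ} {G' : Fin n → Phase n → ℂ}
    (hG : G.HasTemperateGrowth) (hr : ∀ p, starRingEnd ℂ (G p) = G p)
    (hG' : ∀ j, (G' j).HasTemperateGrowth)
    (hv : ∀ j u, sdv j (smulS G u) = smulS G (sdv j u) + smulS (G' j) u)
    (hx : ∀ j u, sdx j (smulS G u) = smulS G (sdx j u)) (u : Sch n) :
    (inner ℂ (emb (smulS G u)) (emb (smulS G (opT 0 u)))).re =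
      ∑ j, ‖emb (smulS G (sdv j u) + smulS (G' j) u)‖ ^ 2 - ∑ j, ‖emb (smulS (G' j) u)‖ ^ 2 +
        1 / 4 * ∑ j, ‖emb (smulS G (smv j u))‖ ^ 2 - n / 2 * ‖emb (smulS G u)‖ ^ 2 := by
  have h1 : ∀ j, (inner ℂ (emb (smulS G u)) (emb (smulS G (sdv j (sdv j u))))).re =
      ‖emb (smulS (G' j) u)‖ ^ 2 - ‖emb (smulS G (sdv j u) + smulS (G' j) u)‖ ^ 2 := fun j => by
    have e1 : inner ℂ (emb (smulS G u)) (emb (smulS G (sdv j (sdv j u)))) =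
        -inner ℂ (emb (sdv j (smulS G u))) (emb (smulS G (sdv j u))) -
          inner ℂ (emb (smulS (G' j) u)) (emb (smulS G (sdv j u))) := by
      rw [inner_smulS hG hr, inner_sdv, hv, map_add, inner_add_left, ← inner_smulS hG hr,
        smulS_comm (hG' j) hG, ← inner_smulS hG hr]
      ring
    rw [e1, hv, map_add, inner_add_left]
    set a := emb (smulS G (sdv j u))
    set b := emb (smulS (G' j) u)
    simp only [Complex.sub_re, Complex.neg_re, Complex.add_re, re_inner_self]
    have e2 : ‖a + b‖ ^ 2 = ‖a‖ ^ 2 + 2 * (inner ℂ b a).re + ‖b‖ ^ 2 := by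
      rw [← re_inner_self, inner_add_left, inner_add_right, inner_add_right,
        ← inner_conj_symm a b]
      simp only [Complex.add_re, Complex.conj_re, re_inner_self]
      ring
    rw [e2]
    ring
  have h2 : ∀ j, (inner ℂ (emb (smulS G u)) (emb (smulS G (smv j (sdx j u))))).re = 0 :=
    fun j => by
      have : smulS G (smv j (sdx j u)) = smv j (sdx j (smulS G u)) := by
        rw [hx]
        exact smulS_comm hG (cv_temperate j) _
      rw [this]
      exact re_inner_transport j _
  have h3 : ∀ j, (inner ℂ (emb (smulS G u)) (emb (smulS G (smv j (smv j u))))).re =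
      ‖emb (smulS G (smv j u))‖ ^ 2 := fun j => by
    have e1 : ∀ w, smulS G (smv j w) = smv j (smulS G w) := fun w =>
      smulS_comm hG (cv_temperate j) _
    rw [e1, inner_smv, ← e1, re_inner_self]
  rw [opT_expand, snv_eq]
  simp only [map_add, map_sub, map_neg, map_sum, map_smul, zero_smul, sub_zero, inner_add_right,
    inner_sub_right, inner_neg_right, inner_sum, inner_smul_right, Complex.add_re, Complex.sub_re,
    Complex.neg_re, Complex.re_sum, h1, h2]
  rw [show (1 / 4 : ℂ) = ((1 / 4 : ℝ) : ℂ) by norm_num,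
    show (n : ℂ) / 2 = ((n / 2 : ℝ) : ℂ) by push_cast; rfl]
  simp only [Complex.re_ofReal_mul, Complex.re_sum, h3, re_inner_self, Finset.sum_sub_distrib,
    Finset.sum_const_zero]
  ring

/-- The function `|v|²`. -/
def sqv (p : Phase n) : ℝ := ‖p.2‖ ^ 2

theorem sqv_nonneg (p : Phase n) : 0 ≤ sqv p := sq_nonneg _

theorem sqv_temperate : (sqv : Phase n → ℝ).HasTemperateGrowth :=
  Function.HasTemperateGrowth.comp (Function.hasTemperateGrowth_norm_sq (H := Conf n))
    (ContinuousLinearMap.snd ℝ (Conf n) (Conf n)).hasTemperateGrowth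

theorem fderiv_sqv (p m : Phase n) : fderiv ℝ sqv p m = 2 * inner ℝ p.2 m.2 := by
  have h : HasFDerivAt (sqv : Phase n → ℝ) _ p :=
    (hasStrictFDerivAt_norm_sq p.2).hasFDerivAt.comp p (hasFDerivAt_snd (p := p))
  rw [h.fderiv]
  simp

theorem fderiv_sqv_ev (j : Fin n) (p : Phase n) : fderiv ℝ sqv p (ev j) = 2 * p.2 j := by
  rw [fderiv_sqv, ev, EuclideanSpace.inner_single_right]
  simp

theorem fderiv_sqv_ex (j : Fin n) (p : Phase n) : fderiv ℝ sqv p (ex j) = 0 := by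
  rw [fderiv_sqv, ex, inner_zero_right, mul_zero]

theorem coord_temperate (j : Fin n) : (fun p : Phase n => 2 * p.2 j).HasTemperateGrowth :=
  (Function.HasTemperateGrowth.const 2).mul ((EuclideanSpace.proj j : Conf n →L[ℝ] ℝ) ∘L
    ContinuousLinearMap.snd ℝ (Conf n) (Conf n)).hasTemperateGrowth

theorem smulS_two_coord (j : Fin n) (u : Sch n) :
    smulS (toC fun p => 2 * p.2 j) u = (2 : ℂ) • smv j u := by
  ext p
  have h : smv j u p = cv j p * u p := smulS_apply (cv_temperate j) u p
  rw [smulS_apply (toC_temperate (coord_temperate j)), _root_.smul_apply, h]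
  simp [toC, cv]
  ring

section VelocityWeight

variable {κ ε : ℝ} (hκ : 0 ≤ κ) (hε : 0 < ε)
include hκ hε

theorem sdv_wt_sqv (j : Fin n) (u : Sch n) : sdv j (smulS (toC (wt sqv κ ε)) u) =
    smulS (toC (wt sqv κ ε)) (sdv j u) +
      smulS (fun p => toC (wd sqv κ ε) p * toC (fun p => 2 * p.2 j) p) u := by
  rw [smulS_mul (toC_temperate (wd_temperate sqv_temperate sqv_nonneg hκ hε))
    (toC_temperate (coord_temperate j))]
  exact sder_wt sqv_temperate sqv_nonneg hκ hε (coord_temperate j) (fderiv_sqv_ev j) u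

theorem sdx_wt_sqv (j : Fin n) (u : Sch n) :
    sdx j (smulS (toC (wt sqv κ ε)) u) = smulS (toC (wt sqv κ ε)) (sdx j u) := by
  refine (sder_wt sqv_temperate sqv_nonneg hκ hε (Function.HasTemperateGrowth.const 0)
    (fderiv_sqv_ex j) u).trans ?_
  rw [smulS_toC_zero, map_zero, add_zero]
  rfl

theorem norm_wd_sqv_le (j : Fin n) (u : Sch n) :
    ‖emb (smulS (fun p => toC (wd sqv κ ε) p * toC (fun p => 2 * p.2 j) p) u)‖ ≤
      2 * κ * ‖emb (smulS (toC (wt sqv κ ε)) (smv j u))‖ := by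
  have hd := toC_temperate (wd_temperate (sqv_temperate (n := n)) sqv_nonneg hκ hε)
  rw [smulS_mul hd (toC_temperate (coord_temperate j)), smulS_two_coord, map_smul, map_smul,
    norm_smul, Complex.norm_ofNat, mul_assoc]
  exact mul_le_mul_of_nonneg_left (norm_smulS_wd_le sqv_temperate sqv_nonneg hκ hε _) two_pos.le

/-- The weighted energy estimate for `P₀`. -/
theorem weighted_energy (hκ' : κ ≤ 1 / 8) (u : Sch n) :
    1 / 2 * ∑ j, ‖emb (smulS (toC (wt sqv κ ε)) (sdv j u))‖ ^ 2 +
        1 / 16 * ∑ j, ‖emb (smulS (toC (wt sqv κ ε)) (smv j u))‖ ^ 2 ≤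
      (inner ℂ (emb (smulS (toC (wt sqv κ ε)) u)) (emb (smulS (toC (wt sqv κ ε)) (opT 0 u)))).re +
        n / 2 * ‖emb (smulS (toC (wt sqv κ ε)) u)‖ ^ 2 := by
  have hd := toC_temperate (wd_temperate (sqv_temperate (n := n)) sqv_nonneg hκ hε)
  have hw := toC_temperate (wt_temperate (sqv_temperate (n := n)) sqv_nonneg hκ hε)
  rw [re_inner_smulS_opT hw (conj_toC _) (fun j => hd.mul (toC_temperate (coord_temperate j)))
    (sdv_wt_sqv hκ hε)
    (sdx_wt_sqv hκ hε) u]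
  have h1 : ∀ j, 1 / 2 * ‖emb (smulS (toC (wt sqv κ ε)) (sdv j u))‖ ^ 2 +
      1 / 16 * ‖emb (smulS (toC (wt sqv κ ε)) (smv j u))‖ ^ 2 ≤
      ‖emb (smulS (toC (wt sqv κ ε)) (sdv j u) +
        smulS (fun p => toC (wd sqv κ ε) p * toC (fun p => 2 * p.2 j) p) u)‖ ^ 2 -
      ‖emb (smulS (fun p => toC (wd sqv κ ε) p * toC (fun p => 2 * p.2 j) p) u)‖ ^ 2 +
      1 / 4 * ‖emb (smulS (toC (wt sqv κ ε)) (smv j u))‖ ^ 2 := fun j => by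
    have e1 := norm_wd_sqv_le hκ hε j u
    rw [map_add]
    set a := emb (smulS (toC (wt sqv κ ε)) (sdv j u))
    set b := emb (smulS (fun p => toC (wd sqv κ ε) p * toC (fun p => 2 * p.2 j) p) u)
    set y := ‖emb (smulS (toC (wt sqv κ ε)) (smv j u))‖
    have hy : 0 ≤ y := norm_nonneg _
    -- This is where `κ ≤ 1/8` enters. Then `‖a + b‖² - ‖b‖² ≥ ‖a‖²/2 - 2‖b‖² ≥ ‖a‖²/2 - y²/8`, and
    -- the potential contributes `y²/4`.
    have e2 : ‖b‖ ≤ 1 / 4 * y := e1.trans (by gcongr; linarith)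
    have e3 : ‖a‖ ≤ ‖a + b‖ + ‖b‖ := by
      have := norm_sub_le (a + b) b
      rwa [add_sub_cancel_right] at this
    have e4 : ‖b‖ ^ 2 ≤ (1 / 4 * y) ^ 2 := by gcongr
    have e5 : ‖a‖ ^ 2 ≤ (‖a + b‖ + ‖b‖) ^ 2 := by gcongr
    nlinarith [sq_nonneg (‖a + b‖ - ‖b‖)]
  have h2 := Finset.sum_le_sum fun j (_ : j ∈ Finset.univ) => h1 j
  simp only [Finset.sum_add_distrib, Finset.sum_sub_distrib, ← Finset.mul_sum] at h2
  have e : ∀ a b c d e : ℝ, a ≤ b - c + d → a ≤ b - c + d - e + e := fun a b c d e h => by linarith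
  exact e _ _ _ _ _ h2

end VelocityWeight

end

section

variable {n : ℕ} {V : Conf n → ℝ} {M : ℝ}

theorem norm_wop_sum_le {f : Phase n → ℝ} (hf : f.HasTemperateGrowth) (h0 : ∀ p, 0 ≤ f p) {κ ε : ℝ}
    (hκ : 0 ≤ κ) (hε : 0 < ε) {b : Phase n → Fin n → ℝ} {A B : ℝ} (hA : 0 ≤ A) (hB : 0 ≤ B)
    (hb : ∀ p i, |b p i| * wt f κ ε p ≤ A * wt f κ ε p + B) {β : L2 n} {d : Fin n → L2 n}
    (hβ : β =ᵐ[volume] fun p => ∑ i, ((b p i : ℝ) : ℂ) * d i p) :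
    ‖wop hf h0 hκ hε β‖ ≤ ∑ i, (A * ‖wop hf h0 hκ hε (d i)‖ + B * ‖d i‖) := by
  refine norm_le_of_ae_le_sum hA hB ?_
  have h1 : ∀ᵐ p, ∀ i, wop hf h0 hκ hε (d i) p = ((wt f κ ε p : ℝ) : ℂ) * d i p :=
    ae_all_iff.2 fun i => coeFn_wop hf h0 hκ hε (d i)
  filter_upwards [h1, hβ, coeFn_wop hf h0 hκ hε β] with p e1 e2 e3
  rw [e3, e2, Finset.mul_sum]
  refine (norm_sum_le _ _).trans (Finset.sum_le_sum fun i _ => ?_)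
  rw [e1, norm_mul, norm_mul, norm_mul, Complex.norm_real, Complex.norm_real,
    Real.norm_of_nonneg (wt_pos f κ ε p).le, Real.norm_eq_abs]
  calc _ = (|b p i| * wt f κ ε p) * ‖d i p‖ := by ring
    _ ≤ (A * wt f κ ε p + B) * ‖d i p‖ := mul_le_mul_of_nonneg_right (hb p i) (norm_nonneg _)
    _ = _ := by ring

/-- The part of a weighted function at high velocities is controlled by its velocity moments. -/
theorem norm_wop_sqv_le {κ ε : ℝ} (hκ : 0 ≤ κ) (hε : 0 < ε) {u : L2 n} {y : Fin n → L2 n}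
    (hy : ∀ i, y i =ᵐ[volume] fun p => cv i p * u p) {R : ℝ} (hR : 0 ≤ R)
    (h : ∑ j, ‖wop sqv_temperate sqv_nonneg hκ hε (y j)‖ ^ 2 ≤
      R * ‖wop sqv_temperate sqv_nonneg hκ hε u‖ ^ 2) :
    ‖wop sqv_temperate sqv_nonneg hκ hε u‖ ≤
      Real.sqrt (R + 1) * Real.exp (κ * (R + 1)) * ‖u‖ := by
  set G := wop (sqv_temperate (n := n)) sqv_nonneg hκ hε
  set E := Real.exp (κ * (R + 1))
  have hint : ∀ f : L2 n, Integrable (fun p => ‖f p‖ ^ 2) := fun f =>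
    (Lp.memLp f).norm.integrable_sq
  have h1 : (R + 1) * ‖G u‖ ^ 2 ≤ ∑ j, ‖G (y j)‖ ^ 2 + (R + 1) * E ^ 2 * ‖u‖ ^ 2 := by
    simp only [norm_sq_L2]
    rw [← integral_const_mul, ← integral_const_mul, ← integral_finsetSum _ fun j _ => hint _,
      ← integral_add (integrable_finsetSum _ fun j _ => hint _) ((hint u).const_mul _)]
    refine integral_mono_ae ((hint _).const_mul _)
      ((integrable_finsetSum _ fun j _ => hint _).add ((hint u).const_mul _)) ?_
    have e1 : ∀ᵐ p, ∀ j, G (y j) p = ((wt sqv κ ε p : ℝ) : ℂ) * y j p :=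
      ae_all_iff.2 fun j => coeFn_wop sqv_temperate sqv_nonneg hκ hε (y j)
    filter_upwards [e1, ae_all_iff.2 hy, coeFn_wop sqv_temperate sqv_nonneg hκ hε u]
      with p e1 e2 e3
    have e4 : ∑ j, ‖G (y j) p‖ ^ 2 = wt sqv κ ε p ^ 2 * sqv p * ‖u p‖ ^ 2 := by
      rw [sqv, EuclideanSpace.real_norm_sq_eq, Finset.mul_sum, Finset.sum_mul]
      refine Finset.sum_congr rfl fun j _ => ?_
      rw [e1, e2, cv, norm_mul, norm_mul, Complex.norm_real, Complex.norm_real, mul_pow, mul_pow,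
        Real.norm_eq_abs, Real.norm_eq_abs, sq_abs, sq_abs]
      ring
    have e5 : ‖G u p‖ ^ 2 = wt sqv κ ε p ^ 2 * ‖u p‖ ^ 2 := by
      rw [e3, norm_mul, Complex.norm_real, mul_pow, Real.norm_eq_abs, sq_abs]
    simp only [e4, e5]
    rw [← mul_assoc, ← add_mul]
    refine mul_le_mul_of_nonneg_right ?_ (sq_nonneg _)
    -- Above `|v|² = R + 1` the moment dominates; below it the weight is at most `E`, whatever `ε`.
    -- The surplus `1` over `R` is what remains on the left after `h` is inserted.
    rcases le_total (R + 1) (sqv p) with hp | hp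
    · have : wt sqv κ ε p ^ 2 * (R + 1) ≤ wt sqv κ ε p ^ 2 * sqv p := by gcongr
      have : 0 ≤ (R + 1) * E ^ 2 := by positivity
      linarith
    · have : wt sqv κ ε p ≤ E :=
        (wt_le_exp sqv_nonneg hκ hε p).trans (Real.exp_le_exp.2 (by gcongr))
      have : (R + 1) * wt sqv κ ε p ^ 2 ≤ (R + 1) * E ^ 2 := by
        have := (wt_pos sqv κ ε p).le
        gcongr
      have : 0 ≤ wt sqv κ ε p ^ 2 * sqv p := mul_nonneg (sq_nonneg _) (sqv_nonneg p)
      linarith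
  refine (pow_le_pow_iff_left₀ (norm_nonneg _) (by positivity) two_ne_zero).1 ?_
  rw [mul_pow, mul_pow, Real.sq_sqrt (by positivity)]
  linarith

/-- Gaussian decay of eigenfunctions in the velocity variable. -/
theorem memLp_exp_sqv (h : Vanishing (gradient V) M) {z : ℂ} {u : L2 n}
    (hu : HasValue (P V) u (z • u)) {κ : ℝ} (hκ : 0 ≤ κ) (hκ' : κ ≤ 1 / 8) :
    MemLp (fun p : Phase n => ((Real.exp (κ * ‖p.2‖ ^ 2) : ℝ) : ℂ) * u p) 2 volume := by
  have hM : 0 ≤ M := (norm_nonneg _).trans (h.norm_le 0)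
  obtain ⟨w, f, d, y, hw, hf, hd, hy, hyu, hfu⟩ := exists_seq_of_eigenfunction h hu
  set K : ℝ := ‖z‖ + n / 2 + n * M ^ 2 / 2
  have hK : 0 ≤ K := by positivity
  refine memLp_exp_of_wop sqv_temperate sqv_nonneg hκ
    (C := Real.sqrt (16 * K + 1) * Real.exp (κ * (16 * K + 1)) * ‖u‖) fun ε hε => ?_
  refine norm_wop_sqv_le hκ hε hyu (by positivity) ?_
  set G := wop (sqv_temperate (n := n)) sqv_nonneg hκ hε with hG
  have hGl : ∀ {w : ℕ → L2 n} {x : L2 n}, Filter.Tendsto w Filter.atTop (nhds x) →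
      Filter.Tendsto (fun k => G (w k)) Filter.atTop (nhds (G x)) := fun h =>
    (G.continuous.tendsto _).comp h
  -- The energy estimate passes to the limit along the Schwartz approximation because, for fixed
  -- `ε`, the weight is a bounded operator.
  have h1 : 1 / 2 * ∑ j, ‖G (d j)‖ ^ 2 + 1 / 16 * ∑ j, ‖G (y j)‖ ^ 2 ≤
      (inner ℂ (G u) (G f)).re + n / 2 * ‖G u‖ ^ 2 := by
    refine le_of_tendsto_of_tendsto'
      (((tendsto_finsetSum _ fun j _ => (hGl (hd j)).norm.pow 2).const_mul _).add
        ((tendsto_finsetSum _ fun j _ => (hGl (hy j)).norm.pow 2).const_mul _))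
      (((Complex.continuous_re.tendsto _).comp ((hGl hw).inner (hGl hf))).add
        (((hGl hw).norm.pow 2).const_mul _)) fun k => ?_
    simp only [hG, wop_emb, Function.comp_apply]
    exact weighted_energy hκ hε hκ' (w k)
  have h2 := norm_wop_sum_le sqv_temperate sqv_nonneg hκ hε (b := fun p i => gradient V p.1 i)
    (A := M) (B := 0) hM le_rfl (fun p i => by
      rw [add_zero]
      refine mul_le_mul_of_nonneg_right ?_ (wt_pos _ _ _ p).le
      exact (PiLp.norm_apply_le _ i).trans (h.norm_le p.1)) hfu
  simp only [zero_mul, add_zero] at h2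
  have h3 : (inner ℂ (G u) (G f)).re ≤
      ‖z‖ * ‖G u‖ ^ 2 + ‖G u‖ * ∑ j, M * ‖G (d j)‖ := by
    have e1 : G f = z • G u + G (f - z • u) := by
      rw [← map_smul, ← map_add]
      congr 1
      abel
    refine (re_inner_le _ _).trans ?_
    have e2 : ‖G f‖ ≤ ‖z‖ * ‖G u‖ + ∑ j, M * ‖G (d j)‖ := by
      rw [e1, ← norm_smul]
      exact (norm_add_le _ _).trans (add_le_add_right h2 _)
    calc _ ≤ ‖G u‖ * (‖z‖ * ‖G u‖ + ∑ j, M * ‖G (d j)‖) := by gcongr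
      _ = _ := by ring
  -- The gradient part of the perturbation is absorbed completely by the term `1/2 ∑ ‖G (d j)‖²` of
  -- the energy estimate; this dictates the last summand of `K`.
  have h4 : ‖G u‖ * ∑ j, M * ‖G (d j)‖ ≤
      1 / 2 * ∑ j, ‖G (d j)‖ ^ 2 + n * M ^ 2 / 2 * ‖G u‖ ^ 2 := by
    have : (n : ℝ) * M ^ 2 / 2 * ‖G u‖ ^ 2 = ∑ _j : Fin n, M ^ 2 / 2 * ‖G u‖ ^ 2 := by
      rw [Finset.sum_const, Finset.card_univ, Fintype.card_fin, nsmul_eq_mul]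
      ring
    rw [this, Finset.mul_sum, Finset.mul_sum, ← Finset.sum_add_distrib]
    refine Finset.sum_le_sum fun j _ => ?_
    nlinarith [sq_nonneg (‖G (d j)‖ - M * ‖G u‖)]
  have h5 : 16 * K * ‖G u‖ ^ 2 = 16 * (‖z‖ * ‖G u‖ ^ 2 + n / 2 * ‖G u‖ ^ 2 +
      n * M ^ 2 / 2 * ‖G u‖ ^ 2) := by ring
  rw [h5]
  linarith

end

section

variable {n : ℕ} {V : Conf n → ℝ} {M : ℝ}

/-! ### Decay in the position variable -/

/-- The bracket of the position variable. -/
def bx (p : Phase n) : ℝ := bracket p.1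

theorem bx_nonneg (p : Phase n) : 0 ≤ bx p := (bracket_pos p.1).le

theorem bx_temperate : (bx : Phase n → ℝ).HasTemperateGrowth := bracket_temperate

theorem fderiv_bx (p m : Phase n) : fderiv ℝ bx p m = inner ℝ p.1 m.1 / bracket p.1 := by
  have h1 : HasFDerivAt (fun p : Phase n => 1 + ‖p.1‖ ^ 2) _ p :=
    ((hasStrictFDerivAt_norm_sq p.1).hasFDerivAt.comp p (hasFDerivAt_fst (p := p))).const_add 1
  have h2 : HasFDerivAt (bx : Phase n → ℝ) _ p := h1.sqrt (by positivity)
  rw [h2.fderiv]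
  have h3 := (bracket_pos p.1).ne'
  rw [bracket] at h3 ⊢
  simp
  field_simp

theorem coord_div_temperate (j : Fin n) :
    (fun p : Phase n => p.1 j / bracket p.1).HasTemperateGrowth :=
  ((EuclideanSpace.proj j : Conf n →L[ℝ] ℝ) ∘L
    ContinuousLinearMap.fst ℝ (Conf n) (Conf n)).hasTemperateGrowth.mul
      (temperate_inv bracket_temperate one_pos fun p : Phase n => one_le_bracket p.1)

section PositionWeight

variable {κ ε : ℝ} (hκ : 0 ≤ κ) (hε : 0 < ε)
include hκ hε

theorem sdv_wt_bx (j : Fin n) (u : Sch n) :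
    sdv j (smulS (toC (wt bx κ ε)) u) = smulS (toC (wt bx κ ε)) (sdv j u) := by
  refine (sder_wt bx_temperate bx_nonneg hκ hε (Function.HasTemperateGrowth.const 0)
    (fun p => ?_) u).trans ?_
  · rw [fderiv_bx, ev, inner_zero_right, zero_div]
  · rw [smulS_toC_zero, map_zero, add_zero]
    rfl

theorem sdx_wt_bx (j : Fin n) (u : Sch n) : sdx j (smulS (toC (wt bx κ ε)) u) =
    smulS (toC (wt bx κ ε)) (sdx j u) + smulS (toC (wd bx κ ε)) (smulS (cxb j) u) :=
  sder_wt bx_temperate bx_nonneg hκ hε (coord_div_temperate j) (fun p => by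
    rw [fderiv_bx, ex, EuclideanSpace.inner_single_right]
    simp) u

/-- A weight in `x` is seen only by the transport term, and `v·∇⟨x⟩ = v·x/⟨x⟩`. This is why that
operator enters `τ`. -/
theorem opT_wt_bx (z : ℂ) (u : Sch n) : opT z (smulS (toC (wt bx κ ε)) u) =
    smulS (toC (wt bx κ ε)) (opT z u) + smulS (toC (wd bx κ ε)) (smulS (cvx n) u) := by
  have hd := toC_temperate (wd_temperate (bx_temperate (n := n)) bx_nonneg hκ hε)
  have hw := toC_temperate (wt_temperate (bx_temperate (n := n)) bx_nonneg hκ hε)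
  have h1 : ∀ j u, smv j (smulS (toC (wt bx κ ε)) u) = smulS (toC (wt bx κ ε)) (smv j u) :=
    fun j u => smulS_comm (cv_temperate j) hw u
  have h2 : ∀ j (u : Sch n), smv j (smulS (toC (wd bx κ ε)) (smulS (cxb j) u)) =
      smulS (toC (wd bx κ ε)) (smulS (cxb j) (smv j u)) := fun j u => by
    have e1 : smulS (cxb j) (smv j u) = smv j (smulS (cxb j) u) :=
      smulS_comm (cxb_temperate j) (cv_temperate j) u
    rw [e1]
    exact smulS_comm (cv_temperate j) hd _
  rw [smulS_cvx]
  simp only [opT_apply, ann_apply, cre_apply, sdv_wt_bx hκ hε, sdx_wt_bx hκ hε, h1, h2, map_add,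
    map_sub, map_neg, map_smul, map_sum, Finset.sum_add_distrib]
  abel

/-- The weighted estimate for `P₀ - z`. -/
theorem norm_wt_bx_le {z : ℂ} {K : ℝ} (hκK : κ * K ≤ 1 / 2)
    (hcvx : ∀ u : Sch n, ‖emb (smulS (cvx n) u)‖ ≤ K * ‖emb (opT z u)‖) (u : Sch n) :
    ‖emb (opT z (smulS (toC (wt bx κ ε)) u))‖ ≤
      2 * ‖emb (smulS (toC (wt bx κ ε)) (opT z u))‖ := by
  have hw := toC_temperate (wt_temperate (bx_temperate (n := n)) bx_nonneg hκ hε)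
  have h1 := norm_smulS_wd_le (bx_temperate (n := n)) bx_nonneg hκ hε (smulS (cvx n) u)
  -- With the weight moved inside, `hcvx` applies to the weighted function, and the commutator costs
  -- at most half of the left-hand side.
  rw [smulS_comm hw cvx_temperate] at h1
  have h2 := h1.trans (mul_le_mul_of_nonneg_left (hcvx _) hκ)
  have h3 := congrArg emb (opT_wt_bx hκ hε z u)
  rw [map_add] at h3
  have h4 := norm_add_le (emb (smulS (toC (wt bx κ ε)) (opT z u)))
    (emb (smulS (toC (wd bx κ ε)) (smulS (cvx n) u)))
  rw [← h3] at h4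
  have h5 := mul_le_mul_of_nonneg_right hκK
    (norm_nonneg (emb (opT z (smulS (toC (wt bx κ ε)) u))))
  rw [mul_assoc] at h5
  linarith

end PositionWeight

/-- The factor `2` provides a strict inequality, since `compNorm` is an infimum that need not be
known to be attained. -/
theorem norm_cvx_le_inv_tau {z : ℂ} (hz : z ∉ halfLine) (u : Sch n) :
    ‖emb (smulS (cvx n) u)‖ ≤ 2 * (tau n z)⁻¹ * ‖emb (opT z u)‖ := by
  have hτ := inv_pos.2 (tau_pos (n := n) hz)
  have h1 : compNorm (mulVX n) (R0 n z) < ENNReal.ofReal (2 * (tau n z)⁻¹) :=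
    (compNorm_le_inv_tau hz).2.trans_lt
      ((ENNReal.ofReal_lt_ofReal_iff (by positivity)).2 (by linarith))
  obtain ⟨h2, h3⟩ := exists_bound_of_compNorm_lt h1 (emb (opT z u))
  obtain ⟨h6, h7⟩ := mulOp_emb cvx_temperate u
  have h8 : mulVX n ⟨R0 n z (emb (opT z u)), h2⟩ = mulVX n ⟨emb u, h6⟩ :=
    congrArg _ (Subtype.ext (emb_eq_R0_opT hz u).symm)
  rw [h8] at h3
  exact (congrArg norm h7).symm.trans_le h3

/-- Outside a large ball the field is smaller than `δ`. Inside, the weight is bounded by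
`exp(κ⟨x⟩)`, so `B` does not depend on `ε`. -/
theorem Vanishing.exists_le {b : Conf n → Conf n} (h : Vanishing b M) {κ δ : ℝ} (hκ : 0 ≤ κ)
    (hδ : 0 < δ) : ∃ B, 0 ≤ B ∧ ∀ ε, 0 < ε → ∀ (p : Phase n) (i : Fin n),
      |b p.1 i| * wt bx κ ε p ≤ δ * wt bx κ ε p + B := by
  have h1 : ∀ᶠ x in Filter.cocompact (Conf n), ‖b x‖ < δ := by
    have := h.tendsto.norm
    rw [norm_zero] at this
    exact this.eventually_lt_const hδ
  rw [← Metric.cobounded_eq_cocompact, ← comap_norm_atTop, Filter.eventually_comap] at h1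
  obtain ⟨S, hS⟩ := Filter.eventually_atTop.1 h1
  have hM : 0 ≤ M := (norm_nonneg _).trans (h.norm_le 0)
  refine ⟨M * Real.exp (κ * Real.sqrt (1 + S ^ 2)), by positivity, fun ε hε p i => ?_⟩
  have hb := (PiLp.norm_apply_le (b p.1) i)
  rw [Real.norm_eq_abs] at hb
  have hw := (wt_pos bx κ ε p).le
  rcases le_or_gt S ‖p.1‖ with hp | hp
  · have := (hS _ hp _ rfl).le
    have h2 : |b p.1 i| * wt bx κ ε p ≤ δ * wt bx κ ε p := by
      gcongr
      exact hb.trans this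
    have : 0 ≤ M * Real.exp (κ * Real.sqrt (1 + S ^ 2)) := by positivity
    linarith
  · have h2 : |b p.1 i| * wt bx κ ε p ≤ M * Real.exp (κ * Real.sqrt (1 + S ^ 2)) := by
      refine mul_le_mul (hb.trans (h.norm_le _)) ((wt_le_exp bx_nonneg hκ hε p).trans
        (Real.exp_le_exp.2 (mul_le_mul_of_nonneg_left (Real.sqrt_le_sqrt ?_) hκ))) hw hM
      gcongr
    have : 0 ≤ δ * wt bx κ ε p := by positivity
    linarith

/-- Exponential decay of eigenfunctions in the position variable. -/
theorem memLp_exp_bracket (h : Vanishing (gradient V) M) {z : ℂ} (hz : z ∉ halfLine) {u : L2 n}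
    (hu : HasValue (P V) u (z • u)) {κ : ℝ} (hκ : 0 ≤ κ) (hκ' : κ ≤ tau n z / 4) :
    MemLp (fun p : Phase n => ((Real.exp (κ * bracket p.1) : ℝ) : ℂ) * u p) 2 volume := by
  obtain ⟨w, f, d, y, hw, hf, hd, -, -, hfu⟩ := exists_seq_of_eigenfunction h hu
  set A : ℝ := 2 * (1 + (‖z‖ + 1) * ‖R0 n z‖) with hA
  have hA0 : 0 < A := by positivity
  -- This `δ` makes the `n` weighted gradient terms, each at most `A ‖G (f - z • u)‖`, sum to at
  -- most half of `‖G (f - z • u)‖`.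
  obtain ⟨B, hB, hb⟩ := h.exists_le (κ := κ) (δ := (2 * (n + 1) * A)⁻¹) hκ (by positivity)
  refine memLp_exp_of_wop bx_temperate bx_nonneg hκ
    (C := 2 * A * ∑ i, B * ‖d i‖) fun ε hε => ?_
  set G := wop (bx_temperate (n := n)) bx_nonneg hκ hε with hG
  have hGl : ∀ {w : ℕ → L2 n} {x : L2 n}, Filter.Tendsto w Filter.atTop (nhds x) →
      Filter.Tendsto (fun k => G (w k)) Filter.atTop (nhds (G x)) := fun h =>
    (G.continuous.tendsto _).comp h
  have hτ := tau_pos (n := n) hz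
  have hX : ∀ w : Sch n, ‖emb (opT z (smulS (toC (wt bx κ ε)) w))‖ ≤ 2 * ‖G (emb (opT z w))‖ := by
    intro w
    rw [hG, wop_emb]
    refine norm_wt_bx_le hκ hε ?_ (norm_cvx_le_inv_tau hz) w
    calc κ * (2 * (tau n z)⁻¹) ≤ tau n z / 4 * (2 * (tau n z)⁻¹) := by gcongr
      _ = 1 / 2 := by field_simp; norm_num
  have hN : ∀ w : Sch n, ‖emb w‖ ≤ ‖R0 n z‖ * ‖emb (opT z w)‖ := fun w => by
    conv_lhs => rw [emb_eq_R0_opT hz w]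
    exact (R0 n z).le_opNorm _
  have hF : ∀ w : Sch n, ‖emb (opT 0 w)‖ + ‖emb w‖ ≤ A / 2 * ‖emb (opT z w)‖ := fun w => by
    have e1 : emb (opT 0 w) = emb (opT z w) + z • emb w := by
      rw [opT_shift 0 z, map_add, map_smul, sub_zero]
    have e2 := norm_add_le (emb (opT z w)) (z • emb w)
    rw [← e1, norm_smul] at e2
    have e3 := mul_le_mul_of_nonneg_left (hN w) (by positivity : 0 ≤ ‖z‖ + 1)
    rw [hA]
    linarith
  have hGF : ∀ w : Sch n, ‖emb (opT 0 (smulS (toC (wt bx κ ε)) w))‖ +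
      ‖emb (smulS (toC (wt bx κ ε)) w)‖ ≤ A * ‖G (emb (opT z w))‖ := fun w => by
    have e1 := (hF (smulS (toC (wt bx κ ε)) w)).trans
      (mul_le_mul_of_nonneg_left (hX w) (by positivity))
    linarith
  have hGu : ∀ w : Sch n, ‖G (emb w)‖ ≤ A * ‖G (emb (opT z w))‖ := fun w => by
    rw [hG, wop_emb]
    exact le_trans (le_add_of_nonneg_left (norm_nonneg _)) (hGF w)
  have hGd : ∀ i (w : Sch n), ‖G (emb (sdv i w))‖ ≤ A * ‖G (emb (opT z w))‖ := fun i w => by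
    rw [hG, wop_emb, ← sdv_wt_bx hκ hε]
    exact (norm_sdv_le i _).trans (hGF w)
  have hfz : Filter.Tendsto (fun k => emb (opT z (w k))) Filter.atTop (nhds (f - z • u)) := by
    refine (hf.sub (hw.const_smul z)).congr fun k => ?_
    rw [opT_shift z 0, map_add, map_smul]
    module
  have hlim := (hGl hfz).norm.const_mul A
  have h1 : ‖G u‖ ≤ A * ‖G (f - z • u)‖ :=
    le_of_tendsto_of_tendsto' (hGl hw).norm hlim fun k => hGu (w k)
  have h2 : ∀ i, ‖G (d i)‖ ≤ A * ‖G (f - z • u)‖ := fun i =>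
    le_of_tendsto_of_tendsto' (hGl (hd i)).norm hlim fun k => hGd i (w k)
  have h3 := norm_wop_sum_le bx_temperate bx_nonneg hκ hε (b := fun p i => gradient V p.1 i)
    (A := (2 * (n + 1) * A)⁻¹) (B := B) (by positivity) hB (hb ε hε) hfu
  rw [Finset.sum_add_distrib] at h3
  have h4 : ∑ i, (2 * (n + 1) * A)⁻¹ * ‖G (d i)‖ ≤ 1 / 2 * ‖G (f - z • u)‖ := by
    calc _ ≤ ∑ _i : Fin n, (2 * ((n : ℝ) + 1))⁻¹ * ‖G (f - z • u)‖ := by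
          refine Finset.sum_le_sum fun i _ => ?_
          calc _ ≤ (2 * ((n : ℝ) + 1) * A)⁻¹ * (A * ‖G (f - z • u)‖) := by
                gcongr
                exact h2 i
            _ = _ := by field_simp
      _ = n / (n + 1) * (1 / 2 * ‖G (f - z • u)‖) := by
          rw [Finset.sum_const, Finset.card_univ, Fintype.card_fin, nsmul_eq_mul]
          field_simp
      _ ≤ 1 * (1 / 2 * ‖G (f - z • u)‖) := by
          gcongr
          rw [div_le_one (by positivity)]
          linarith
      _ = _ := one_mul _
  -- Absorbing the half is legitimate since the weighted norm is finite for each `ε`; the remaining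
  -- bound involves no weight.
  have h5 : ‖G (f - z • u)‖ ≤ 2 * ∑ i, B * ‖d i‖ := by linarith
  calc _ ≤ A * ‖G (f - z • u)‖ := h1
    _ ≤ A * (2 * ∑ i, B * ‖d i‖) := by gcongr
    _ = _ := by ring

/-! ### From the hypothesis on `V` to the conclusion. -/

/-- Dividing by `⟨x⟩` gives `|∇V| ≤ C⟨x⟩^{-(ρ + 1)}` with `ρ + 1 > 0`. Nothing else about `V` is
used later. -/
theorem vanishing_of_bound (hV : ContDiff ℝ 1 V) {ρ C : ℝ} (hρ : -1 < ρ)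
    (hbound : ∀ x, |V x| + bracket x * ‖gradient V x‖ ≤ C * bracket x ^ (-ρ)) :
    Vanishing (gradient V) C := by
  have h1 : ∀ x, ‖gradient V x‖ ≤ C * bracket x ^ (-(ρ + 1)) := fun x => by
    have e1 : bracket x * ‖gradient V x‖ ≤ C * bracket x ^ (-ρ) :=
      (le_add_of_nonneg_left (abs_nonneg _)).trans (hbound x)
    have e2 : bracket x ^ (-ρ) = bracket x * bracket x ^ (-(ρ + 1)) := by
      rw [show -ρ = 1 + -(ρ + 1) by ring, Real.rpow_add (bracket_pos x), Real.rpow_one]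
    rw [e2, mul_left_comm] at e1
    exact le_of_mul_le_mul_left e1 (bracket_pos x)
  have hC : 0 ≤ C := by
    have := (norm_nonneg _).trans (h1 0)
    exact nonneg_of_mul_nonneg_left this (Real.rpow_pos_of_pos (bracket_pos _) _)
  refine ⟨?_, fun x => (h1 x).trans (mul_le_of_le_one_right hC
    (Real.rpow_le_one_of_one_le_of_nonpos (one_le_bracket x) (by linarith))), ?_⟩
  · exact (InnerProductSpace.toDual ℝ (Conf n)).symm.continuous.comp
      (hV.continuous_fderiv one_ne_zero)
  · refine squeeze_zero_norm h1 ?_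
    have h2 : Filter.Tendsto (fun x : Conf n => bracket x) (Filter.cocompact (Conf n))
        Filter.atTop := by
      refine Filter.tendsto_atTop_mono (fun x => ?_) (tendsto_norm_cocompact_atTop (E := Conf n))
      exact Real.le_sqrt_of_sq_le (by linarith)
    have h3 := (tendsto_rpow_neg_atTop (by linarith : 0 < ρ + 1)).comp h2
    simpa using h3.const_mul C

end

end KFP

end

theorem theorem5p1 (n : ℕ) (hn : 1 ≤ n) (ρ : ℝ) (hρ : -1 < ρ)
    (V : KFP.Conf n → ℝ) (hV : ContDiff ℝ 1 V) (C : ℝ)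
    (hbound : ∀ x, |V x| + KFP.bracket x * ‖gradient V x‖ ≤ C * KFP.bracket x ^ (-ρ)) :
    (∀ ζ : ℂ, ζ ∉ KFP.halfLine → 0 < KFP.tau n ζ) ∧
      ∃ c₀ : ℝ, 0 < c₀ ∧
        ∀ z ∈ KFP.discreteSpectrum (KFP.P V), z ∉ KFP.halfLine ∧
          ∀ u : (KFP.P V).domain, (u : KFP.L2 n) ≠ 0 → KFP.P V u = z • (u : KFP.L2 n) →
            MeasureTheory.MemLp
              (fun p : KFP.Phase n =>
                ((Real.exp (c₀ * KFP.tau n z * (KFP.bracket p.1 + ‖p.2‖ ^ 2)) : ℝ) : ℂ) *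
                  (u : KFP.L2 n) p)
              2 MeasureTheory.volume := by
  have h := KFP.vanishing_of_bound hV hρ hbound
  refine ⟨fun ζ hζ => KFP.tau_pos hζ, 1 / 32, by norm_num, fun z hzd => ?_⟩
  have hz := KFP.discreteSpectrum_P_not_mem_halfLine h hn hzd
  refine ⟨hz, fun u _ hu => ?_⟩
  have hu' : KFP.HasValue (KFP.P V) (u : KFP.L2 n) (z • (u : KFP.L2 n)) := ⟨u.2, hu⟩
  have hτ := KFP.tau_pos (n := n) hz
  have hτ2 := KFP.tau_le_two hn hz
  -- By `τ ≤ 2` this is at most `1/8`, as the velocity decay requires, and it is below the `τ/4`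
  -- allowed in position.
  set κ := KFP.tau n z / 16 with hκ
  have h1 := KFP.memLp_exp_bracket h hz hu' (κ := κ) (by positivity) (by linarith)
  have h2 := KFP.memLp_exp_sqv h hu' (κ := κ) (by positivity) (by linarith)
  refine (h1.norm.add h2.norm).mono' ?_ (Filter.Eventually.of_forall fun p => ?_)
  · have hc : Continuous fun p : KFP.Phase n => KFP.bracket p.1 :=
      KFP.bracket_temperate.1.continuous
    exact (Continuous.aestronglyMeasurable (by fun_prop)).mul (Lp.aestronglyMeasurable _)
  · rw [Pi.add_apply, norm_mul, norm_mul, norm_mul, ← add_mul, Complex.norm_real,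
      Complex.norm_real, Complex.norm_real, Real.norm_of_nonneg (Real.exp_pos _).le,
      Real.norm_of_nonneg (Real.exp_pos _).le, Real.norm_of_nonneg (Real.exp_pos _).le]
    refine mul_le_mul_of_nonneg_right ?_ (norm_nonneg _)
    -- `(τ/32)(a + b) ≤ (τ/16) max(a, b)`, so the joint weight is at most the sum of the two
    -- separate weights.
    rcases le_total (KFP.bracket p.1) (‖p.2‖ ^ 2) with hp | hp
    · refine le_add_of_nonneg_of_le (Real.exp_pos _).le (Real.exp_le_exp.2 ?_)
      rw [hκ]
      nlinarith
    · refine le_add_of_le_of_nonneg (Real.exp_le_exp.2 ?_) (Real.exp_pos _).le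
      rw [hκ]
      nlinarith
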